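/- **Setting.** Let $d_{\rm ind}\ge 1$, $d_{\rm cls}\ge 0$, $d=d_{\rm ind}+d_{\rm cls}$. Consider a sequence of cluster samples (the sample index, suppressed below, tends to infinity). Each sample consists of $G$ clusters of nonrandom sizes $n_g\ge 1$, $n=\sum_{g\le G} n_g$, and of random variables $(Y_{gj},X_{gj})\in\mathbb R\times\mathbb R^d$, $g\le G$, $j\le n_g$, with $X_{gj}=(X_{gj}^{\rm ind},X_g^{\rm cls})\in\mathbb R^{d_{\rm ind}}\times\mathbb R^{d_{\rm cls}}$. Let $h>0$ be a bandwidth depending on the sample. Put $\mathbf X_g=(X_{g1},\dots,X_{gn_g})$. Let $k:\mathbb R\to[0,\infty)$ be a bounded, measurable, even function with $\int k=1$, $\kappa_2=\int u^2k(u)\,du<\infty$, $\int u^4k(u)\,du<\infty$; put $K(u)=\prod_{q=1}^d k(u^{(q)})$, $R_k=\int k^2$. The Nadaraya–Watson estimator at $x=(x^{\rm ind},x^{\rm cls})\in\mathbb R^d$ is $$\hat m_{\rm nw}(x)=\frac{\sum_{g}\sum_{j}K\big((X_{gj}-x)/h\big)Y_{gj}}{\sum_{g}\sum_{j}K\big((X_{gj}-x)/h\big)}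 .$$ **Assumptions.** The functions $m,\sigma^2,\sigma(\cdot,\cdot;\cdot),f,f_2,f_3,f_4$ below are measurable and do not depend on the sample. 1. (*Data-generating process.*) The data of different clusters are mutually independent. The errors $e_{gj}=Y_{gj}-m(X_{gj})$ are square integrable and satisfy $\mathbb E[e_{gj}\mid\mathbf X_g]=0$, $\mathbb E[e_{gj}^2\mid\mathbf X_g]=\sigma^2(X_{gj})$ and, for $j\ne\ell$, $\mathbb E[e_{gj}e_{g\ell}\mid\mathbf X_g]=\sigma(X_{gj}^{\rm ind},X_{g\ell}^{\rm ind};X_g^{\rm cls})$. Every $X_{gj}$ has Lebesgue density $f$; for $p\in\{2,3,4\}$ and distinct $j_1,\dots,j_p\le n_g$, the vector $(X_{gj_1}^{\rm ind},\dots,X_{gj_p}^{\rm ind};X_g^{\rm cls})$ has Lebesgue density $f_p$. 2. (*Bandwidth.*) $nh^d\to\infty$, $h\to0$ and $(\max_{g}n_g)h^{d_{\rm ind}}=O(1)$. 3. (*Smoothness.*) $f(x)>0$, and there is an open neighbourhood $\mathcal N$ of $x$ on which $m$ and $f$ are twice continuously differentiable and $\sigma^2$ is continuous; moreover $f_2$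 is continuously differentiable, and $\sigma(\cdot,\cdot;\cdot)$, $f_3$, $f_4$ are continuous, at all arguments $(x_1^{\rm ind},\dots,x_p^{\rm ind};x^{\rm cls})$ with $(x_i^{\rm ind},x^{\rm cls})\in\mathcal N$ for all $i$. 4. (*Cluster sizes.*) $\big(\frac1n\sum_{g}n_g^2\big)h^{d_{\rm ind}}\to\lambda\in[0,\infty)$. 5. (*Moments and rates.*) For some real $r\ge2$: there is a constant $\bar v$ with $\mathbb E[|e_{gj}|^{2r}\mid X_{gj}=\tilde x]\le\bar v^2$ for $\tilde x\in\mathcal N$ (all $g,j$ and all samples); $\big(\sum_g n_g^r\big)^{1/r}\big/n^{1/4}$ is bounded; and $\frac{1}{n^{r/2}h^{dr-d}}=O(1)$. Moreover $nh^{d+4}=O(1)$, $\max_g n_g^4/n\to0$, and $$R_k^{d}f(x)\sigma^2(x)+\lambda R_k^{d_{\rm cls}}f_2(x^{\rm ind},x^{\rm ind};x^{\rm cls})\,\sigma(x^{\rm ind},x^{\rm ind};x^{\rm cls})>0 .$$ 6. (*Tails.*) Either $K$ has compact support, or $f$ and $f_2$ are bounded and, for some constant $C$ and all $u\in\mathbb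 R^d$, $|m(u)|\le C(1+\|u\|)^2$ and $\sigma^2(u)\le C(1+\|u\|)^4$. **Theorem (Asymptotic normality).** Under these assumptions, with $$B_{\rm nw}(x)=\kappa_2\sum_{q=1}^d\Big(\tfrac12\partial_{qq}m(x)+f(x)^{-1}\partial_qf(x)\,\partial_qm(x)\Big),$$ one has $$\sqrt{nh^d}\,\big(\hat m_{\rm nw}(x)-m(x)-h^2B_{\rm nw}(x)\big)\overset{d}{\longrightarrow}\mathrm N\left(0,\ \frac{R_k^d\sigma^2(x)}{f(x)}+\frac{\lambda R_k^{d_{\rm cls}}f_2(x^{\rm ind},x^{\rm ind};x^{\rm cls})\,\sigma(x^{\rm ind},x^{\rm ind};x^{\rm cls})}{f(x)^2}\right).$$ -/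

import Mathlib

open MeasureTheory ProbabilityTheory Filter Topology Asymptotics

noncomputable section

/-! ## Regressors, kernels -/

/-- A regressor vector `(x_ind, x_cls)` with `dI` individual-level and `dC` cluster-level
coordinates; the volume on this type is Lebesgue measure on `ℝ ^ (dI + dC)`. -/
abbrev Regressor (dI dC : ℕ) : Type := (Fin dI → ℝ) × (Fin dC → ℝ)

/-- `k` individual-level regressor vectors of members of one cluster, together with the
cluster-level regressor vector that they share: `(x_1, …, x_k ; x_cls)`. -/
abbrev JointRegressor (k dI dC : ℕ) : Type := (Fin k → Fin dI → ℝ) × (Fin dC → ℝ)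

/-- The univariate kernel functions: nonnegative, bounded, symmetric, with integral one and
with finite second and fourth moments. -/
structure IsUnivariateKernel (k : ℝ → ℝ) : Prop where
  measurable : Measurable k
  nonneg : ∀ u, 0 ≤ k u
  bounded : ∃ kbar : ℝ, ∀ u, k u ≤ kbar
  symm : ∀ u, k (-u) = k u
  integral_eq_one : ∫ u, k u = 1
  integrable_sq : Integrable fun u => u ^ 2 * k u
  integrable_fourth : Integrable fun u => u ^ 4 * k u

/-- The second moment `κ₂ = ∫ u² k(u) du`. -/
def kernelSecondMoment (k : ℝ → ℝ) : ℝ := ∫ u, u ^ 2 * k u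

/-- The roughness `R_k = ∫ k(u)² du`. -/
def kernelRoughness (k : ℝ → ℝ) : ℝ := ∫ u, k u ^ 2

/-- The product kernel `K(u) = ∏_q k(u_q)` on `ℝ ^ (dI + dC)`. -/
def productKernel {dI dC : ℕ} (k : ℝ → ℝ) (u : Regressor dI dC) : ℝ :=
  (∏ q, k (u.1 q)) * ∏ q, k (u.2 q)

/-- The standard basis vectors of `ℝ ^ (dI + dC)`. -/
def coordVec {dI dC : ℕ} : Fin dI ⊕ Fin dC → Regressor dI dC
  | Sum.inl i => (Pi.single i 1, 0)
  | Sum.inr i => (0, Pi.single i 1)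

/-- The partial derivative `∂_q φ`. -/
def partialDeriv {dI dC : ℕ} (φ : Regressor dI dC → ℝ) (q : Fin dI ⊕ Fin dC) :
    Regressor dI dC → ℝ :=
  fun y => lineDeriv ℝ φ y (coordVec q)

/-- The Nadaraya-Watson bias constant
`κ₂ ∑_q (½ ∂_qq m(x) + f(x)⁻¹ ∂_q f(x) ∂_q m(x))`. -/
def biasNW {dI dC : ℕ} (k : ℝ → ℝ) (f m : Regressor dI dC → ℝ) (x : Regressor dI dC) : ℝ :=
  kernelSecondMoment k *
    ∑ q : Fin dI ⊕ Fin dC,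
      (1 / 2 * partialDeriv (partialDeriv m q) q x
        + (f x)⁻¹ * partialDeriv f q x * partialDeriv m q x)

/-! ## Cluster samples -/

/-- A sample of `G` clusters with nonrandom sizes `n_g ≥ 1`. Member `j` of cluster `g` has the
outcome `Y g j` and the individual-level regressors `Xind g j`; the cluster-level regressors
`Xcls g` are shared by all members of cluster `g`. -/
structure ClusterSample (dI dC : ℕ) (Ω : Type*) [MeasurableSpace Ω] where
  G : ℕ
  size : Fin G → ℕ
  size_pos : ∀ g, 0 < size g
  Xind : (g : Fin G) → Fin (size g) → Ω → (Fin dI → ℝ)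
  Xcls : Fin G → Ω → (Fin dC → ℝ)
  Y : (g : Fin G) → Fin (size g) → Ω → ℝ
  measurable_Xind : ∀ g j, Measurable (Xind g j)
  measurable_Xcls : ∀ g, Measurable (Xcls g)
  measurable_Y : ∀ g j, Measurable (Y g j)

namespace ClusterSample

variable {dI dC : ℕ} {Ω : Type*} [MeasurableSpace Ω]

/-- The number of observations `n = ∑_g n_g`. -/
def n (S : ClusterSample dI dC Ω) : ℕ := ∑ g, S.size g

/-- The largest cluster size. -/
def maxSize (S : ClusterSample dI dC Ω) : ℕ := Finset.univ.sup S.size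

/-- The regressor vector `X_{gj}` of member `j` of cluster `g`. -/
def X (S : ClusterSample dI dC Ω) (g : Fin S.G) (j : Fin (S.size g)) (ω : Ω) : Regressor dI dC :=
  (S.Xind g j ω, S.Xcls g ω)

/-- The regressors `(X_{gj_1}, …, X_{gj_k})` of some members of cluster `g`. -/
def jointX (S : ClusterSample dI dC Ω) (g : Fin S.G) {k : ℕ} (j : Fin k → Fin (S.size g)) (ω : Ω) :
    JointRegressor k dI dC :=
  (fun i => S.Xind g (j i) ω, S.Xcls g ω)

/-- The σ-algebra generated by all the regressors `𝐗_g` of cluster `g`. -/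
@[reducible] def sigmaX (S : ClusterSample dI dC Ω) (g : Fin S.G) : MeasurableSpace Ω :=
  MeasurableSpace.comap (S.jointX g id) inferInstance

/-- All the data of cluster `g`. -/
def clusterData (S : ClusterSample dI dC Ω) (g : Fin S.G) (ω : Ω) :
    (Fin (S.size g) → ℝ) × JointRegressor (S.size g) dI dC :=
  (fun j => S.Y g j ω, S.jointX g id ω)

/-- The regression error `e_{gj} = Y_{gj} - m(X_{gj})`. -/
def err (S : ClusterSample dI dC Ω) (m : Regressor dI dC → ℝ) (g : Fin S.G)
    (j : Fin (S.size g)) (ω : Ω) : ℝ :=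
  S.Y g j ω - m (S.X g j ω)

/-- The Nadaraya-Watson estimator at `x` with kernel `K = ∏ k` and bandwidth `h`. -/
def nadarayaWatson (S : ClusterSample dI dC Ω) (k : ℝ → ℝ) (h : ℝ) (x : Regressor dI dC)
    (ω : Ω) : ℝ :=
  (∑ g, ∑ j, productKernel k (h⁻¹ • (S.X g j ω - x)) * S.Y g j ω) /
    ∑ g, ∑ j, productKernel k (h⁻¹ • (S.X g j ω - x))

end ClusterSample

/-! ## Assumptions -/

section Assumptions

variable {dI dC : ℕ} {Ω : ℕ → Type*} [∀ t, MeasurableSpace (Ω t)]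

/-- The data-generating process of a sequence of cluster samples, with regression function `m`,
conditional variance function `s2`, within-cluster conditional covariance function `sc`, marginal
regressor density `f` and joint within-cluster densities `fJ k` for `k = 2, 3, 4`. None of these
functions depends on the sample `t`, the cluster `g` or the members. -/
structure IsClusterDGP (P : ∀ t, Measure (Ω t)) (S : ∀ t, ClusterSample dI dC (Ω t))
    (f : Regressor dI dC → ℝ) (fJ : (k : ℕ) → JointRegressor k dI dC → ℝ)
    (m s2 : Regressor dI dC → ℝ) (sc : JointRegressor 2 dI dC → ℝ) : Prop where
  measurable_f : Measurable f
  f_nonneg : ∀ u, 0 ≤ f u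
  measurable_fJ : ∀ k, Measurable (fJ k)
  fJ_nonneg : ∀ k z, 0 ≤ fJ k z
  measurable_m : Measurable m
  measurable_s2 : Measurable s2
  measurable_sc : Measurable sc
  /-- Different clusters are mutually independent. -/
  indep : ∀ t, iIndepFun (fun g => (S t).clusterData g) (P t)
  /-- The errors have finite second moments, so that the conditional moments below make sense. -/
  memLp_err : ∀ t g j, MemLp ((S t).err m g j) 2 (P t)
  /-- `E[e_{gj} | 𝐗_g] = 0` -/
  cond_mean : ∀ t g j, (P t)[(S t).err m g j | (S t).sigmaX g] =ᵐ[P t] 0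
  /-- `E[e_{gj}² | 𝐗_g] = σ²(X_{gj})` -/
  cond_var : ∀ t g j, (P t)[fun ω => (S t).err m g j ω ^ 2 | (S t).sigmaX g]
    =ᵐ[P t] fun ω => s2 ((S t).X g j ω)
  /-- `E[e_{gj} e_{gl} | 𝐗_g] = σ(X_{gj}^ind, X_{gl}^ind ; X_g^cls)` for `j ≠ l` -/
  cond_cov : ∀ t g j l, j ≠ l →
    (P t)[fun ω => (S t).err m g j ω * (S t).err m g l ω | (S t).sigmaX g]
    =ᵐ[P t] fun ω => sc ((S t).jointX g ![j, l] ω)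
  /-- Every `X_{gj}` has the density `f`. -/
  law_X : ∀ t g j, (P t).map ((S t).X g j) = volume.withDensity fun u => ENNReal.ofReal (f u)
  /-- For `k = 2, 3, 4`, any `k` distinct members of a cluster have the joint density `fJ k`. -/
  law_jointX : ∀ k ∈ ({2, 3, 4} : Set ℕ), ∀ t g (j : Fin k → Fin ((S t).size g)),
    Function.Injective j →
    (P t).map ((S t).jointX g j) = volume.withDensity fun z => ENNReal.ofReal (fJ k z)

/-- The points `(x_1, …, x_k ; x_cls)` with `(x_i, x_cls) ∈ N` for every `i`. -/
def jointNhd {dI dC : ℕ} (N : Set (Regressor dI dC)) (k : ℕ) : Set (JointRegressor k dI dC) :=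
  {z | ∀ i, (z.1 i, z.2) ∈ N}

/-- The point `(x_ind, …, x_ind ; x_cls)`. -/
def diagPoint {dI dC : ℕ} (k : ℕ) (x : Regressor dI dC) : JointRegressor k dI dC :=
  (fun _ => x.1, x.2)

/-- Smoothness on the neighbourhood `N` of the functions of the model. -/
structure IsSmoothModelOn (N : Set (Regressor dI dC))
    (f : Regressor dI dC → ℝ) (fJ : (k : ℕ) → JointRegressor k dI dC → ℝ)
    (m s2 : Regressor dI dC → ℝ) (sc : JointRegressor 2 dI dC → ℝ) : Prop where
  contDiffOn_m : ContDiffOn ℝ 2 m N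
  contDiffOn_f : ContDiffOn ℝ 2 f N
  contDiffOn_f2 : ContDiffOn ℝ 1 (fJ 2) (jointNhd N 2)
  continuousOn_f3 : ContinuousOn (fJ 3) (jointNhd N 3)
  continuousOn_f4 : ContinuousOn (fJ 4) (jointNhd N 4)
  continuousOn_s2 : ContinuousOn s2 N
  continuousOn_sc : ContinuousOn sc (jointNhd N 2)

/-- Bandwidth and cluster sizes: `n h^d → ∞`, `h → 0`, `(max_g n_g) h^dI = O(1)`,
`(n⁻¹ ∑_g n_g²) h^dI → lam` and `n h^(d+4) = O(1)`, with `d = dI + dC`;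
moreover `max_g n_g⁴ / n → 0`. -/
structure BandwidthCondition (S : ∀ t, ClusterSample dI dC (Ω t)) (h : ℕ → ℝ) (lam : ℝ) :
    Prop where
  pos : ∀ t, 0 < h t
  tendsto_effective : Tendsto (fun t => ((S t).n : ℝ) * h t ^ (dI + dC)) atTop atTop
  tendsto_zero : Tendsto h atTop (𝓝 0)
  maxSize_isBigO : (fun t => ((S t).maxSize : ℝ) * h t ^ dI) =O[atTop] fun _ => (1 : ℝ)
  tendsto_lam : Tendsto
    (fun t => (1 / ((S t).n : ℝ) * ∑ g, ((S t).size g : ℝ) ^ 2) * h t ^ dI) atTop (𝓝 lam)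
  bias_isBigO : (fun t => ((S t).n : ℝ) * h t ^ (dI + dC + 4)) =O[atTop] fun _ => (1 : ℝ)
  maxSize_pow_four : Tendsto (fun t => ((S t).maxSize : ℝ) ^ 4 / ((S t).n : ℝ)) atTop (𝓝 0)

/-- The moment condition of order `2r` on `N`, with the accompanying restrictions on the cluster
sizes and the bandwidth:
`E[|e|^(2r) | X = u] ≤ v²` for `u ∈ N`, `(∑_g n_g^r)^(1/r) / n^(1/4) ≤ C`, and
`1 / (n^(r/2) h^(dr-d)) = O(1)`. The conditional expectation of the nonnegative variable
`|e|^(2r)` is taken in `[0, ∞]`. -/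
structure MomentCondition (P : ∀ t, Measure (Ω t)) (S : ∀ t, ClusterSample dI dC (Ω t))
    (h : ℕ → ℝ) (m : Regressor dI dC → ℝ) (N : Set (Regressor dI dC)) (r : ℝ) : Prop where
  cond_moment : ∃ v : ℝ, ∀ t g j, ∀ᵐ ω ∂(P t), (S t).X g j ω ∈ N →
    condLExp (MeasurableSpace.comap ((S t).X g j) inferInstance) (P t)
      (fun ω => ENNReal.ofReal (|(S t).err m g j ω| ^ (2 * r))) ω ≤ ENNReal.ofReal (v ^ 2)
  sizes : ∃ C : ℝ, ∀ᶠ t in atTop,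
    (∑ g, ((S t).size g : ℝ) ^ r) ^ (1 / r) / ((S t).n : ℝ) ^ (1 / 4 : ℝ) ≤ C
  bandwidth : (fun t => 1 / (((S t).n : ℝ) ^ (r / 2)
    * h t ^ (((dI + dC : ℕ) : ℝ) * r - ((dI + dC : ℕ) : ℝ)))) =O[atTop] fun _ => (1 : ℝ)

/-- Control of the model far away from `x`, for kernels with unbounded support: `f` and `f₂` are
bounded, `m` grows at most quadratically and `σ²` at most quartically. -/
def HasModerateGrowth (f : Regressor dI dC → ℝ) (fJ : (k : ℕ) → JointRegressor k dI dC → ℝ)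
    (m s2 : Regressor dI dC → ℝ) : Prop :=
  ∃ C : ℝ, (∀ u, f u ≤ C) ∧ (∀ z, fJ 2 z ≤ C) ∧
    (∀ u, |m u| ≤ C * (1 + ‖u‖) ^ 2) ∧ (∀ u, s2 u ≤ C * (1 + ‖u‖) ^ 4)

end Assumptions

/-- The asymptotic variance
`R_k^d σ²(x) / f(x) + lam R_k^dC f₂(x_ind, x_ind; x_cls) σ(x_ind, x_ind; x_cls) / f(x)²`. -/
def asymptoticVarianceNW {dI dC : ℕ} (k : ℝ → ℝ) (lam : ℝ) (f : Regressor dI dC → ℝ)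
    (fJ : (k : ℕ) → JointRegressor k dI dC → ℝ)
    (s2 : Regressor dI dC → ℝ) (sc : JointRegressor 2 dI dC → ℝ) (x : Regressor dI dC) : ℝ :=
  kernelRoughness k ^ (dI + dC) * s2 x / f x
    + lam * kernelRoughness k ^ dC * fJ 2 (diagPoint 2 x) * sc (diagPoint 2 x) / f x ^ 2

end

/-! ## The central limit theorem for triangular arrays under Lyapunov's condition -/

/-! Write K_gj for the kernel weights, E = n h^d for the effective sample size and b for the bias
constant. Since Y = m(X) + e, the scaled estimation error is exactly a ratio (A + O + B) / F. Here F
= E⁻¹ ∑ K_gj is the kernel density estimator, A and O are E^(-1/2) ∑ K_gj e_gj over regressors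
inside and outside a small neighbourhood U of x, and B = E^(-1/2) ∑ K_gj (m(X_gj) - m(x) - h² b). It
is shown that A is asymptotically normal, that O and B tend to 0 and F to f(x) in probability;
Slutsky's lemma (`tendstoInDistribution_gaussianReal_ratio`) then divides the variance of A by
f(x)².

All second moments rest on one computation. After the substitution u = x + h v a single member of a
cluster contributes h^d times an integral over ℝ^d. A pair of members shares its cluster-level
coordinates and contributes h^(2dI+dC) = h^d h^dI times an integral in which the cluster-level
kernel is squared. Summed over clusters and divided by E, pairs carry the factor (n⁻¹ ∑ n_g²) h^dI,
which tends to λ. This bounds the sums in O, B and F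
(`IsClusterDGP.exists_tendsto_sum_integral_sq_le`) and gives the exact variance of A
(`IsClusterDGP.integral_score_sq`).

B: the kernel integral of (m - m(x)) f is expanded to second order at x. The linear term vanishes by
symmetry, and b is chosen so that the quadratic term cancels (`tendsto_integral_bias`, `biasNW_eq`).
The mean of B is thus √E · o(h²), which vanishes because n h^(d+4) is bounded.

A: its cluster summands are independent and centred, so Lyapunov's theorem of order 2r applies
(`tendstoInDistribution_sum_of_lyapunov`). Conditioning on X_gj and the power-mean inequality within
a cluster bound the 2r-th moments, and the size and bandwidth conditions make their sum vanish.
Restricting A to U is what makes the local moment bound and the local bounds on σ² and σ(·,·;·)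
sufficient. O is handled by second moments alone: for each fixed v the point x + h v eventually lies
in U. -/

theorem norm_cexp_sub_taylor_two_le (y : ℝ) :
    ‖Complex.exp (y * Complex.I) - (1 + y * Complex.I - y ^ 2 / 2)‖ ≤ 4 * |y| ^ 3 := by
  have hn : ‖(y * Complex.I : ℂ)‖ = |y| := by simp
  -- For |y| ≤ 1 this is the remainder of the exponential series. For |y| > 1 the terms 1, 1, |y|
  -- and y²/2 are at most 7/2 · |y|³ together, whence the constant 4.
  rcases le_or_gt |y| 1 with hy | hy
  · have h := Complex.exp_bound (x := y * Complex.I) (by rw [hn]; exact hy) (n := 3) (by norm_num)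
    rw [hn] at h
    have e : ∑ m ∈ Finset.range 3, (y * Complex.I : ℂ) ^ m / (m.factorial : ℂ)
        = 1 + y * Complex.I - y ^ 2 / 2 := by
      simp [Finset.sum_range_succ, Nat.factorial, mul_pow]
      ring
    rw [e] at h
    refine h.trans ?_
    have : (0 : ℝ) ≤ |y| ^ 3 := by positivity
    norm_num [Nat.factorial]
    linarith
  · have h1 : ‖Complex.exp (y * Complex.I)‖ = 1 := Complex.norm_exp_ofReal_mul_I y
    have h2 : ‖(y : ℂ) ^ 2 / 2‖ = |y| ^ 2 / 2 := by simp
    calc _ ≤ ‖Complex.exp (y * Complex.I)‖ + ‖(1 + y * Complex.I - y ^ 2 / 2 : ℂ)‖ :=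
          norm_sub_le _ _
      _ ≤ 1 + ((1 + |y|) + |y| ^ 2 / 2) := by
          rw [h1]
          gcongr
          refine (norm_sub_le _ _).trans ?_
          rw [h2]
          gcongr
          refine (norm_add_le _ _).trans ?_
          rw [hn]; simp
      _ ≤ 4 * |y| ^ 3 := by nlinarith [mul_pos (sub_pos.2 hy) (sub_pos.2 hy), abs_nonneg y]

/-- Telescoping: factors are exchanged one at a time, and all the others have norm at most one. -/
theorem norm_prod_sub_prod_le {ι : Type*} (s : Finset ι) (a b : ι → ℂ)
    (ha : ∀ i ∈ s, ‖a i‖ ≤ 1) (hb : ∀ i ∈ s, ‖b i‖ ≤ 1) :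
    ‖∏ i ∈ s, a i - ∏ i ∈ s, b i‖ ≤ ∑ i ∈ s, ‖a i - b i‖ := by
  classical
  induction s using Finset.induction_on with
  | empty => simp
  | insert i s hi ih =>
    have ih := ih (fun j hj => ha j (Finset.mem_insert_of_mem hj))
      (fun j hj => hb j (Finset.mem_insert_of_mem hj))
    rw [Finset.prod_insert hi, Finset.prod_insert hi, Finset.sum_insert hi]
    have hp : ‖∏ j ∈ s, b j‖ ≤ 1 := by
      rw [norm_prod]
      exact Finset.prod_le_one (fun _ _ => norm_nonneg _)
        (fun j hj => hb j (Finset.mem_insert_of_mem hj))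
    calc _ = ‖a i * (∏ j ∈ s, a j - ∏ j ∈ s, b j) + (a i - b i) * ∏ j ∈ s, b j‖ := by
          congr 1; ring
      _ ≤ ‖a i‖ * ‖∏ j ∈ s, a j - ∏ j ∈ s, b j‖ + ‖a i - b i‖ * ‖∏ j ∈ s, b j‖ := by
          refine (norm_add_le _ _).trans ?_
          rw [norm_mul, norm_mul]
      _ ≤ 1 * ‖∏ j ∈ s, a j - ∏ j ∈ s, b j‖ + ‖a i - b i‖ * 1 := by
          gcongr
          exact ha i (Finset.mem_insert_self _ _)
      _ ≤ _ := by linarith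

/-- Split at |y| = ε. This feeds a Lyapunov condition of any order p ≥ 3 into a cubic Taylor
remainder; the negative power of ε is harmless because ε stays fixed while the p-th moments vanish.
-/
theorem abs_cube_le_add_rpow {p ε : ℝ} (hp : 3 ≤ p) (hε : 0 < ε) (y : ℝ) :
    |y| ^ 3 ≤ ε * y ^ 2 + ε ^ (3 - p) * |y| ^ p := by
  have hy0 := abs_nonneg y
  rcases le_or_gt |y| ε with h | h
  · have : |y| ^ 3 ≤ ε * y ^ 2 := by
      rw [← sq_abs y, pow_succ']
      gcongr
    have : 0 ≤ ε ^ (3 - p) * |y| ^ p := by positivity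
    linarith
  · have hy : 0 < |y| := hε.trans h
    have h1 : |y| ^ 3 = |y| ^ (3 - p) * |y| ^ p := by
      rw [← Real.rpow_add hy, sub_add_cancel]; norm_cast
    have h2 : |y| ^ (3 - p) ≤ ε ^ (3 - p) :=
      Real.rpow_le_rpow_of_nonpos hε h.le (by linarith)
    have : |y| ^ (3 - p) * |y| ^ p ≤ ε ^ (3 - p) * |y| ^ p := by gcongr
    have : 0 ≤ ε * y ^ 2 := by positivity
    linarith

theorem sq_le_add_rpow {p ε : ℝ} (hp : 3 ≤ p) (hε : 0 < ε) (y : ℝ) :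
    y ^ 2 ≤ ε ^ 2 + ε ^ (2 - p) * |y| ^ p := by
  rcases le_or_gt |y| ε with h | h
  · have : y ^ 2 ≤ ε ^ 2 := by rw [← sq_abs y]; gcongr
    have : 0 ≤ ε ^ (2 - p) * |y| ^ p := by positivity
    linarith
  · have hy : 0 < |y| := hε.trans h
    have h1 : y ^ 2 = |y| ^ (2 - p) * |y| ^ p := by
      rw [← Real.rpow_add hy, sub_add_cancel, ← sq_abs]; norm_cast
    have h2 : |y| ^ (2 - p) ≤ ε ^ (2 - p) :=
      Real.rpow_le_rpow_of_nonpos hε h.le (by linarith)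
    have : |y| ^ (2 - p) * |y| ^ p ≤ ε ^ (2 - p) * |y| ^ p := by gcongr
    have : 0 ≤ ε ^ 2 := by positivity
    linarith

/-- Both functions are compared with 1 - s²v/2, where v is the variance. The Gaussian side costs
s⁴v²; one factor v is traded for ε² + ε^(2-p) E|Z|^p, so that summing over a row leaves a small
factor times the total variance. -/
theorem norm_charFun_sub_exp_le {Ω : Type*} [MeasurableSpace Ω] {P : Measure Ω}
    [IsProbabilityMeasure P] {Z : Ω → ℝ} (hZ : MemLp Z 2 P) (h0 : ∫ ω, Z ω ∂P = 0)
    {p : ℝ} (hp : 3 ≤ p) (hZp : Integrable (fun ω => |Z ω| ^ p) P) {ε : ℝ} (hε : 0 < ε) (s : ℝ) :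
    ‖charFun (P.map Z) s - Complex.exp (-(s ^ 2 * ∫ ω, Z ω ^ 2 ∂P) / 2 : ℝ)‖ ≤
      4 * |s| ^ 3 * (ε * ∫ ω, Z ω ^ 2 ∂P + ε ^ (3 - p) * ∫ ω, |Z ω| ^ p ∂P)
      + s ^ 4 * (ε ^ 2 + ε ^ (2 - p) * ∫ ω, |Z ω| ^ p ∂P) * ∫ ω, Z ω ^ 2 ∂P := by
  have hZ1 : Integrable Z P := hZ.integrable (by norm_num)
  have hZ2 : Integrable (fun ω => Z ω ^ 2) P := hZ.integrable_sq
  set v := ∫ ω, Z ω ^ 2 ∂P with hv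
  set L := ∫ ω, |Z ω| ^ p ∂P with hL
  have hv0 : 0 ≤ v := integral_nonneg fun ω => sq_nonneg _
  have hvle : v ≤ ε ^ 2 + ε ^ (2 - p) * L := by
    have : v ≤ ∫ ω, (ε ^ 2 + ε ^ (2 - p) * |Z ω| ^ p) ∂P :=
      integral_mono hZ2 ((integrable_const _).add (hZp.const_mul _))
        (fun ω => sq_le_add_rpow hp hε (Z ω))
    rwa [integral_add (integrable_const _) (hZp.const_mul _), integral_const_mul,
      integral_const, probReal_univ, one_smul] at this
  have hexpint : Integrable (fun ω => Complex.exp ((s * Z ω : ℝ) * Complex.I)) P := by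
    refine Integrable.of_bound (C := 1) ?_ (ae_of_all _ fun ω => ?_)
    · have := hZ.aestronglyMeasurable
      refine Continuous.comp_aestronglyMeasurable
        (g := fun y : ℝ => Complex.exp ((s * y : ℝ) * Complex.I)) (by fun_prop) this
    · rw [Complex.norm_exp_ofReal_mul_I]
  have hpolyint : Integrable (fun ω => (1 + (s * Z ω : ℝ) * Complex.I
      - ((s * Z ω : ℝ) : ℂ) ^ 2 / 2 : ℂ)) P := by
    refine ((integrable_const _).add ?_).sub ?_
    · exact ((hZ1.const_mul s).ofReal).mul_const _
    · have := (((hZ2.const_mul (s ^ 2)).ofReal (𝕜 := ℂ)).div_const 2)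
      refine this.congr (ae_of_all _ fun ω => ?_)
      simp [mul_pow]
  have hpoly : ∫ ω, (1 + (s * Z ω : ℝ) * Complex.I - ((s * Z ω : ℝ) : ℂ) ^ 2 / 2 : ℂ) ∂P
      = 1 - (s ^ 2 * v : ℝ) / 2 := by
    rw [integral_sub, integral_add (integrable_const _), integral_mul_const, integral_div]
    · have e1 : ∫ ω, ((s * Z ω : ℝ) : ℂ) ∂P = 0 := by
        rw [integral_complex_ofReal, integral_const_mul, h0]; simp
      have e2 : ∫ ω, ((s * Z ω : ℝ) : ℂ) ^ 2 ∂P = (s ^ 2 * v : ℝ) := by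
        rw [← integral_const_mul, ← integral_complex_ofReal]
        congr 1; ext ω; push_cast; ring
      rw [e1, e2]; simp
    · exact ((hZ1.const_mul s).ofReal).mul_const _
    · exact (integrable_const _).add (((hZ1.const_mul s).ofReal).mul_const _)
    · have := (((hZ2.const_mul (s ^ 2)).ofReal (𝕜 := ℂ)).div_const 2)
      refine this.congr (ae_of_all _ fun ω => ?_)
      simp [mul_pow]
  have hchar : charFun (P.map Z) s = ∫ ω, Complex.exp ((s * Z ω : ℝ) * Complex.I) ∂P := by
    rw [charFun_apply_real, integral_map hZ.aestronglyMeasurable.aemeasurable]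
    · simp
    · fun_prop
  have hA : ‖charFun (P.map Z) s - (1 - (s ^ 2 * v : ℝ) / 2)‖ ≤
      4 * |s| ^ 3 * (ε * v + ε ^ (3 - p) * L) := by
    rw [hchar, ← hpoly, ← integral_sub hexpint hpolyint]
    have hbd : Integrable (fun ω => 4 * |s| ^ 3 * (ε * Z ω ^ 2 + ε ^ (3 - p) * |Z ω| ^ p)) P :=
      ((hZ2.const_mul _).add (hZp.const_mul _)).const_mul _
    refine (norm_integral_le_of_norm_le hbd (ae_of_all _ fun ω => ?_)).trans (le_of_eq ?_)
    · refine (norm_cexp_sub_taylor_two_le _).trans ?_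
      rw [abs_mul, mul_pow, mul_assoc]
      gcongr
      exact abs_cube_le_add_rpow hp hε _
    · rw [integral_const_mul, integral_add (hZ2.const_mul _) (hZp.const_mul _),
        integral_const_mul, integral_const_mul]
  have hB : ‖(1 - (s ^ 2 * v : ℝ) / 2 : ℂ) - Complex.exp (-(s ^ 2 * v) / 2 : ℝ)‖ ≤
      s ^ 4 * v * v := by
    have e : (1 - (s ^ 2 * v : ℝ) / 2 : ℂ) - Complex.exp (-(s ^ 2 * v) / 2 : ℝ)
        = ((1 - (s ^ 2 * v) / 2 - Real.exp (-(s ^ 2 * v) / 2) : ℝ) : ℂ) := by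
      push_cast; rfl
    rw [e, Complex.norm_real, Real.norm_eq_abs]
    set w := (s ^ 2 * v) / 2 with hw
    have hw0 : 0 ≤ w := by positivity
    have e2 : -(s ^ 2 * v) / 2 = -w := by rw [hw]; ring
    have e3 : s ^ 4 * v * v = 4 * w ^ 2 := by rw [hw]; ring
    rw [e2, e3]
    have h1 := Real.add_one_le_exp (-w)
    -- Through exp(-w) ≤ 1/(1+w), since (1+w)(1-w+w²) = 1+w³ ≥ 1.
    have h2 : Real.exp (-w) ≤ 1 - w + w ^ 2 := by
      have h3 : 1 / (1 + w) ≤ 1 - w + w ^ 2 := by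
        rw [div_le_iff₀ (by positivity)]
        nlinarith [pow_nonneg hw0 3]
      have h4 : Real.exp (-w) ≤ 1 / (1 + w) := by
        rw [Real.exp_neg, ← one_div]
        exact one_div_le_one_div_of_le (by positivity) (by linarith [Real.add_one_le_exp w])
      linarith
    rw [abs_le]
    constructor <;> nlinarith [sq_nonneg w]
  calc _ ≤ ‖charFun (P.map Z) s - (1 - (s ^ 2 * v : ℝ) / 2)‖
        + ‖(1 - (s ^ 2 * v : ℝ) / 2 : ℂ) - Complex.exp (-(s ^ 2 * v) / 2 : ℝ)‖ :=
        norm_sub_le_norm_sub_add_norm_sub _ _ _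
    _ ≤ _ := by
        refine add_le_add hA (hB.trans ?_)
        gcongr

/-- Lyapunov's central limit theorem for triangular arrays with independent rows. -/
theorem tendstoInDistribution_sum_of_lyapunov {Ω : ℕ → Type*} [∀ t, MeasurableSpace (Ω t)]
    {P : ∀ t, Measure (Ω t)} [∀ t, IsProbabilityMeasure (P t)] {ι : ℕ → Type*}
    [∀ t, Fintype (ι t)] {Z : ∀ t, ι t → Ω t → ℝ}
    (hm : ∀ t i, Measurable (Z t i))
    (hind : ∀ t, iIndepFun (Z t) (P t)) {p : ℝ} (hp : 3 ≤ p) {V : ℝ}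
    (hL2 : ∀ᶠ t in atTop, ∀ i, MemLp (Z t i) 2 (P t))
    (hmean : ∀ᶠ t in atTop, ∀ i, ∫ ω, Z t i ω ∂(P t) = 0)
    (hLp : ∀ᶠ t in atTop, ∀ i, Integrable (fun ω => |Z t i ω| ^ p) (P t))
    (hvar : Tendsto (fun t => ∑ i, ∫ ω, Z t i ω ^ 2 ∂(P t)) atTop (𝓝 V))
    (hlya : Tendsto (fun t => ∑ i, ∫ ω, |Z t i ω| ^ p ∂(P t)) atTop (𝓝 0)) :
    TendstoInDistribution (fun t ω => ∑ i, Z t i ω) atTop (id : ℝ → ℝ) P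
      (gaussianReal 0 V.toNNReal) where
  forall_aemeasurable t := (Finset.measurable_sum _ fun i _ => hm t i).aemeasurable
  tendsto := by
    have hV : 0 ≤ V := ge_of_tendsto' hvar fun t =>
      Finset.sum_nonneg fun i _ => integral_nonneg fun ω => sq_nonneg _
    refine ProbabilityMeasure.tendsto_iff_tendsto_charFun.2 fun s => ?_
    simp only [ProbabilityMeasure.coe_mk, Measure.map_id]
    have hlim : charFun (gaussianReal 0 V.toNNReal) s = Complex.exp (-(s ^ 2 * V) / 2 : ℝ) := by
      rw [charFun_gaussianReal]
      congr 1
      have : ((V.toNNReal : ℝ) : ℂ) = V := by rw [Real.coe_toNNReal _ hV]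
      rw [this]; push_cast; ring
    rw [hlim]
    have hprod : ∀ t, charFun ((P t).map fun ω => ∑ i, Z t i ω) s
        = ∏ i, charFun ((P t).map (Z t i)) s := fun t => by
      rw [(hind t).charFun_map_fun_sum_eq_prod fun i => (hm t i).aemeasurable]
      simp
    have hexp : Tendsto (fun t => Complex.exp
        (-(s ^ 2 * ∑ i, ∫ ω, Z t i ω ^ 2 ∂(P t)) / 2 : ℝ)) atTop
        (𝓝 (Complex.exp (-(s ^ 2 * V) / 2 : ℝ))) := by
      refine (Complex.continuous_exp.tendsto _).comp
        ((Complex.continuous_ofReal.tendsto _).comp ?_)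
      exact ((hvar.const_mul _).neg.div_const _)
    -- The comparison is with the Gaussian that has the actual variance of row t, because its
    -- characteristic function factorizes over the row.
    suffices hdiff : Tendsto (fun t => ‖charFun ((P t).map fun ω => ∑ i, Z t i ω) s -
        Complex.exp (-(s ^ 2 * ∑ i, ∫ ω, Z t i ω ^ 2 ∂(P t)) / 2 : ℝ)‖) atTop (𝓝 0) by
      have := (tendsto_zero_iff_norm_tendsto_zero.2 hdiff).add hexp
      simpa using this
    have hbound : ∀ ε > 0, ∀ᶠ t in atTop, ‖charFun ((P t).map fun ω => ∑ i, Z t i ω) s -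
        Complex.exp (-(s ^ 2 * ∑ i, ∫ ω, Z t i ω ^ 2 ∂(P t)) / 2 : ℝ)‖ ≤
        4 * |s| ^ 3 * (ε * (∑ i, ∫ ω, Z t i ω ^ 2 ∂(P t))
          + ε ^ (3 - p) * ∑ i, ∫ ω, |Z t i ω| ^ p ∂(P t))
        + s ^ 4 * (ε ^ 2 + ε ^ (2 - p) * ∑ i, ∫ ω, |Z t i ω| ^ p ∂(P t))
          * ∑ i, ∫ ω, Z t i ω ^ 2 ∂(P t) := by
      intro ε hε
      filter_upwards [hL2, hmean, hLp] with t h2 h0 hq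
      have hpr : ∀ i, IsProbabilityMeasure ((P t).map (Z t i)) := fun i =>
        Measure.isProbabilityMeasure_map (hm t i).aemeasurable
      have hexpprod : Complex.exp (-(s ^ 2 * ∑ i, ∫ ω, Z t i ω ^ 2 ∂(P t)) / 2 : ℝ)
          = ∏ i, Complex.exp (-(s ^ 2 * ∫ ω, Z t i ω ^ 2 ∂(P t)) / 2 : ℝ) := by
        rw [← Complex.exp_sum]
        congr 1
        rw [Finset.mul_sum, ← Finset.sum_neg_distrib, Finset.sum_div]
        push_cast; rfl
      rw [hprod, hexpprod]
      refine (norm_prod_sub_prod_le _ _ _ (fun i _ => norm_charFun_le_one _) (fun i _ => ?_)).trans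
        ?_
      · rw [← Complex.ofReal_exp, Complex.norm_real, Real.norm_eq_abs, Real.abs_exp,
          Real.exp_le_one_iff]
        have : 0 ≤ ∫ ω, Z t i ω ^ 2 ∂(P t) := integral_nonneg fun ω => sq_nonneg _
        have : 0 ≤ s ^ 2 * ∫ ω, Z t i ω ^ 2 ∂(P t) := by positivity
        linarith
      · refine (Finset.sum_le_sum fun i _ =>
          norm_charFun_sub_exp_le (h2 i) (h0 i) hp (hq i) hε s).trans ?_
        rw [Finset.sum_add_distrib, ← Finset.mul_sum, Finset.sum_add_distrib, ← Finset.mul_sum,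
          ← Finset.mul_sum, Finset.mul_sum (a := s ^ 4 * _)]
        gcongr with i _
        -- The single p-th moment multiplying the i-th variance is replaced by the sum over the row,
        -- which gives a factor independent of i.
        exact Finset.single_le_sum (f := fun i => ∫ ω, |Z t i ω| ^ p ∂(P t))
          (fun j _ => integral_nonneg fun ω => by positivity) (Finset.mem_univ i)
    rw [Metric.tendsto_atTop]
    intro η hη
    -- First ε is fixed so that the limit in t of the bound is below η, then t is taken large.
    have hlimε : Tendsto (fun ε : ℝ => 4 * |s| ^ 3 * (ε * V) + s ^ 4 * ε ^ 2 * V)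
        (𝓝[>] 0) (𝓝 0) := by
      have : Continuous (fun ε : ℝ => 4 * |s| ^ 3 * (ε * V) + s ^ 4 * ε ^ 2 * V) := by fun_prop
      have := this.tendsto 0
      simp only [zero_mul, mul_zero, ne_eq, OfNat.ofNat_ne_zero, not_false_eq_true, zero_pow,
        add_zero] at this
      exact this.mono_left nhdsWithin_le_nhds
    obtain ⟨ε, hεη, hε⟩ := ((hlimε.eventually (gt_mem_nhds hη)).and self_mem_nhdsWithin).exists
    have hlimt : Tendsto (fun t => 4 * |s| ^ 3 * (ε * (∑ i, ∫ ω, Z t i ω ^ 2 ∂(P t))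
          + ε ^ (3 - p) * ∑ i, ∫ ω, |Z t i ω| ^ p ∂(P t))
        + s ^ 4 * (ε ^ 2 + ε ^ (2 - p) * ∑ i, ∫ ω, |Z t i ω| ^ p ∂(P t))
          * ∑ i, ∫ ω, Z t i ω ^ 2 ∂(P t)) atTop
        (𝓝 (4 * |s| ^ 3 * (ε * V + ε ^ (3 - p) * 0) + s ^ 4 * (ε ^ 2 + ε ^ (2 - p) * 0) * V)) :=
      (((hvar.const_mul _).add (hlya.const_mul _)).const_mul _).add
        (((tendsto_const_nhds.add (hlya.const_mul _)).const_mul _).mul hvar)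
    simp only [mul_zero, add_zero] at hlimt
    obtain ⟨T, hT⟩ := ((hlimt.eventually (gt_mem_nhds hεη)).and
      (hbound ε hε)).exists_forall_of_atTop
    refine ⟨T, fun t ht => ?_⟩
    rw [Real.dist_eq, sub_zero, abs_of_nonneg (norm_nonneg _)]
    exact (hT t ht).2.trans_lt (hT t ht).1

/-! ## Slutsky's theorem for random variables on varying probability spaces -/

/-- Hypotheses and conclusion involve only the laws within each row, so all rows may be placed on
the single infinite product space, where Slutsky's theorem on a fixed space applies. -/
theorem tendstoInDistribution_comp_prodMk {Ω : ℕ → Type*} [∀ t, MeasurableSpace (Ω t)]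
    {P : ∀ t, Measure (Ω t)} [∀ t, IsProbabilityMeasure (P t)] {Ω' : Type*} [MeasurableSpace Ω']
    {P' : Measure Ω'} [IsProbabilityMeasure P'] {E : Type*} [NormedAddCommGroup E]
    [MeasurableSpace E] [BorelSpace E] [SecondCountableTopology E]
    {X : ∀ t, Ω t → ℝ} {Y : ∀ t, Ω t → E} {Z : Ω' → ℝ} {c : E} {g : ℝ × E → ℝ}
    (hg : Continuous g) (hX : TendstoInDistribution X atTop Z P P')
    (hXm : ∀ t, Measurable (X t)) (hYm : ∀ t, Measurable (Y t))
    (hY : ∀ ε > 0, Tendsto (fun t => P t {ω | ε ≤ ‖Y t ω - c‖}) atTop (𝓝 0)) :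
    TendstoInDistribution (fun t ω => g (X t ω, Y t ω)) atTop (fun ω => g (Z ω, c)) P P' := by
  set Q := Measure.infinitePi P with hQ
  have hmp : ∀ t, MeasurePreserving (Function.eval t) Q (P t) := fun t =>
    measurePreserving_eval_infinitePi P t
  have hmap : ∀ (t : ℕ) (W : Ω t → ℝ), Measurable W →
      Q.map (fun ω => W (ω t)) = (P t).map W := fun t W hW => by
    rw [← (hmp t).map_eq, Measure.map_map hW (measurable_pi_apply t)]; rfl
  have hX' : TendstoInDistribution (fun t ω => X t (ω t)) atTop Z (fun _ => Q) P' :=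
    ⟨fun t => ((hXm t).comp (measurable_pi_apply t)).aemeasurable, hX.aemeasurable_limit,
      hX.tendsto.congr fun t => Subtype.ext (hmap t _ (hXm t)).symm⟩
  have hY' : TendstoInMeasure Q (fun t ω => Y t (ω t)) atTop (fun _ => c) := by
    rw [tendstoInMeasure_iff_norm]
    intro ε hε
    refine (hY ε hε).congr fun t => ?_
    have hs : MeasurableSet {ω | ε ≤ ‖Y t ω - c‖} :=
      measurableSet_le measurable_const ((hYm t).sub_const c).norm
    rw [← (hmp t).measure_preimage hs.nullMeasurableSet]
    rfl
  have := hX'.continuous_comp_prodMk_of_tendstoInMeasure_const hg hY'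
    (fun t => ((hYm t).comp (measurable_pi_apply t)).aemeasurable)
  have hgm : ∀ t, Measurable fun ω => g (X t ω, Y t ω) := fun t =>
    hg.measurable.comp ((hXm t).prodMk (hYm t))
  refine ⟨fun t => (hgm t).aemeasurable, this.aemeasurable_limit,
    this.tendsto.congr fun t => Subtype.ext (hmap t _ (hgm t))⟩

/-! ## Moments of product kernels -/

namespace IsUnivariateKernel

variable {k : ℝ → ℝ} (hk : IsUnivariateKernel k)
include hk

theorem integrable : Integrable k :=
  Integrable.of_integral_ne_zero (by rw [hk.integral_eq_one]; exact one_ne_zero)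

theorem integrable_pow_mul {a : ℕ} (ha : a ≤ 4) : Integrable fun u => u ^ a * k u := by
  refine (hk.integrable.add hk.integrable_fourth).mono'
    ((by fun_prop : Measurable fun u : ℝ => u ^ a).mul hk.measurable).aestronglyMeasurable
    (ae_of_all _ fun u => ?_)
  rw [Real.norm_eq_abs, abs_mul, abs_of_nonneg (hk.nonneg u), Pi.add_apply]
  have h1 : |u ^ a| ≤ 1 + u ^ 4 := by
    rw [abs_pow]
    have h4 : |u| ^ 4 = u ^ 4 := by
      rw [← abs_pow]; exact abs_of_nonneg (by positivity)
    rcases le_total |u| 1 with h | h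
    · have := pow_le_one₀ (n := a) (abs_nonneg u) h
      have : 0 ≤ u ^ 4 := by positivity
      linarith
    · have := pow_le_pow_right₀ h ha
      rw [h4] at this; linarith
  nlinarith [hk.nonneg u]

theorem integral_odd {a : ℕ} (ha : Odd a) : ∫ u, u ^ a * k u = 0 := by
  have h := integral_neg_eq_self (fun u => u ^ a * k u) (volume : Measure ℝ)
  have h2 : ∀ u, (-u) ^ a * k (-u) = -(u ^ a * k u) := fun u => by
    rw [ha.neg_pow, hk.symm]; ring
  simp_rw [h2, integral_neg] at h
  linarith

theorem exists_bound : ∃ b : ℝ, 1 ≤ b ∧ ∀ u, k u ≤ b := by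
  obtain ⟨b, hb⟩ := hk.bounded
  exact ⟨max 1 b, le_max_left _ _, fun u => (hb u).trans (le_max_right _ _)⟩

end IsUnivariateKernel

/-- The product kernel `∏_q k(v_q)` on `ι → ℝ`. -/
noncomputable def piKernel {ι : Type*} [Fintype ι] (k : ℝ → ℝ) (v : ι → ℝ) : ℝ := ∏ q, k (v q)

theorem productKernel_eq {dI dC : ℕ} (k : ℝ → ℝ) (u : Regressor dI dC) :
    productKernel k u = piKernel k u.1 * piKernel k u.2 := rfl

namespace IsUnivariateKernel

section Pi

variable {ι : Type*} [Fintype ι] {k : ℝ → ℝ} (hk : IsUnivariateKernel k)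
include hk

theorem piKernel_nonneg (v : ι → ℝ) : 0 ≤ piKernel k v :=
  Finset.prod_nonneg fun _ _ => hk.nonneg _

theorem measurable_piKernel : Measurable (piKernel k : (ι → ℝ) → ℝ) :=
  Finset.measurable_prod _ fun q _ => hk.measurable.comp (measurable_pi_apply q)

theorem integrable_piKernel_mul_prod_pow {a : ι → ℕ} (ha : ∀ q, a q ≤ 4) :
    Integrable fun v : ι → ℝ => (∏ q, v q ^ a q) * piKernel k v := by
  simp_rw [piKernel, ← Finset.prod_mul_distrib]
  exact Integrable.fintype_prod (f := fun q u => u ^ a q * k u)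
    fun q => hk.integrable_pow_mul (ha q)

omit hk in
theorem integral_piKernel_mul_prod_pow (a : ι → ℕ) :
    ∫ v : ι → ℝ, (∏ q, v q ^ a q) * piKernel k v = ∏ q, ∫ u, u ^ a q * k u := by
  simp_rw [piKernel, ← Finset.prod_mul_distrib]
  exact integral_fintype_prod_volume_eq_prod (fun q u => u ^ a q * k u)

/-- The weight (1 + ‖v‖)⁴ is the common dominating function of the limit arguments: σ² and the
square of m - m(x) are bounded by multiples of it where needed. The sup norm is attained at a
coordinate, so ‖v‖⁴ ≤ ∑ v_q⁴ and fourth moments of k suffice. -/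
theorem integrable_weight_piKernel :
    Integrable fun v : ι → ℝ => (1 + ‖v‖) ^ 4 * piKernel k v := by
  classical
  have h0 : Integrable fun v : ι → ℝ => piKernel k v := by
    simpa using hk.integrable_piKernel_mul_prod_pow (ι := ι) (a := fun _ => 0) (by simp)
  have h4 : ∀ q : ι, Integrable fun v : ι → ℝ => v q ^ 4 * piKernel k v := fun q => by
    have := hk.integrable_piKernel_mul_prod_pow (ι := ι) (a := Pi.single q 4) (fun p => by
      by_cases h : p = q
      · subst h; simp
      · simp [h])
    refine this.congr (ae_of_all _ fun v => ?_)
    simp only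
    congr 1
    rw [Finset.prod_eq_single q]
    · simp
    · intro p _ hp; simp [hp]
    · simp
  have hsum : Integrable fun v : ι → ℝ => 8 * (piKernel k v + ∑ q, v q ^ 4 * piKernel k v) :=
    (h0.add (integrable_finsetSum _ fun q _ => h4 q)).const_mul 8
  refine hsum.mono' ((by fun_prop : Measurable fun v : ι → ℝ => (1 + ‖v‖) ^ 4).mul
    hk.measurable_piKernel).aestronglyMeasurable (ae_of_all _ fun v => ?_)
  have hk0 := hk.piKernel_nonneg v
  rw [Real.norm_eq_abs, abs_of_nonneg (by positivity), ← Finset.sum_mul]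
  have hn : ‖v‖ ^ 4 ≤ ∑ q, v q ^ 4 := by
    rcases isEmpty_or_nonempty ι with hι | hι
    · simp [Subsingleton.elim v 0]
    · obtain ⟨q, hq⟩ := Finite.exists_max fun q => ‖v q‖
      have hq' : ‖v‖ ≤ ‖v q‖ := (pi_norm_le_iff_of_nonneg (norm_nonneg _)).2 hq
      refine (pow_le_pow_left₀ (norm_nonneg _) hq' 4).trans ?_
      refine le_trans (le_of_eq ?_) (Finset.single_le_sum (f := fun q => v q ^ 4)
        (fun _ _ => by positivity) (Finset.mem_univ q))
      rw [Real.norm_eq_abs, ← abs_pow, abs_of_nonneg (by positivity)]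
  -- The constant 8 = 2³ is the one from convexity of the fourth power.
  have h1 : (1 + ‖v‖) ^ 4 ≤ 8 * (1 + ‖v‖ ^ 4) := by
    nlinarith [sq_nonneg (‖v‖ - 1), sq_nonneg (‖v‖ ^ 2 - 1), sq_nonneg (‖v‖ ^ 2 - ‖v‖),
      norm_nonneg v]
  have h2 : (1 + ‖v‖) ^ 4 ≤ 8 * (1 + ∑ q, v q ^ 4) := h1.trans (by linarith)
  calc _ ≤ 8 * (1 + ∑ q, v q ^ 4) * piKernel k v := by gcongr
    _ = _ := by ring

theorem integrable_piKernel : Integrable fun v : ι → ℝ => piKernel k v := by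
  simpa using hk.integrable_piKernel_mul_prod_pow (ι := ι) (a := fun _ => 0) (by simp)

theorem integral_piKernel : ∫ v : ι → ℝ, piKernel k v = 1 := by
  have := integral_piKernel_mul_prod_pow (ι := ι) (k := k) (fun _ => 0)
  simpa [hk.integral_eq_one] using this

omit hk in
theorem integral_piKernel_sq :
    ∫ v : ι → ℝ, piKernel k v ^ 2 = kernelRoughness k ^ Fintype.card ι := by
  simp_rw [piKernel, ← Finset.prod_pow]
  exact integral_fintype_prod_volume_eq_pow (fun u => k u ^ 2)

theorem piKernel_sq_le {b : ℝ} (hb : ∀ u, k u ≤ b) (v : ι → ℝ) :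
    piKernel k v ^ 2 ≤ b ^ Fintype.card ι * piKernel k v := by
  rw [sq]
  have := hk.piKernel_nonneg v
  gcongr
  refine (Finset.prod_le_prod (fun _ _ => hk.nonneg _) (fun q _ => hb (v q))).trans ?_
  simp

theorem integrable_weight_piKernel_sq :
    Integrable fun v : ι → ℝ => (1 + ‖v‖) ^ 4 * piKernel k v ^ 2 := by
  obtain ⟨b, -, hb⟩ := hk.exists_bound
  refine (hk.integrable_weight_piKernel.const_mul (b ^ Fintype.card ι)).mono'
    ((by fun_prop : Measurable fun v : ι → ℝ => (1 + ‖v‖) ^ 4).mul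
      (hk.measurable_piKernel.pow_const 2)).aestronglyMeasurable (ae_of_all _ fun v => ?_)
  rw [Real.norm_eq_abs, abs_of_nonneg (by positivity)]
  have := hk.piKernel_sq_le hb v
  calc _ ≤ (1 + ‖v‖) ^ 4 * (b ^ Fintype.card ι * piKernel k v) := by gcongr
    _ = _ := by ring

end Pi

section Product

variable {dI dC : ℕ} {k : ℝ → ℝ} (hk : IsUnivariateKernel k)
include hk

theorem productKernel_nonneg (u : Regressor dI dC) : 0 ≤ productKernel k u :=
  mul_nonneg (hk.piKernel_nonneg _) (hk.piKernel_nonneg _)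

theorem measurable_productKernel : Measurable (productKernel k : Regressor dI dC → ℝ) :=
  (hk.measurable_piKernel.comp measurable_fst).mul (hk.measurable_piKernel.comp measurable_snd)

theorem exists_productKernel_bound :
    ∃ b : ℝ, 1 ≤ b ∧ ∀ u : Regressor dI dC, productKernel k u ≤ b := by
  obtain ⟨b, hb1, hb⟩ := hk.exists_bound
  refine ⟨b ^ dI * b ^ dC, one_le_mul_of_one_le_of_one_le (one_le_pow₀ hb1) (one_le_pow₀ hb1),
    fun u => ?_⟩
  rw [productKernel]
  refine mul_le_mul ?_ ?_ (hk.piKernel_nonneg _) (by positivity)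
  · refine (Finset.prod_le_prod (fun _ _ => hk.nonneg _) (fun q _ => hb (u.1 q))).trans ?_
    simp
  · refine (Finset.prod_le_prod (fun _ _ => hk.nonneg _) (fun q _ => hb (u.2 q))).trans ?_
    simp

omit hk in
theorem weight_le (u : Regressor dI dC) :
    (1 + ‖u‖) ^ 4 ≤ (1 + ‖u.1‖) ^ 4 * (1 + ‖u.2‖) ^ 4 := by
  rw [← mul_pow]
  have h : ‖u‖ ≤ ‖u.1‖ + ‖u.2‖ := by
    rw [Prod.norm_def]
    exact max_le_add_of_nonneg (norm_nonneg _) (norm_nonneg _)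
  gcongr
  nlinarith [norm_nonneg u.1, norm_nonneg u.2, mul_nonneg (norm_nonneg u.1) (norm_nonneg u.2)]

theorem integrable_weight_productKernel :
    Integrable fun u : Regressor dI dC => (1 + ‖u‖) ^ 4 * productKernel k u := by
  have := (hk.integrable_weight_piKernel (ι := Fin dI)).mul_prod
    (hk.integrable_weight_piKernel (ι := Fin dC))
  refine this.mono' ((by fun_prop : Measurable fun v : Regressor dI dC => (1 + ‖v‖) ^ 4).mul
    hk.measurable_productKernel).aestronglyMeasurable (ae_of_all _ fun u => ?_)
  have h1 := hk.productKernel_nonneg u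
  rw [Real.norm_eq_abs, abs_of_nonneg (by positivity)]
  calc _ ≤ ((1 + ‖u.1‖) ^ 4 * (1 + ‖u.2‖) ^ 4) * productKernel k u := by
        gcongr; exact weight_le u
    _ = _ := by rw [productKernel_eq]; ring

theorem integrable_weight_productKernel_sq :
    Integrable fun u : Regressor dI dC => (1 + ‖u‖) ^ 4 * productKernel k u ^ 2 := by
  obtain ⟨b, -, hb⟩ := hk.exists_productKernel_bound (dI := dI) (dC := dC)
  refine (hk.integrable_weight_productKernel.const_mul b).mono'
    ((by fun_prop : Measurable fun v : Regressor dI dC => (1 + ‖v‖) ^ 4).mul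
    (hk.measurable_productKernel.pow_const 2)).aestronglyMeasurable (ae_of_all _ fun u => ?_)
  have h1 := hk.productKernel_nonneg u
  rw [Real.norm_eq_abs, abs_of_nonneg (by positivity)]
  calc _ ≤ (1 + ‖u‖) ^ 4 * (b * productKernel k u) := by
        rw [sq]; gcongr; exact hb u
    _ = _ := by ring

theorem integral_productKernel : ∫ u : Regressor dI dC, productKernel k u = 1 := by
  have := integral_prod_mul (μ := (volume : Measure (Fin dI → ℝ)))
    (ν := (volume : Measure (Fin dC → ℝ))) (piKernel k) (piKernel k)
  rw [hk.integral_piKernel, hk.integral_piKernel, mul_one] at this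
  exact this

omit hk in
theorem integral_productKernel_sq :
    ∫ u : Regressor dI dC, productKernel k u ^ 2 = kernelRoughness k ^ (dI + dC) := by
  have := integral_prod_mul (μ := (volume : Measure (Fin dI → ℝ)))
    (ν := (volume : Measure (Fin dC → ℝ))) (fun v => piKernel k v ^ 2) (fun v => piKernel k v ^ 2)
  rw [integral_piKernel_sq, integral_piKernel_sq, Fintype.card_fin, Fintype.card_fin,
    ← pow_add] at this
  rw [← this]
  refine integral_congr_ae (ae_of_all _ fun u => ?_)
  simp only [productKernel_eq, mul_pow]

end Product

end IsUnivariateKernel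

/-- The coordinates of a regressor vector. -/
def Regressor.coord {dI dC : ℕ} (u : Regressor dI dC) : Fin dI ⊕ Fin dC → ℝ
  | Sum.inl i => u.1 i
  | Sum.inr i => u.2 i

theorem Regressor.sum_coord_smul {dI dC : ℕ} (u : Regressor dI dC) :
    ∑ q, u.coord q • (coordVec q : Regressor dI dC) = u := by
  rw [Fintype.sum_sum_type]
  refine Prod.ext ?_ ?_
  · ext i
    simp [Regressor.coord, coordVec, Prod.fst_sum, Finset.sum_apply, Pi.single_apply]
  · ext i
    simp [Regressor.coord, coordVec, Prod.snd_sum, Finset.sum_apply, Pi.single_apply]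

namespace IsUnivariateKernel

variable {dI dC : ℕ} {k : ℝ → ℝ}

theorem integral_prod_coord_pow (a : Fin dI ⊕ Fin dC → ℕ) :
    ∫ u : Regressor dI dC, (∏ q, u.coord q ^ a q) * productKernel k u
      = ∏ q, ∫ u, u ^ a q * k u := by
  have := integral_prod_mul (μ := (volume : Measure (Fin dI → ℝ)))
    (ν := (volume : Measure (Fin dC → ℝ)))
    (fun v => (∏ q, v q ^ a (Sum.inl q)) * piKernel k v)
    (fun v => (∏ q, v q ^ a (Sum.inr q)) * piKernel k v)
  rw [integral_piKernel_mul_prod_pow (fun q => a (Sum.inl q)),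
    integral_piKernel_mul_prod_pow (fun q => a (Sum.inr q))] at this
  rw [Fintype.prod_sum_type, ← this]
  refine integral_congr_ae (ae_of_all _ fun u => ?_)
  simp only [productKernel_eq, Fintype.prod_sum_type, Regressor.coord]
  ring

variable (hk : IsUnivariateKernel k)
include hk

theorem integral_coord_mul (p : Fin dI ⊕ Fin dC) :
    ∫ u : Regressor dI dC, u.coord p * productKernel k u = 0 := by
  have := integral_prod_coord_pow (k := k) (Pi.single p 1 : Fin dI ⊕ Fin dC → ℕ)
  rw [Finset.prod_eq_zero (Finset.mem_univ p)] at this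
  · rw [← this]
    congr 1; ext u; congr 1
    rw [Finset.prod_eq_single p]
    · simp
    · intro q _ hq; simp [hq]
    · simp
  · simpa using hk.integral_odd (a := 1) odd_one

theorem integral_coord_mul_coord_mul (p q : Fin dI ⊕ Fin dC) :
    ∫ u : Regressor dI dC, u.coord p * u.coord q * productKernel k u
      = if p = q then kernelSecondMoment k else 0 := by
  have := integral_prod_coord_pow (k := k) (Pi.single p 1 + Pi.single q 1 : Fin dI ⊕ Fin dC → ℕ)
  have e : ∀ u : Regressor dI dC, ∏ s, u.coord s ^ ((Pi.single p 1 + Pi.single q 1 :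
      Fin dI ⊕ Fin dC → ℕ) s) = u.coord p * u.coord q := fun u => by
    simp_rw [Pi.add_apply, pow_add, Finset.prod_mul_distrib]
    congr 1
    · rw [Finset.prod_eq_single p]
      · simp
      · intro q _ hq; simp [hq]
      · simp
    · rw [Finset.prod_eq_single q]
      · simp
      · intro q _ hq; simp [hq]
      · simp
  simp_rw [e] at this
  rw [this]
  split_ifs with h
  · subst h
    rw [Finset.prod_eq_single p]
    · simp [kernelSecondMoment]
    · intro q _ hq; simp [hq, hk.integral_eq_one]
    · simp
  · refine Finset.prod_eq_zero (Finset.mem_univ p) ?_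
    simpa [h] using hk.integral_odd (a := 1) odd_one

end IsUnivariateKernel

/-! ### The kernel weight of a pair of cluster members -/

/-- The weight `K(z_1, z_cls) K(z_2, z_cls)`. -/
noncomputable def pairKernel {dI dC : ℕ} (k : ℝ → ℝ) (z : JointRegressor 2 dI dC) : ℝ :=
  productKernel k (z.1 0, z.2) * productKernel k (z.1 1, z.2)

namespace IsUnivariateKernel

variable {dI dC : ℕ} {k : ℝ → ℝ}

/-- The individual-level coordinates separate, while the shared cluster-level kernel is squared.
This is the origin of R_k^dC, without any R_k^dI, in the covariance part of the variance. -/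
theorem pairKernel_eq (z : JointRegressor 2 dI dC) :
    pairKernel k z = (∏ i, piKernel k (z.1 i)) * piKernel k z.2 ^ 2 := by
  rw [pairKernel, productKernel_eq, productKernel_eq, Fin.prod_univ_two]; ring

variable (hk : IsUnivariateKernel k)
include hk

theorem pairKernel_nonneg (z : JointRegressor 2 dI dC) : 0 ≤ pairKernel k z :=
  mul_nonneg (hk.productKernel_nonneg _) (hk.productKernel_nonneg _)

theorem measurable_pairKernel : Measurable (pairKernel k : JointRegressor 2 dI dC → ℝ) := by
  refine (hk.measurable_productKernel.comp ?_).mul (hk.measurable_productKernel.comp ?_) <;>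
    fun_prop

theorem integral_pairKernel :
    ∫ z : JointRegressor 2 dI dC, pairKernel k z = kernelRoughness k ^ dC := by
  have := integral_prod_mul (μ := (volume : Measure (Fin 2 → Fin dI → ℝ)))
    (ν := (volume : Measure (Fin dC → ℝ))) (fun v => ∏ i, piKernel k (v i))
    (fun v => piKernel k v ^ 2)
  rw [integral_fintype_prod_volume_eq_prod (fun _ v => piKernel k v), integral_piKernel_sq,
    Fintype.card_fin] at this
  simp_rw [pairKernel_eq]
  refine Eq.trans this ?_
  simp [hk.integral_piKernel]

/-- A weight on one member of the pair is enough, because products of two summands are later bounded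
by squares of single ones. -/
theorem integrable_weight_pairKernel :
    Integrable fun z : JointRegressor 2 dI dC => (1 + ‖(z.1 0, z.2)‖) ^ 4 * pairKernel k z := by
  have h1 : Integrable fun v : Fin 2 → Fin dI → ℝ =>
      ∏ i, (![fun v => (1 + ‖v‖) ^ 4 * piKernel k v, piKernel k] : Fin 2 → (Fin dI → ℝ) → ℝ)
        i (v i) := by
    refine Integrable.fintype_prod (f := (![fun v => (1 + ‖v‖) ^ 4 * piKernel k v, piKernel k] :
      Fin 2 → (Fin dI → ℝ) → ℝ)) fun i => ?_
    fin_cases i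
    · exact hk.integrable_weight_piKernel
    · exact hk.integrable_piKernel
  refine (h1.mul_prod (hk.integrable_weight_piKernel_sq (ι := Fin dC))).mono' ?_
    (ae_of_all _ fun z => ?_)
  · refine (Measurable.mul ?_ hk.measurable_pairKernel).aestronglyMeasurable
    fun_prop
  · have h1 := hk.pairKernel_nonneg z
    rw [Real.norm_eq_abs, abs_of_nonneg (by positivity)]
    calc _ ≤ ((1 + ‖z.1 0‖) ^ 4 * (1 + ‖z.2‖) ^ 4) * pairKernel k z := by
          gcongr; exact weight_le (z.1 0, z.2)
      _ = _ := by
          rw [pairKernel_eq]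
          simp only [Fin.prod_univ_two, Matrix.cons_val_zero, Matrix.cons_val_one]
          ring

end IsUnivariateKernel

/-! ## Rescaled integrals -/

section Rescale

variable {E : Type*} [NormedAddCommGroup E] [NormedSpace ℝ E] [FiniteDimensional ℝ E]
  [MeasureSpace E] [BorelSpace E] [(volume : Measure E).IsAddHaarMeasure]

theorem integral_eq_rescale (x : E) {h : ℝ} (hh : 0 < h) (φ : E → ℝ) :
    ∫ u, φ u = h ^ Module.finrank ℝ E * ∫ v, φ (x + h • v) := by
  have h1 := Measure.integral_comp_smul (volume : Measure E) (fun u => φ (x + u)) h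
  rw [h1, integral_add_left_eq_self, abs_of_pos (by positivity), smul_eq_mul,
    mul_inv_cancel_left₀ (by positivity)]

theorem integrable_rescale_iff (x : E) {h : ℝ} (hh : 0 < h) (φ : E → ℝ) :
    Integrable (fun v => φ (x + h • v)) ↔ Integrable φ := by
  rw [integrable_comp_smul_iff (volume : Measure E) (fun u => φ (x + u)) hh.ne']
  refine ⟨fun hi => ?_, fun hi => hi.comp_add_left x⟩
  simpa using hi.comp_add_left (-x)

variable {Ω : Type*} [MeasurableSpace Ω] {P : Measure Ω} {X : Ω → E} {f : E → ℝ}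

theorem integral_comp_eq_rescale (hX : Measurable X) (hf : Measurable f) (hf0 : ∀ u, 0 ≤ f u)
    (hlaw : P.map X = volume.withDensity fun u => ENNReal.ofReal (f u))
    {φ : E → ℝ} (hφ : Measurable φ) (x : E) {h : ℝ} (hh : 0 < h) :
    ∫ ω, φ (X ω) ∂P
      = h ^ Module.finrank ℝ E * ∫ v, φ (x + h • v) * f (x + h • v) := by
  rw [← integral_map hX.aemeasurable hφ.aestronglyMeasurable, hlaw,
    integral_withDensity_eq_integral_toReal_smul hf.ennreal_ofReal (by simp),
    integral_eq_rescale x hh]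
  simp_rw [ENNReal.toReal_ofReal (hf0 _), smul_eq_mul, mul_comm (f _)]

theorem integrable_comp_iff_rescale (hX : Measurable X) (hf : Measurable f) (hf0 : ∀ u, 0 ≤ f u)
    (hlaw : P.map X = volume.withDensity fun u => ENNReal.ofReal (f u))
    {φ : E → ℝ} (hφ : Measurable φ) (x : E) {h : ℝ} (hh : 0 < h) :
    Integrable (fun ω => φ (X ω)) P
      ↔ Integrable fun v => φ (x + h • v) * f (x + h • v) := by
  have := integrable_map_measure (μ := P) (f := X) (g := φ) hφ.aestronglyMeasurable hX.aemeasurable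
  rw [Function.comp_def] at this
  rw [← this, hlaw, integrable_withDensity_iff_integrable_smul' hf.ennreal_ofReal (by simp),
    ← integrable_rescale_iff x hh]
  simp_rw [ENNReal.toReal_ofReal (hf0 _), smul_eq_mul, mul_comm (f _)]

end Rescale

/-- Dominated convergence, with domination required only where w is nonzero: for a compactly
supported kernel nothing is known about the model elsewhere. Integrability is recorded as well,
since the integral of a nonintegrable function is 0 by convention and later identities need genuine
integrals. -/
theorem tendsto_integral_weight_mul {α : Type*} [MeasurableSpace α] {μ : Measure α}
    {w D : α → ℝ} (hw : Measurable w) (hw0 : ∀ v, 0 ≤ w v)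
    (hwD : Integrable (fun v => D v * w v) μ) {F : ℕ → α → ℝ} {c : α → ℝ} {C : ℝ}
    (hF : ∀ t, Measurable (F t))
    (hbd : ∀ᶠ t in atTop, ∀ v, w v ≠ 0 → |F t v| ≤ C * D v)
    (hlim : ∀ v, Tendsto (fun t => F t v) atTop (𝓝 (c v))) :
    (∀ᶠ t in atTop, Integrable (fun v => w v * F t v) μ) ∧
      Tendsto (fun t => ∫ v, w v * F t v ∂μ) atTop (𝓝 (∫ v, w v * c v ∂μ)) := by
  have hb : ∀ᶠ t in atTop, ∀ v, ‖w v * F t v‖ ≤ C * (D v * w v) := by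
    filter_upwards [hbd] with t ht v
    rw [Real.norm_eq_abs, abs_mul, abs_of_nonneg (hw0 v)]
    by_cases h : w v = 0
    · simp [h]
    · calc _ ≤ w v * (C * D v) := mul_le_mul_of_nonneg_left (ht v h) (hw0 v)
        _ = _ := by ring
  constructor
  · filter_upwards [hb] with t ht
    exact (hwD.const_mul C).mono' (hw.mul (hF t)).aestronglyMeasurable (ae_of_all _ ht)
  · refine tendsto_integral_filter_of_dominated_convergence (fun v => C * (D v * w v))
      (Eventually.of_forall fun t => (hw.mul (hF t)).aestronglyMeasurable) ?_
      (hwD.const_mul C) (ae_of_all _ fun v => (hlim v).const_mul _)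
    filter_upwards [hb] with t ht using ae_of_all _ ht

/-! ## Conditional expectations against bounded weights -/

section CondExp

variable {Ω : Type*} {m0 m1 : MeasurableSpace Ω} {P : Measure[m0] Ω} [IsProbabilityMeasure P]

/-- Pulling out what is known. Kernel weights are bounded functions of the regressors, so each
conditional moment hypothesis becomes an identity of integrals; Y' is integrable because it is
almost everywhere a conditional expectation. -/
theorem integral_mul_eq_of_condExp (hm : m1 ≤ m0) {Y Y' w : Ω → ℝ} (hY : Integrable Y P)
    (hw : Measurable[m1] w) {c : ℝ} (hc : ∀ ω, |w ω| ≤ c) (h : P[Y | m1] =ᵐ[P] Y') :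
    Integrable (fun ω => w ω * Y ω) P ∧ Integrable (fun ω => w ω * Y' ω) P ∧
      ∫ ω, w ω * Y ω ∂P = ∫ ω, w ω * Y' ω ∂P := by
  have hw' : Measurable[m0] w := hw.mono hm le_rfl
  have hb : ∀ᵐ ω ∂P, ‖w ω‖ ≤ c := ae_of_all _ hc
  have hY' : Integrable Y' P := integrable_condExp.congr h
  refine ⟨hY.bdd_mul hw'.aestronglyMeasurable hb, hY'.bdd_mul hw'.aestronglyMeasurable hb, ?_⟩
  have h1 := condExp_stronglyMeasurable_mul_of_bound hm hw.stronglyMeasurable hY c hb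
  calc ∫ ω, w ω * Y ω ∂P = ∫ ω, P[w * Y | m1] ω ∂P := (integral_condExp hm).symm
    _ = _ := by
        refine integral_congr_ae ?_
        filter_upwards [h1, h] with ω h1 h2
        rw [h1, Pi.mul_apply, h2]

/-- The measures with densities Y and its conditional expectation agree on the smaller σ-algebra,
hence integrate its measurable functions alike; in [0, ∞] no integrability is needed. -/
theorem lintegral_mul_condLExp (hm : m1 ≤ m0) {Y w : Ω → ENNReal} (hY : Measurable[m0] Y)
    (hw : Measurable[m1] w) :
    ∫⁻ ω, w ω * condLExp m1 P Y ω ∂P = ∫⁻ ω, w ω * Y ω ∂P := by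
  have hw' : Measurable[m0] w := hw.mono hm le_rfl
  have hc : Measurable[m0] (condLExp m1 P Y) := (measurable_condLExp m1 P Y).mono hm le_rfl
  have e : (P.withDensity (condLExp m1 P Y)).trim hm = (P.withDensity Y).trim hm := by
    refine @Measure.ext _ m1 _ _ fun s hs => ?_
    rw [trim_measurableSet_eq hm hs, trim_measurableSet_eq hm hs, withDensity_apply _ (hm s hs),
      withDensity_apply _ (hm s hs), setLIntegral_condLExp hm P Y hs]
  have h1 := lintegral_withDensity_eq_lintegral_mul P hc hw'
  have h2 := lintegral_withDensity_eq_lintegral_mul P hY hw'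
  rw [← lintegral_trim hm hw] at h1 h2
  rw [e, h2] at h1
  simp only [Pi.mul_apply] at h1
  simp_rw [mul_comm (w _)]
  exact h1.symm

end CondExp

/-! ## Second moments of sums over the members of a cluster -/

/-- As κ_j κ_l ≥ 0, the inequality 2 ζ_j ζ_l ≤ ζ_j² + ζ_l² removes the mixed products. Hence no
control of covariances is needed, which matters away from x, where nothing is assumed about
σ(·,·;·). -/
theorem memLp_sum_and_integral_sq_le {Ω ι : Type*} [MeasurableSpace Ω] {P : Measure Ω}
    [Fintype ι] {κ ζ : ι → Ω → ℝ} (hκm : ∀ j, Measurable (κ j))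
    (hζm : ∀ j, Measurable (ζ j)) (hκ0 : ∀ j ω, 0 ≤ κ j ω) {q1 q2 : ℝ} (hq2 : 0 ≤ q2)
    (h1 : ∀ j, Integrable (fun ω => κ j ω ^ 2 * ζ j ω ^ 2) P ∧
      ∫ ω, κ j ω ^ 2 * ζ j ω ^ 2 ∂P ≤ q1)
    (h2 : ∀ j l, j ≠ l → Integrable (fun ω => κ j ω * κ l ω * ζ j ω ^ 2) P ∧
      ∫ ω, κ j ω * κ l ω * ζ j ω ^ 2 ∂P ≤ q2) :
    MemLp (fun ω => ∑ j, κ j ω * ζ j ω) 2 P ∧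
      ∫ ω, (∑ j, κ j ω * ζ j ω) ^ 2 ∂P ≤
        Fintype.card ι * q1 + (Fintype.card ι : ℝ) ^ 2 * q2 := by
  classical
  have hL : ∀ j, MemLp (fun ω => κ j ω * ζ j ω) 2 P := fun j => by
    refine (memLp_two_iff_integrable_sq ((hκm j).mul (hζm j)).aestronglyMeasurable).2 ?_
    simpa [mul_pow] using (h1 j).1
  refine ⟨memLp_finsetSum _ fun j _ => hL j, ?_⟩
  have hint : ∀ j l, Integrable (fun ω => κ j ω * ζ j ω * (κ l ω * ζ l ω)) P := fun j l =>
    (hL j).integrable_mul (hL l)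
  -- Since q2 ≥ 0 it may be added on the diagonal too, so the double sum is simply card · q1 + card²
  -- · q2.
  have hjl : ∀ j l, ∫ ω, κ j ω * ζ j ω * (κ l ω * ζ l ω) ∂P ≤ (if j = l then q1 else 0) + q2 := by
    intro j l
    split_ifs with h
    · subst h
      refine le_trans (le_of_eq ?_) ((h1 j).2.trans (by linarith))
      congr 1; ext ω; ring
    · rw [zero_add]
      have hA := h2 j l h
      have hB := h2 l j (Ne.symm h)
      calc ∫ ω, κ j ω * ζ j ω * (κ l ω * ζ l ω) ∂P
          ≤ ∫ ω, (1 / 2 * (κ j ω * κ l ω * ζ j ω ^ 2)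
            + 1 / 2 * (κ l ω * κ j ω * ζ l ω ^ 2)) ∂P := by
            refine integral_mono (hint j l) ((hA.1.const_mul _).add (hB.1.const_mul _)) fun ω => ?_
            have h0 : 0 ≤ κ j ω * κ l ω := mul_nonneg (hκ0 j ω) (hκ0 l ω)
            nlinarith [mul_nonneg h0 (sq_nonneg (ζ j ω - ζ l ω))]
        _ ≤ _ := by
            rw [integral_add (hA.1.const_mul _) (hB.1.const_mul _), integral_const_mul,
              integral_const_mul]
            linarith [hA.2, hB.2]
  calc ∫ ω, (∑ j, κ j ω * ζ j ω) ^ 2 ∂P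
      = ∑ j, ∑ l, ∫ ω, κ j ω * ζ j ω * (κ l ω * ζ l ω) ∂P := by
        simp_rw [sq, Finset.sum_mul_sum]
        rw [integral_finsetSum _ fun j _ => integrable_finsetSum _ fun l _ => hint j l]
        exact Finset.sum_congr rfl fun j _ => integral_finsetSum _ fun l _ => hint j l
    _ ≤ ∑ j : ι, ∑ l : ι, ((if j = l then q1 else 0) + q2) :=
        Finset.sum_le_sum fun j _ => Finset.sum_le_sum fun l _ => hjl j l
    _ = _ := by
        simp [Finset.sum_add_distrib, Finset.sum_const, Finset.card_univ]
        ring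

/-- A row-wise law of large numbers: sums of independent square integrable variables whose
second moments are negligible. -/
theorem tendsto_measure_sum_sub_ge {Ω : ℕ → Type*} [∀ t, MeasurableSpace (Ω t)]
    {P : ∀ t, Measure (Ω t)} [∀ t, IsProbabilityMeasure (P t)] {ι : ℕ → Type*}
    [∀ t, Fintype (ι t)] {W : ∀ t, ι t → Ω t → ℝ}
    (hind : ∀ t, iIndepFun (W t) (P t))
    (hL2 : ∀ᶠ t in atTop, ∀ i, MemLp (W t i) 2 (P t)) {c : ℝ}
    (hmean : Tendsto (fun t => ∑ i, ∫ ω, W t i ω ∂(P t)) atTop (𝓝 c))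
    (hsq : Tendsto (fun t => ∑ i, ∫ ω, W t i ω ^ 2 ∂(P t)) atTop (𝓝 0)) {ε : ℝ} (hε : 0 < ε) :
    Tendsto (fun t => P t {ω | ε ≤ |∑ i, W t i ω - c|}) atTop (𝓝 0) := by
  have hlim : Tendsto (fun t => ENNReal.ofReal
      ((∑ i, ∫ ω, W t i ω ^ 2 ∂(P t)) / (ε / 2) ^ 2)) atTop (𝓝 0) := by
    have := ENNReal.tendsto_ofReal (hsq.div_const ((ε / 2) ^ 2))
    simpa using this
  refine tendsto_of_tendsto_of_tendsto_of_le_of_le' tendsto_const_nhds hlim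
    (Eventually.of_forall fun _ => zero_le) ?_
  -- Half of ε absorbs the distance of the mean from c, the other half goes into Chebyshev's
  -- inequality.
  have hnear : ∀ᶠ t in atTop, |∑ i, ∫ ω, W t i ω ∂(P t) - c| < ε / 2 := by
    have := (tendsto_sub_nhds_zero_iff.2 hmean).abs
    rw [abs_zero] at this
    exact this.eventually (gt_mem_nhds (by positivity))
  filter_upwards [hL2, hnear] with t hL hn
  have hsum : MemLp (fun ω => ∑ i, W t i ω) 2 (P t) := memLp_finsetSum _ fun i _ => hL i
  have hE : ∫ ω, ∑ i, W t i ω ∂(P t) = ∑ i, ∫ ω, W t i ω ∂(P t) :=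
    integral_finsetSum _ fun i _ => (hL i).integrable (by norm_num)
  have hcheb := meas_ge_le_variance_div_sq hsum (half_pos hε)
  refine le_trans (measure_mono fun ω hω => ?_) (hcheb.trans ?_)
  · simp only [Set.mem_ofPred_eq] at hω ⊢
    rw [hE]
    have := abs_sub_le (∑ i, W t i ω) (∑ i, ∫ ω, W t i ω ∂(P t)) c
    linarith
  · refine ENNReal.ofReal_le_ofReal ?_
    gcongr
    have hv := IndepFun.variance_sum (μ := P t) (X := W t) (s := Finset.univ) (fun i _ => hL i)
      (fun i _ j _ hij => (hind t).indepFun hij)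
    have e : (fun ω => ∑ i, W t i ω) = ∑ i, W t i := by ext ω; simp
    rw [e, hv]
    exact Finset.sum_le_sum fun i _ => variance_le_expectation_sq (hL i).aestronglyMeasurable

/-! ## Limits of kernel-weighted integrals -/

/-- The densities `f` and `f₂` are continuous at `x` and bounded where the rescaled kernel
does not vanish. -/
structure DensityControl {dI dC : ℕ} (k : ℝ → ℝ) (h : ℕ → ℝ) (f : Regressor dI dC → ℝ)
    (f2 : JointRegressor 2 dI dC → ℝ) (x : Regressor dI dC) : Prop where
  pos : ∀ t, 0 < h t
  tendsto_zero : Tendsto h atTop (𝓝 0)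
  measurable_f : Measurable f
  f_nonneg : ∀ u, 0 ≤ f u
  measurable_f2 : Measurable f2
  f2_nonneg : ∀ z, 0 ≤ f2 z
  continuousAt_f : ContinuousAt f x
  continuousAt_f2 : ContinuousAt f2 (diagPoint 2 x)
  f_le : ∃ C, ∀ᶠ t in atTop, ∀ v, productKernel k v ≠ 0 → f (x + h t • v) ≤ C
  f2_le : ∃ C, ∀ᶠ t in atTop, ∀ z, pairKernel k z ≠ 0 → f2 (diagPoint 2 x + h t • z) ≤ C

theorem tendsto_add_smul {E : Type*} [NormedAddCommGroup E] [NormedSpace ℝ E] {h : ℕ → ℝ}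
    (hh : Tendsto h atTop (𝓝 0)) (x v : E) : Tendsto (fun t => x + h t • v) atTop (𝓝 x) := by
  simpa using tendsto_const_nhds.add (hh.smul_const v)

namespace DensityControl

variable {dI dC : ℕ} {k : ℝ → ℝ} {h : ℕ → ℝ} {f : Regressor dI dC → ℝ}
  {f2 : JointRegressor 2 dI dC → ℝ} {x : Regressor dI dC}

theorem tendsto_integral_mul (hc : DensityControl k h f f2 x) {w : Regressor dI dC → ℝ}
    (hw : Measurable w) (hw0 : ∀ v, 0 ≤ w v) (hwk : ∀ v, w v ≠ 0 → productKernel k v ≠ 0)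
    (hwi : Integrable fun v => (1 + ‖v‖) ^ 4 * w v)
    {ρ : ℕ → Regressor dI dC → ℝ} (hρ : ∀ t, Measurable (ρ t)) {C c : ℝ}
    (hbd : ∀ᶠ t in atTop, ∀ v, productKernel k v ≠ 0 →
      |ρ t (x + h t • v)| ≤ C * (1 + ‖v‖) ^ 4)
    (hlim : ∀ v, Tendsto (fun t => ρ t (x + h t • v)) atTop (𝓝 c)) :
    (∀ᶠ t in atTop, Integrable fun v => w v * (ρ t (x + h t • v) * f (x + h t • v))) ∧
      Tendsto (fun t => ∫ v, w v * (ρ t (x + h t • v) * f (x + h t • v))) atTop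
        (𝓝 ((∫ v, w v) * (c * f x))) := by
  obtain ⟨Cf, hCf⟩ := hc.f_le
  rw [← integral_mul_const]
  refine tendsto_integral_weight_mul hw hw0 hwi (C := C * Cf)
    (fun t => ((hρ t).comp (by fun_prop)).mul (hc.measurable_f.comp (by fun_prop))) ?_ fun v => ?_
  · filter_upwards [hbd, hCf] with t h1 h2 v hv
    rw [abs_mul, abs_of_nonneg (hc.f_nonneg _)]
    calc _ ≤ (C * (1 + ‖v‖) ^ 4) * Cf :=
          mul_le_mul (h1 v (hwk v hv)) (h2 v (hwk v hv)) (hc.f_nonneg _)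
            ((abs_nonneg _).trans (h1 v (hwk v hv)))
      _ = _ := by ring
  · exact (hlim v).mul (hc.continuousAt_f.tendsto.comp (tendsto_add_smul hc.tendsto_zero x v))

theorem tendsto_integral_pair_mul (hc : DensityControl k h f f2 x) (hk : IsUnivariateKernel k)
    {Ψ : ℕ → JointRegressor 2 dI dC → ℝ} (hΨ : ∀ t, Measurable (Ψ t)) {C c : ℝ}
    (hbd : ∀ᶠ t in atTop, ∀ z, pairKernel k z ≠ 0 →
      |Ψ t (diagPoint 2 x + h t • z)| ≤ C * (1 + ‖(z.1 0, z.2)‖) ^ 4)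
    (hlim : ∀ z, Tendsto (fun t => Ψ t (diagPoint 2 x + h t • z)) atTop (𝓝 c)) :
    (∀ᶠ t in atTop, Integrable fun z =>
      pairKernel k z * (Ψ t (diagPoint 2 x + h t • z) * f2 (diagPoint 2 x + h t • z))) ∧
      Tendsto (fun t => ∫ z, pairKernel k z *
        (Ψ t (diagPoint 2 x + h t • z) * f2 (diagPoint 2 x + h t • z))) atTop
        (𝓝 (kernelRoughness k ^ dC * (c * f2 (diagPoint 2 x)))) := by
  obtain ⟨Cf, hCf⟩ := hc.f2_le
  rw [← hk.integral_pairKernel (dI := dI), ← integral_mul_const]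
  refine tendsto_integral_weight_mul hk.measurable_pairKernel hk.pairKernel_nonneg
    hk.integrable_weight_pairKernel (C := C * Cf)
    (fun t => ((hΨ t).comp (by fun_prop)).mul (hc.measurable_f2.comp (by fun_prop))) ?_ fun v => ?_
  · filter_upwards [hbd, hCf] with t h1 h2 v hv
    rw [abs_mul, abs_of_nonneg (hc.f2_nonneg _)]
    calc _ ≤ (C * (1 + ‖(v.1 0, v.2)‖) ^ 4) * Cf :=
          mul_le_mul (h1 v hv) (h2 v hv) (hc.f2_nonneg _) ((abs_nonneg _).trans (h1 v hv))
      _ = _ := by ring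
  · exact (hlim v).mul (hc.continuousAt_f2.tendsto.comp (tendsto_add_smul hc.tendsto_zero _ v))

end DensityControl

/-! ## Moments of kernel weights in a cluster sample -/

namespace ClusterSample

variable {dI dC : ℕ} {Ω : Type*} [MeasurableSpace Ω]

/-- The kernel weight `K((X_{gj} - x) / h)`. -/
noncomputable def kern (S : ClusterSample dI dC Ω) (k : ℝ → ℝ) (h : ℝ) (x : Regressor dI dC)
    (g : Fin S.G) (j : Fin (S.size g)) (ω : Ω) : ℝ :=
  productKernel k (h⁻¹ • (S.X g j ω - x))

variable (S : ClusterSample dI dC Ω)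

theorem measurable_X (g : Fin S.G) (j : Fin (S.size g)) : Measurable (S.X g j) :=
  (S.measurable_Xind g j).prodMk (S.measurable_Xcls g)

theorem measurable_jointX (g : Fin S.G) {p : ℕ} (j : Fin p → Fin (S.size g)) :
    Measurable (S.jointX g j) :=
  (measurable_pi_lambda _ fun i => S.measurable_Xind g (j i)).prodMk (S.measurable_Xcls g)

theorem sigmaX_le (g : Fin S.G) : S.sigmaX g ≤ ‹MeasurableSpace Ω› :=
  (S.measurable_jointX g id).comap_le

theorem measurable_sigmaX_X (g : Fin S.G) (j : Fin (S.size g)) :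
    Measurable[S.sigmaX g] (S.X g j) := by
  have : S.X g j = (fun z : JointRegressor (S.size g) dI dC => (z.1 j, z.2)) ∘ S.jointX g id := rfl
  rw [this]
  exact Measurable.comp (by fun_prop) (comap_measurable _)

variable {k : ℝ → ℝ} (hk : IsUnivariateKernel k) (h : ℝ) (x : Regressor dI dC)
include hk

theorem kern_nonneg (g : Fin S.G) (j : Fin (S.size g)) (ω : Ω) : 0 ≤ S.kern k h x g j ω :=
  hk.productKernel_nonneg _

theorem measurable_kern (g : Fin S.G) (j : Fin (S.size g)) : Measurable (S.kern k h x g j) :=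
  hk.measurable_productKernel.comp (((S.measurable_X g j).sub_const x).const_smul h⁻¹)

theorem measurable_sigmaX_kern (g : Fin S.G) (j : Fin (S.size g)) :
    Measurable[S.sigmaX g] (S.kern k h x g j) := by
  refine hk.measurable_productKernel.comp (g := productKernel k)
    (f := fun ω => h⁻¹ • (S.X g j ω - x)) ?_
  have : (fun ω => h⁻¹ • (S.X g j ω - x)) = (fun u => h⁻¹ • (u - x)) ∘ S.X g j := rfl
  rw [this]
  exact Measurable.comp (by fun_prop) (S.measurable_sigmaX_X g j)

omit hk in
theorem kern_mul_kern (g : Fin S.G) (j l : Fin (S.size g)) (ω : Ω) :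
    S.kern k h x g j ω * S.kern k h x g l ω
      = pairKernel k (h⁻¹ • (S.jointX g ![j, l] ω - diagPoint 2 x)) := rfl

end ClusterSample

theorem finrank_regressor (dI dC : ℕ) : Module.finrank ℝ (Regressor dI dC) = dI + dC := by
  simp [Module.finrank_prod]

theorem finrank_jointRegressor_two (dI dC : ℕ) :
    Module.finrank ℝ (JointRegressor 2 dI dC) = 2 * dI + dC := by
  simp [Module.finrank_prod, Module.finrank_pi_fintype]

theorem inv_smul_add_smul_sub {E : Type*} [NormedAddCommGroup E] [NormedSpace ℝ E] {h : ℝ}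
    (hh : 0 < h) (x v : E) : h⁻¹ • (x + h • v - x) = v := by
  rw [add_sub_cancel_left, inv_smul_smul₀ hh.ne']

instance (dI dC : ℕ) : (volume : Measure (Regressor dI dC)).IsAddHaarMeasure :=
  Measure.prod.instIsAddHaarMeasure _ _

instance (p dI dC : ℕ) : (volume : Measure (JointRegressor p dI dC)).IsAddHaarMeasure :=
  have : (volume : Measure (Fin p → Fin dI → ℝ)).IsAddHaarMeasure :=
    Measure.pi.isAddHaarMeasure _
  Measure.prod.instIsAddHaarMeasure _ _

namespace IsClusterDGP

variable {dI dC : ℕ} {Ω : ℕ → Type*} [∀ t, MeasurableSpace (Ω t)]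
  {P : ∀ t, Measure (Ω t)} {S : ∀ t, ClusterSample dI dC (Ω t)}
  {f : Regressor dI dC → ℝ} {fJ : (k : ℕ) → JointRegressor k dI dC → ℝ}
  {m s2 : Regressor dI dC → ℝ} {sc : JointRegressor 2 dI dC → ℝ}
  (hd : IsClusterDGP P S f fJ m s2 sc)
include hd

theorem integral_weight_X (t : ℕ) (g : Fin (S t).G) (j : Fin ((S t).size g))
    {w ρ : Regressor dI dC → ℝ} (hw : Measurable w) (hρ : Measurable ρ) (x : Regressor dI dC)
    {h : ℝ} (hh : 0 < h) :
    (Integrable (fun ω => w (h⁻¹ • ((S t).X g j ω - x)) * ρ ((S t).X g j ω)) (P t) ↔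
      Integrable fun v => w v * (ρ (x + h • v) * f (x + h • v))) ∧
    ∫ ω, w (h⁻¹ • ((S t).X g j ω - x)) * ρ ((S t).X g j ω) ∂(P t)
      = h ^ (dI + dC) * ∫ v, w v * (ρ (x + h • v) * f (x + h • v)) := by
  have hφ : Measurable fun u => w (h⁻¹ • (u - x)) * ρ u := (hw.comp (by fun_prop)).mul hρ
  have h1 := integrable_comp_iff_rescale ((S t).measurable_X g j) hd.measurable_f hd.f_nonneg
    (hd.law_X t g j) hφ x hh
  have h2 := integral_comp_eq_rescale ((S t).measurable_X g j) hd.measurable_f hd.f_nonneg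
    (hd.law_X t g j) hφ x hh
  simp_rw [inv_smul_add_smul_sub hh, finrank_regressor, mul_assoc] at h1 h2
  exact ⟨h1, h2⟩

/-- A pair varies in dimension 2dI + dC rather than 2(dI + dC), because the cluster-level
coordinates are shared. Its contribution is therefore smaller than that of a single member only by
h^dI. -/
theorem integral_weight_pair (t : ℕ) (g : Fin (S t).G) {j l : Fin ((S t).size g)} (hjl : j ≠ l)
    {w ρ : JointRegressor 2 dI dC → ℝ} (hw : Measurable w) (hρ : Measurable ρ)
    (x : Regressor dI dC) {h : ℝ} (hh : 0 < h) :
    (Integrable (fun ω => w (h⁻¹ • ((S t).jointX g ![j, l] ω - diagPoint 2 x))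
        * ρ ((S t).jointX g ![j, l] ω)) (P t) ↔
      Integrable fun z => w z * (ρ (diagPoint 2 x + h • z) * fJ 2 (diagPoint 2 x + h • z))) ∧
    ∫ ω, w (h⁻¹ • ((S t).jointX g ![j, l] ω - diagPoint 2 x)) * ρ ((S t).jointX g ![j, l] ω) ∂(P t)
      = h ^ (2 * dI + dC) *
        ∫ z, w z * (ρ (diagPoint 2 x + h • z) * fJ 2 (diagPoint 2 x + h • z)) := by
  have hφ : Measurable fun u => w (h⁻¹ • (u - diagPoint 2 x)) * ρ u := (hw.comp (by fun_prop)).mul hρ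
  have hinj : Function.Injective ![j, l] := by
    intro a b
    fin_cases a <;> fin_cases b <;> simp [hjl, hjl.symm]
  have hl := hd.law_jointX 2 (by simp) t g ![j, l] hinj
  have h1 := integrable_comp_iff_rescale ((S t).measurable_jointX g ![j, l]) (hd.measurable_fJ 2)
    (hd.fJ_nonneg 2) hl hφ (diagPoint 2 x) hh
  have h2 := integral_comp_eq_rescale ((S t).measurable_jointX g ![j, l]) (hd.measurable_fJ 2)
    (hd.fJ_nonneg 2) hl hφ (diagPoint 2 x) hh
  simp_rw [inv_smul_add_smul_sub hh, finrank_jointRegressor_two, mul_assoc] at h1 h2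
  exact ⟨h1, h2⟩

/-- The second moment of a kernel-weighted sum over a cluster, when the second moments of the
summands are dominated by a function `ρ` of the regressors. -/
theorem sum_integral_sq_le {k : ℝ → ℝ} (hk : IsUnivariateKernel k) (t : ℕ) {h : ℝ} (hh : 0 < h)
    (x : Regressor dI dC) {ρ : Regressor dI dC → ℝ} (hρ : Measurable ρ) (hρ0 : ∀ u, 0 ≤ ρ u)
    {ζ : ∀ g, Fin ((S t).size g) → Ω t → ℝ} (hζ : ∀ g j, Measurable (ζ g j))
    (hQ1 : Integrable fun v => productKernel k v ^ 2 * (ρ (x + h • v) * f (x + h • v)))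
    (hQ2 : Integrable fun z : JointRegressor 2 dI dC => pairKernel k z *
      (ρ (x + h • (z.1 0, z.2)) * fJ 2 (diagPoint 2 x + h • z)))
    (h1 : ∀ g j, Integrable (fun ω => (S t).kern k h x g j ω ^ 2 * ρ ((S t).X g j ω)) (P t) →
      Integrable (fun ω => (S t).kern k h x g j ω ^ 2 * ζ g j ω ^ 2) (P t) ∧
      ∫ ω, (S t).kern k h x g j ω ^ 2 * ζ g j ω ^ 2 ∂(P t)
        ≤ ∫ ω, (S t).kern k h x g j ω ^ 2 * ρ ((S t).X g j ω) ∂(P t))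
    (h2 : ∀ g j l, Integrable (fun ω => (S t).kern k h x g j ω * (S t).kern k h x g l ω
        * ρ ((S t).X g j ω)) (P t) →
      Integrable (fun ω => (S t).kern k h x g j ω * (S t).kern k h x g l ω * ζ g j ω ^ 2) (P t) ∧
      ∫ ω, (S t).kern k h x g j ω * (S t).kern k h x g l ω * ζ g j ω ^ 2 ∂(P t)
        ≤ ∫ ω, (S t).kern k h x g j ω * (S t).kern k h x g l ω * ρ ((S t).X g j ω) ∂(P t)) :
    (∀ g, MemLp (fun ω => ∑ j, (S t).kern k h x g j ω * ζ g j ω) 2 (P t)) ∧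
    ∑ g, ∫ ω, (∑ j, (S t).kern k h x g j ω * ζ g j ω) ^ 2 ∂(P t) ≤
      (S t).n * h ^ (dI + dC)
          * (∫ v, productKernel k v ^ 2 * (ρ (x + h • v) * f (x + h • v)))
        + (∑ g, ((S t).size g : ℝ) ^ 2) * h ^ (2 * dI + dC)
          * ∫ z : JointRegressor 2 dI dC, pairKernel k z *
            (ρ (x + h • (z.1 0, z.2)) * fJ 2 (diagPoint 2 x + h • z)) := by
  set Q1 := ∫ v, productKernel k v ^ 2 * (ρ (x + h • v) * f (x + h • v)) with hQ1d
  set Q2 := ∫ z : JointRegressor 2 dI dC, pairKernel k z *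
            (ρ (x + h • (z.1 0, z.2)) * fJ 2 (diagPoint 2 x + h • z)) with hQ2d
  have hQ20 : 0 ≤ Q2 := integral_nonneg fun z => mul_nonneg (hk.pairKernel_nonneg z)
    (mul_nonneg (hρ0 _) (hd.fJ_nonneg 2 _))
  have key : ∀ g, MemLp (fun ω => ∑ j, (S t).kern k h x g j ω * ζ g j ω) 2 (P t) ∧
      ∫ ω, (∑ j, (S t).kern k h x g j ω * ζ g j ω) ^ 2 ∂(P t) ≤
        (S t).size g * (h ^ (dI + dC) * Q1)
          + ((S t).size g : ℝ) ^ 2 * (h ^ (2 * dI + dC) * Q2) := by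
    intro g
    have := memLp_sum_and_integral_sq_le (P := P t) (κ := (S t).kern k h x g) (ζ := ζ g)
      (q1 := h ^ (dI + dC) * Q1) (q2 := h ^ (2 * dI + dC) * Q2)
      ((S t).measurable_kern hk h x g) (hζ g) ((S t).kern_nonneg hk h x g) (by positivity)
      (fun j => ?_) (fun j l hjl => ?_)
    · simpa using this
    · have hX := hd.integral_weight_X t g j (hk.measurable_productKernel.pow_const 2) hρ x hh
      have := h1 g j (hX.1.2 hQ1)
      exact ⟨this.1, this.2.trans hX.2.le⟩
    · have hX := hd.integral_weight_pair t g hjl hk.measurable_pairKernel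
        (ρ := fun z => ρ (z.1 0, z.2)) (hρ.comp (by fun_prop)) x hh
      have := h2 g j l (hX.1.2 hQ2)
      exact ⟨this.1, this.2.trans hX.2.le⟩
  refine ⟨fun g => (key g).1, (Finset.sum_le_sum fun g _ => (key g).2).trans (le_of_eq ?_)⟩
  rw [Finset.sum_add_distrib, ← Finset.sum_mul, ← Finset.sum_mul, ClusterSample.n]
  push_cast
  ring

end IsClusterDGP

/-! ## Second-order Taylor expansions -/

section Taylor

variable {E : Type*} [NormedAddCommGroup E] [NormedSpace ℝ E] {g : E → ℝ} {x : E}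

/-- The derivative is Lipschitz near x, so on the ball of radius ‖w‖ it differs from its value at x
by at most K‖w‖; the mean value inequality contributes the second factor ‖w‖. -/
theorem ContDiffAt.exists_abs_sub_fderiv_le (hg : ContDiffAt ℝ 2 g x) (h0 : g x = 0) :
    ∃ C δ : ℝ, 0 ≤ C ∧ 0 < δ ∧ ∀ w, ‖w‖ < δ → |g (x + w) - fderiv ℝ g x w| ≤ C * ‖w‖ ^ 2 := by
  have hd : ContDiffAt ℝ 1 (fderiv ℝ g) x := hg.fderiv_right (m := 1) (by norm_num)
  obtain ⟨K, s, hs, hK⟩ := hd.exists_lipschitzOnWith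
  have hdiff : ∀ᶠ y in 𝓝 x, DifferentiableAt ℝ g y :=
    (hg.eventually (by simp)).mono fun y hy => hy.differentiableAt (by norm_num)
  obtain ⟨δ, hδ, hball⟩ := Metric.mem_nhds_iff.1 (inter_mem hs hdiff)
  refine ⟨K, δ, K.2, hδ, fun w hw => ?_⟩
  have hsub : Metric.closedBall x ‖w‖ ⊆ Metric.ball x δ := Metric.closedBall_subset_ball hw
  have := (convex_closedBall x ‖w‖).norm_image_sub_le_of_norm_hasFDerivWithin_le'
    (f := g) (f' := fderiv ℝ g) (φ := fderiv ℝ g x) (C := K * ‖w‖) (x := x) (y := x + w)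
    (fun y hy => ((hball (hsub hy)).2 : DifferentiableAt ℝ g y).hasFDerivAt.hasFDerivWithinAt)
    (fun y hy => ?_) (Metric.mem_closedBall_self (norm_nonneg _)) (by simp)
  · rw [h0, sub_zero, add_sub_cancel_left, Real.norm_eq_abs] at this
    refine this.trans (le_of_eq ?_)
    ring
  · have hx : x ∈ Metric.ball x δ := Metric.mem_ball_self hδ
    refine (hK.norm_sub_le (hball (hsub hy)).1 (hball hx).1).trans ?_
    rw [Metric.mem_closedBall, dist_eq_norm] at hy
    gcongr

/-- One application of L'Hôpital's rule leaves the difference quotient at 0 of s ↦ Dg(x + s v) v. A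
limit along each ray suffices, since the uniform quadratic bound supplies the domination. -/
theorem ContDiffAt.tendsto_sub_fderiv_div_sq (hg : ContDiffAt ℝ 2 g x) (h0 : g x = 0) (v : E) :
    Tendsto (fun s : ℝ => (g (x + s • v) - s * fderiv ℝ g x v) / s ^ 2) (𝓝[>] 0)
      (𝓝 (fderiv ℝ (fderiv ℝ g) x v v / 2)) := by
  have hd : ContDiffAt ℝ 1 (fderiv ℝ g) x := hg.fderiv_right (m := 1) (by norm_num)
  have hdiff : ∀ᶠ y in 𝓝 x, DifferentiableAt ℝ g y :=
    (hg.eventually (by simp)).mono fun y hy => hy.differentiableAt (by norm_num)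
  have hline : ∀ s : ℝ, HasDerivAt (fun s : ℝ => x + s • v) v s := fun s => by
    simpa using ((hasDerivAt_id s).smul_const v).const_add x
  have hcont : Tendsto (fun s : ℝ => x + s • v) (𝓝 0) (𝓝 x) := by
    have := (hline 0).continuousAt.tendsto
    simpa using this
  have hev : ∀ᶠ s : ℝ in 𝓝[>] 0, HasDerivAt (fun s : ℝ => g (x + s • v) - s * fderiv ℝ g x v)
      (fderiv ℝ g (x + s • v) v - fderiv ℝ g x v) s := by
    filter_upwards [nhdsWithin_le_nhds (hcont.eventually hdiff)] with s hs
    have h1 : HasDerivAt (fun s : ℝ => g (x + s • v)) (fderiv ℝ g (x + s • v) v) s :=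
      (hs.hasFDerivAt (𝕜 := ℝ)).comp_hasDerivAt s (hline s)
    have h2 : HasDerivAt (fun s : ℝ => s * fderiv ℝ g x v) (fderiv ℝ g x v) s := by
      simpa using (hasDerivAt_id s).mul_const (fderiv ℝ g x v)
    exact h1.sub h2
  refine HasDerivAt.lhopital_zero_nhdsGT hev (g' := fun s => 2 * s)
    (Eventually.of_forall fun s => by simpa using hasDerivAt_pow 2 s) ?_ ?_ ?_ ?_
  · filter_upwards [self_mem_nhdsWithin] with s hs
    have : (0 : ℝ) < s := hs
    positivity
  · have h1 : Tendsto (fun s : ℝ => g (x + s • v) - s * fderiv ℝ g x v) (𝓝 0)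
        (𝓝 (g x - 0 * fderiv ℝ g x v)) :=
      (hg.continuousAt.tendsto.comp hcont).sub (tendsto_id.mul_const _)
    rw [h0, zero_mul, sub_zero] at h1
    exact h1.mono_left nhdsWithin_le_nhds
  · have h1 : Tendsto (fun s : ℝ => s ^ 2) (𝓝 0) (𝓝 (0 ^ 2)) := tendsto_id.pow 2
    rw [zero_pow two_ne_zero] at h1
    exact h1.mono_left nhdsWithin_le_nhds
  · have hd2 : HasFDerivAt (fderiv ℝ g) (fderiv ℝ (fderiv ℝ g) x) (x + (0 : ℝ) • v) := by
      simpa using (hd.differentiableAt (by norm_num)).hasFDerivAt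
    have h1 : HasDerivAt (fun s : ℝ => fderiv ℝ g (x + s • v) v)
        (fderiv ℝ (fderiv ℝ g) x v v) 0 := by
      have h1 : HasDerivAt (fun s : ℝ => fderiv ℝ g (x + s • v)) (fderiv ℝ (fderiv ℝ g) x v) 0 :=
        hd2.comp_hasDerivAt (0 : ℝ) (hline 0)
      exact ((ContinuousLinearMap.apply ℝ ℝ v).hasFDerivAt (x := fderiv ℝ g (x + (0 : ℝ) • v))
        ).comp_hasDerivAt (0 : ℝ) h1
    have h2 := (hasDerivAt_iff_tendsto_slope.1 h1).mono_left
      (nhdsWithin_mono (0 : ℝ) fun s (hs : (0 : ℝ) < s) => hs.ne')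
    refine (h2.div_const 2).congr fun s => ?_
    simp only [slope, sub_zero, zero_smul, add_zero, vsub_eq_sub, smul_eq_mul]
    rw [mul_comm 2 s, ← div_div, ← div_eq_inv_mul]

end Taylor

/-! ### Second derivatives of (m - m(x)) f and the bias constant -/

section Hessian

variable {dI dC : ℕ} {f m : Regressor dI dC → ℝ} {x : Regressor dI dC}

theorem partialDeriv_eventuallyEq (hm : ContDiffAt ℝ 2 m x) (q : Fin dI ⊕ Fin dC) :
    partialDeriv m q =ᶠ[𝓝 x] fun y => fderiv ℝ m y (coordVec q) :=
  (hm.eventually (by simp)).mono fun y hy =>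
    (hy.differentiableAt (by norm_num)).lineDeriv_eq_fderiv

theorem partialDeriv_partialDeriv_eq (hm : ContDiffAt ℝ 2 m x) (q : Fin dI ⊕ Fin dC) :
    partialDeriv (partialDeriv m q) q x
      = fderiv ℝ (fderiv ℝ m) x (coordVec q) (coordVec q) := by
  have hd : ContDiffAt ℝ 1 (fderiv ℝ m) x := hm.fderiv_right (m := 1) (by norm_num)
  have h1 := (hd.differentiableAt (by norm_num)).hasFDerivAt
  have h2 : HasFDerivAt (fun y => fderiv ℝ m y (coordVec q))
      ((fderiv ℝ (fderiv ℝ m) x).flip (coordVec q)) x := by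
    have := h1.clm_apply (hasFDerivAt_const (coordVec q : Regressor dI dC) x)
    simpa using this
  rw [partialDeriv, (partialDeriv_eventuallyEq hm q).lineDeriv_eq,
    h2.differentiableAt.lineDeriv_eq_fderiv, h2.fderiv]
  rfl

/-- The second derivative of `(m - m(x)) f` at `x`. -/
theorem fderiv_fderiv_sub_mul (hm : ContDiffAt ℝ 2 m x) (hf : ContDiffAt ℝ 2 f x)
    (v : Regressor dI dC) :
    fderiv ℝ (fderiv ℝ fun y => (m y - m x) * f y) x v v
      = f x * fderiv ℝ (fderiv ℝ m) x v v + 2 * (fderiv ℝ f x v * fderiv ℝ m x v) := by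
  have hev : fderiv ℝ (fun y => (m y - m x) * f y) =ᶠ[𝓝 x]
      fun y => (m y - m x) • fderiv ℝ f y + f y • fderiv ℝ m y := by
    filter_upwards [hm.eventually (by simp), hf.eventually (by simp)] with y hmy hfy
    have h1 := ((hmy.differentiableAt (by norm_num)).sub_const (m x)).hasFDerivAt.mul
      (hfy.differentiableAt (by norm_num)).hasFDerivAt
    rw [fderiv_sub_const] at h1
    exact h1.fderiv
  have hdm : HasFDerivAt (fderiv ℝ m) (fderiv ℝ (fderiv ℝ m) x) x :=
    ((hm.fderiv_right (m := 1) (by norm_num)).differentiableAt (by norm_num)).hasFDerivAt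
  have hdf : HasFDerivAt (fderiv ℝ f) (fderiv ℝ (fderiv ℝ f) x) x :=
    ((hf.fderiv_right (m := 1) (by norm_num)).differentiableAt (by norm_num)).hasFDerivAt
  have hm1 := (hm.differentiableAt (by norm_num)).hasFDerivAt
  have hf1 := (hf.differentiableAt (by norm_num)).hasFDerivAt
  have h := ((hm1.sub_const (m x)).smul hdf).add (hf1.smul hdm)
  have h' : fderiv ℝ (fun y => (m y - m x) • fderiv ℝ f y + f y • fderiv ℝ m y) x = _ := h.fderiv
  rw [hev.fderiv_eq, h']
  simp
  ring

/-- By the product rule; second derivatives of f do not enter because m - m(x) vanishes at x. -/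
theorem biasNW_eq (k : ℝ → ℝ) (hm : ContDiffAt ℝ 2 m x) (hf : ContDiffAt ℝ 2 f x)
    (hfx : 0 < f x) :
    biasNW k f m x * f x = kernelSecondMoment k * ∑ q : Fin dI ⊕ Fin dC,
      fderiv ℝ (fderiv ℝ fun y => (m y - m x) * f y) x (coordVec q) (coordVec q) / 2 := by
  rw [biasNW, mul_assoc, Finset.sum_mul]
  congr 1
  refine Finset.sum_congr rfl fun q _ => ?_
  rw [fderiv_fderiv_sub_mul hm hf, partialDeriv_partialDeriv_eq hm,
    (partialDeriv_eventuallyEq hm q).self_of_nhds, (partialDeriv_eventuallyEq hf q).self_of_nhds]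
  field_simp

end Hessian

/-! ### Linear and quadratic forms integrated against the product kernel -/

namespace IsUnivariateKernel

variable {dI dC : ℕ} {k : ℝ → ℝ}

theorem _root_.Regressor.abs_coord_le (v : Regressor dI dC) (q : Fin dI ⊕ Fin dC) :
    |v.coord q| ≤ ‖v‖ := by
  cases q with
  | inl i => exact (norm_le_pi_norm v.1 i).trans (norm_fst_le v)
  | inr i => exact (norm_le_pi_norm v.2 i).trans (norm_snd_le v)

variable (hk : IsUnivariateKernel k)
include hk

theorem integrable_mul_of_abs_le {F : Regressor dI dC → ℝ} (hF : Measurable F) {C : ℝ}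
    (hC : ∀ v, |F v| ≤ C * (1 + ‖v‖) ^ 4) : Integrable fun v => productKernel k v * F v := by
  refine (hk.integrable_weight_productKernel.const_mul C).mono'
    (hk.measurable_productKernel.mul hF).aestronglyMeasurable (ae_of_all _ fun v => ?_)
  have := hk.productKernel_nonneg v
  rw [Real.norm_eq_abs, abs_mul, abs_of_nonneg this]
  calc _ ≤ productKernel k v * (C * (1 + ‖v‖) ^ 4) := by gcongr; exact hC v
    _ = _ := by ring

theorem integrable_mul_clm (L : Regressor dI dC →L[ℝ] ℝ) :
    Integrable fun v => productKernel k v * L v := by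
  refine hk.integrable_mul_of_abs_le L.continuous.measurable (C := ‖L‖) fun v => ?_
  refine (L.le_opNorm v).trans ?_
  gcongr
  have h1 : 1 + ‖v‖ ≤ (1 + ‖v‖) ^ 4 := le_self_pow₀ (by linarith [norm_nonneg v]) (by norm_num)
  linarith

theorem integral_mul_clm (L : Regressor dI dC →L[ℝ] ℝ) :
    ∫ v, productKernel k v * L v = 0 := by
  have e : ∀ v : Regressor dI dC, productKernel k v * L v
      = ∑ q, L (coordVec q) * (v.coord q * productKernel k v) := fun v => by
    -- The first rewriting also expands the argument of the kernel; the last one folds it back.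
    conv_lhs => rw [← v.sum_coord_smul, map_sum, Finset.mul_sum, v.sum_coord_smul]
    refine Finset.sum_congr rfl fun q _ => ?_
    rw [map_smul, smul_eq_mul]; ring
  simp_rw [e]
  rw [integral_finsetSum]
  · refine Finset.sum_eq_zero fun q _ => ?_
    rw [integral_const_mul, hk.integral_coord_mul, mul_zero]
  · intro q _
    refine Integrable.const_mul ?_ _
    have := hk.integrable_mul_of_abs_le (F := fun v : Regressor dI dC => v.coord q) (C := 1)
      (by cases q <;> simp only [Regressor.coord] <;> fun_prop) fun v => ?_
    · simpa [mul_comm] using this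
    · have h1 : 1 + ‖v‖ ≤ (1 + ‖v‖) ^ 4 :=
        le_self_pow₀ (by linarith [norm_nonneg v]) (by norm_num)
      have := v.abs_coord_le q
      linarith

/-- Mixed second moments of the product kernel vanish, so only the trace of the form survives. -/
theorem integral_mul_bilin (B : Regressor dI dC →L[ℝ] Regressor dI dC →L[ℝ] ℝ) :
    ∫ v, productKernel k v * (B v v / 2)
      = kernelSecondMoment k * ∑ q, B (coordVec q) (coordVec q) / 2 := by
  have e : ∀ v : Regressor dI dC, productKernel k v * (B v v / 2)
      = ∑ p, ∑ q, B (coordVec p) (coordVec q) / 2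
        * (v.coord p * v.coord q * productKernel k v) := fun v => by
    have : B v v = ∑ p, ∑ q, v.coord p * v.coord q * B (coordVec p) (coordVec q) := by
      have hL : ∀ L : Regressor dI dC →L[ℝ] ℝ, L v = ∑ q, v.coord q * L (coordVec q) := fun L => by
        conv_lhs => rw [← v.sum_coord_smul, map_sum]
        simp
      rw [← ContinuousLinearMap.flip_apply, hL]
      refine Finset.sum_congr rfl fun p _ => ?_
      rw [ContinuousLinearMap.flip_apply, hL, Finset.mul_sum]
      exact Finset.sum_congr rfl fun q _ => by ring
    rw [this, Finset.sum_div, Finset.mul_sum]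
    refine Finset.sum_congr rfl fun p _ => ?_
    rw [Finset.sum_div, Finset.mul_sum]
    exact Finset.sum_congr rfl fun q _ => by ring
  have hi : ∀ p q : Fin dI ⊕ Fin dC, Integrable fun v : Regressor dI dC =>
      v.coord p * v.coord q * productKernel k v := fun p q => by
    have := hk.integrable_mul_of_abs_le (F := fun v : Regressor dI dC => v.coord p * v.coord q)
      (C := 1) (by cases p <;> cases q <;> simp only [Regressor.coord] <;> fun_prop) fun v => ?_
    · simpa [mul_comm] using this
    · rw [abs_mul, one_mul]
      have hv := norm_nonneg v
      calc _ ≤ ‖v‖ * ‖v‖ := mul_le_mul (v.abs_coord_le p) (v.abs_coord_le q) (abs_nonneg _) hv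
        _ ≤ (1 + ‖v‖) * (1 + ‖v‖) := by gcongr <;> linarith
        _ = (1 + ‖v‖) ^ 2 := by ring
        _ ≤ (1 + ‖v‖) ^ 4 := pow_le_pow_right₀ (by linarith) (by norm_num)
  simp_rw [e]
  rw [integral_finsetSum _ fun p _ => integrable_finsetSum _ fun q _ => (hi p q).const_mul _]
  rw [Finset.mul_sum]
  refine Finset.sum_congr rfl fun p _ => ?_
  rw [integral_finsetSum _ fun q _ => (hi p q).const_mul _]
  simp_rw [integral_const_mul, hk.integral_coord_mul_coord_mul]
  simp [mul_comm]

end IsUnivariateKernel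

/-! ## Control of the model where the rescaled kernel does not vanish -/

theorem eventually_forall_add_smul_mem {E : Type*} [NormedAddCommGroup E] [NormedSpace ℝ E]
    {h : ℕ → ℝ} (hh : Tendsto h atTop (𝓝 0)) {x : E} {U : Set E} (hU : U ∈ 𝓝 x) (R : ℝ) :
    ∀ᶠ t in atTop, ∀ v, ‖v‖ ≤ R → x + h t • v ∈ U := by
  obtain ⟨δ, hδ, hball⟩ := Metric.mem_nhds_iff.1 hU
  have h1 : Tendsto (fun t => |h t| * (|R| + 1)) atTop (𝓝 0) := by
    simpa using hh.abs.mul_const (|R| + 1)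
  filter_upwards [h1.eventually (gt_mem_nhds hδ)] with t ht v hv
  refine hball ?_
  rw [Metric.mem_ball, dist_eq_norm, add_sub_cancel_left, norm_smul, Real.norm_eq_abs]
  refine lt_of_le_of_lt ?_ ht
  gcongr
  linarith [le_abs_self R]

theorem isOpen_jointNhd {dI dC : ℕ} {N : Set (Regressor dI dC)} (hN : IsOpen N) (p : ℕ) :
    IsOpen (jointNhd N p) := by
  have : jointNhd N p = ⋂ i, (fun z : JointRegressor p dI dC => (z.1 i, z.2)) ⁻¹' N := by
    ext z; simp [jointNhd]
  rw [this]
  exact isOpen_iInter_of_finite fun i => hN.preimage (by fun_prop)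

section Tails

variable {dI dC : ℕ} {k : ℝ → ℝ}

theorem exists_norm_le_of_hasCompactSupport
    (hc : HasCompactSupport (productKernel k : Regressor dI dC → ℝ)) :
    ∃ R, ∀ v : Regressor dI dC, productKernel k v ≠ 0 → ‖v‖ ≤ R := by
  obtain ⟨R, hR⟩ := hc.isBounded.exists_norm_le
  exact ⟨R, fun v hv => hR v (subset_tsupport _ hv)⟩

theorem pairKernel_ne_zero {z : JointRegressor 2 dI dC} (hz : pairKernel k z ≠ 0) (i : Fin 2) :
    productKernel k (z.1 i, z.2) ≠ 0 := by
  fin_cases i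
  · exact left_ne_zero_of_mul hz
  · exact right_ne_zero_of_mul hz

theorem norm_le_of_pairKernel_ne_zero {R : ℝ}
    (hR : ∀ v : Regressor dI dC, productKernel k v ≠ 0 → ‖v‖ ≤ R)
    {z : JointRegressor 2 dI dC} (hz : pairKernel k z ≠ 0) : ‖z‖ ≤ R := by
  have h := fun i => hR _ (pairKernel_ne_zero hz i)
  refine norm_prod_le_iff.2 ⟨(pi_norm_le_iff_of_nonneg ((norm_nonneg _).trans (h 0))).2 fun i => ?_,
    (norm_snd_le (z.1 0, z.2)).trans (h 0)⟩
  exact (norm_fst_le (z.1 i, z.2)).trans (h i)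

theorem one_add_norm_le {E : Type*} [NormedAddCommGroup E] [NormedSpace ℝ E] {s : ℝ}
    (hs0 : 0 < s) (hs1 : s ≤ 1) (x v : E) : 1 + ‖x + s • v‖ ≤ (1 + ‖x‖) * (1 + ‖v‖) := by
  have h1 : ‖x + s • v‖ ≤ ‖x‖ + s * ‖v‖ := by
    refine (norm_add_le _ _).trans ?_
    rw [norm_smul, Real.norm_of_nonneg hs0.le]
  have h2 : s * ‖v‖ ≤ 1 * ‖v‖ := by gcongr
  nlinarith [mul_nonneg (norm_nonneg x) (norm_nonneg v)]

variable {h : ℕ → ℝ} {f m s2 : Regressor dI dC → ℝ} {fJ : (k : ℕ) → JointRegressor k dI dC → ℝ}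
  {sc : JointRegressor 2 dI dC → ℝ} {x : Regressor dI dC} {N : Set (Regressor dI dC)}

/-- With a compactly supported kernel the points x + h v with nonzero weight eventually lie in any
given neighbourhood of x, where continuity bounds the densities; otherwise they are bounded
globally. -/
theorem densityControl (hpos : ∀ t, 0 < h t) (hzero : Tendsto h atTop (𝓝 0))
    (hf : Measurable f) (hf0 : ∀ u, 0 ≤ f u) (hfJ : Measurable (fJ 2)) (hfJ0 : ∀ z, 0 ≤ fJ 2 z)
    (hN : IsOpen N) (hxN : x ∈ N) (hs : IsSmoothModelOn N f fJ m s2 sc)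
    (htail : HasCompactSupport (productKernel k : Regressor dI dC → ℝ) ∨
      HasModerateGrowth f fJ m s2) : DensityControl k h f (fJ 2) x := by
  have hc1 : ContinuousAt f x := hs.contDiffOn_f.continuousOn.continuousAt (hN.mem_nhds hxN)
  have hc2 : ContinuousAt (fJ 2) (diagPoint 2 x) :=
    hs.contDiffOn_f2.continuousOn.continuousAt ((isOpen_jointNhd hN 2).mem_nhds fun _ => hxN)
  refine ⟨hpos, hzero, hf, hf0, hfJ, hfJ0, hc1, hc2, ?_, ?_⟩
  · rcases htail with hcs | ⟨C, hC, -⟩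
    · obtain ⟨R, hR⟩ := exists_norm_le_of_hasCompactSupport hcs
      refine ⟨f x + 1, ?_⟩
      filter_upwards [eventually_forall_add_smul_mem hzero
        (hc1.eventually (Iic_mem_nhds (lt_add_one (f x)))) R] with t ht v hv
      exact ht v (hR v hv)
    · exact ⟨C, Eventually.of_forall fun t v _ => hC _⟩
  · rcases htail with hcs | ⟨C, -, hC, -⟩
    · obtain ⟨R, hR⟩ := exists_norm_le_of_hasCompactSupport hcs
      refine ⟨fJ 2 (diagPoint 2 x) + 1, ?_⟩
      filter_upwards [eventually_forall_add_smul_mem hzero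
        (hc2.eventually (Iic_mem_nhds (lt_add_one (fJ 2 (diagPoint 2 x))))) R] with t ht z hz
      exact ht z (norm_le_of_pairKernel_ne_zero hR hz)
    · exact ⟨C, Eventually.of_forall fun t z _ => hC _⟩

theorem exists_abs_le_of_growth (hpos : ∀ t, 0 < h t) (hzero : Tendsto h atTop (𝓝 0))
    (hm : ContinuousAt m x)
    (htail : HasCompactSupport (productKernel k : Regressor dI dC → ℝ) ∨
      HasModerateGrowth f fJ m s2) :
    ∃ C, 0 ≤ C ∧ ∀ᶠ t in atTop, ∀ v, productKernel k v ≠ 0 →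
      |m (x + h t • v)| ≤ C * (1 + ‖v‖) ^ 2 := by
  rcases htail with hcs | ⟨C, -, -, hC, -⟩
  · obtain ⟨R, hR⟩ := exists_norm_le_of_hasCompactSupport hcs
    refine ⟨|m x| + 1, by positivity, ?_⟩
    filter_upwards [eventually_forall_add_smul_mem hzero
      (hm.abs.eventually (Iic_mem_nhds (lt_add_one |m x|))) R] with t ht v hv
    refine (ht v (hR v hv) : |m (x + h t • v)| ≤ |m x| + 1).trans ?_
    refine le_mul_of_one_le_right (by positivity) (one_le_pow₀ ?_)
    linarith [norm_nonneg v]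
  · refine ⟨|C| * (1 + ‖x‖) ^ 2, by positivity, ?_⟩
    filter_upwards [hzero.eventually (Iic_mem_nhds one_pos)] with t ht v _
    calc _ ≤ |C| * (1 + ‖x + h t • v‖) ^ 2 := (hC _).trans (by gcongr; exact le_abs_self C)
      _ ≤ |C| * ((1 + ‖x‖) * (1 + ‖v‖)) ^ 2 := by
          gcongr
          exact one_add_norm_le (hpos t) ht x v
      _ = _ := by ring

/-- For a compactly supported kernel no relevant point lies off U for large t, so C = 0 works
vacuously; otherwise this is the quartic growth of σ². -/
theorem exists_le_of_growth_off (hpos : ∀ t, 0 < h t) (hzero : Tendsto h atTop (𝓝 0))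
    {U : Set (Regressor dI dC)} (hU : U ∈ 𝓝 x)
    (htail : HasCompactSupport (productKernel k : Regressor dI dC → ℝ) ∨
      HasModerateGrowth f fJ m s2) :
    ∃ C, 0 ≤ C ∧ ∀ᶠ t in atTop, ∀ v, productKernel k v ≠ 0 → x + h t • v ∉ U →
      s2 (x + h t • v) ≤ C * (1 + ‖v‖) ^ 4 := by
  rcases htail with hcs | ⟨C, -, -, -, hC⟩
  · obtain ⟨R, hR⟩ := exists_norm_le_of_hasCompactSupport hcs
    refine ⟨0, le_rfl, ?_⟩
    filter_upwards [eventually_forall_add_smul_mem hzero hU R] with t ht v hv hvU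
    exact absurd (ht v (hR v hv)) hvU
  · refine ⟨|C| * (1 + ‖x‖) ^ 4, by positivity, ?_⟩
    filter_upwards [hzero.eventually (Iic_mem_nhds one_pos)] with t ht v _ _
    calc _ ≤ |C| * (1 + ‖x + h t • v‖) ^ 4 := (hC _).trans (by gcongr; exact le_abs_self C)
      _ ≤ |C| * ((1 + ‖x‖) * (1 + ‖v‖)) ^ 4 := by
          gcongr
          exact one_add_norm_le (hpos t) ht x v
      _ = _ := by ring

/-- A first-order Taylor expansion of `(m - m(x)) f` with quadratic error, uniformly where the
rescaled kernel does not vanish. -/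
theorem exists_abs_sub_fderiv_le_of_growth (hzero : Tendsto h atTop (𝓝 0)) (hf0 : ∀ u, 0 ≤ f u)
    (hm : ContDiffAt ℝ 2 m x) (hf : ContDiffAt ℝ 2 f x)
    (htail : HasCompactSupport (productKernel k : Regressor dI dC → ℝ) ∨
      HasModerateGrowth f fJ m s2) :
    ∃ C, 0 ≤ C ∧ ∀ᶠ t in atTop, ∀ v, productKernel k v ≠ 0 →
      |(m (x + h t • v) - m x) * f (x + h t • v)
        - fderiv ℝ (fun y => (m y - m x) * f y) x (h t • v)| ≤ C * ‖h t • v‖ ^ 2 := by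
  set g : Regressor dI dC → ℝ := fun y => (m y - m x) * f y with hg
  have hgc : ContDiffAt ℝ 2 g x := (hm.sub contDiffAt_const).mul hf
  obtain ⟨C, δ, hC0, hδ, hC⟩ := hgc.exists_abs_sub_fderiv_le (by simp [hg])
  rcases htail with hcs | ⟨M, hM1, -, hM2, -⟩
  · obtain ⟨R, hR⟩ := exists_norm_le_of_hasCompactSupport hcs
    refine ⟨C, hC0, ?_⟩
    filter_upwards [eventually_forall_add_smul_mem hzero (Metric.ball_mem_nhds x hδ) R]
      with t ht v hv
    refine hC _ ?_
    simpa [dist_eq_norm] using ht v (hR v hv)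
  · set L := fderiv ℝ g x
    have hM0 : 0 ≤ M := (hf0 x).trans (hM1 x)
    -- For ‖w‖ ≥ δ one has ‖w‖/δ ≥ 1, so constant and linear terms are absorbed into multiples of
    -- ‖w‖². Here a bounds (1 + ‖x + w‖)/‖w‖, and D collects the growth of m times the bound on f,
    -- plus the linear term.
    set a := (1 + ‖x‖) / δ + 1 with ha
    set D := (M * a ^ 2 + |m x| / δ ^ 2) * M + ‖L‖ / δ with hD
    refine ⟨max C D, le_max_of_le_left hC0, Eventually.of_forall fun t v _ => ?_⟩
    set w := h t • v
    rcases lt_or_ge ‖w‖ δ with hw | hw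
    · refine (hC w hw).trans ?_
      gcongr
      exact le_max_left _ _
    · have hw1 : 1 ≤ ‖w‖ / δ := (one_le_div hδ).2 hw
      have h1 : 1 + ‖x + w‖ ≤ a * ‖w‖ := by
        have : (1 + ‖x‖) * 1 ≤ (1 + ‖x‖) * (‖w‖ / δ) := by gcongr
        calc _ ≤ (1 + ‖x‖) * 1 + ‖w‖ := by linarith [norm_add_le x w]
          _ ≤ (1 + ‖x‖) * (‖w‖ / δ) + ‖w‖ := by linarith
          _ = _ := by rw [ha]; ring
      have h2 : |m (x + w)| ≤ M * a ^ 2 * ‖w‖ ^ 2 := by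
        calc _ ≤ M * (1 + ‖x + w‖) ^ 2 := hM2 _
          _ ≤ M * (a * ‖w‖) ^ 2 := by gcongr
          _ = _ := by ring
      have h3 : |m x| ≤ |m x| / δ ^ 2 * ‖w‖ ^ 2 := by
        calc |m x| = |m x| * 1 := (mul_one _).symm
          _ ≤ |m x| * (‖w‖ / δ) ^ 2 := by gcongr; exact one_le_pow₀ hw1
          _ = _ := by ring
      have h4 : |L w| ≤ ‖L‖ / δ * ‖w‖ ^ 2 := by
        calc |L w| ≤ ‖L‖ * ‖w‖ := L.le_opNorm w
          _ ≤ ‖L‖ * ‖w‖ * (‖w‖ / δ) := le_mul_of_one_le_right (by positivity) hw1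
          _ = _ := by ring
      have h5 : |m (x + w) - m x| ≤ (M * a ^ 2 + |m x| / δ ^ 2) * ‖w‖ ^ 2 := by
        linarith [abs_sub (m (x + w)) (m x)]
      calc |(m (x + w) - m x) * f (x + w) - L w|
          ≤ |m (x + w) - m x| * f (x + w) + |L w| := by
            refine (abs_sub _ _).trans ?_
            rw [abs_mul, abs_of_nonneg (hf0 _)]
        _ ≤ ((M * a ^ 2 + |m x| / δ ^ 2) * ‖w‖ ^ 2) * M + ‖L‖ / δ * ‖w‖ ^ 2 := by
            refine add_le_add (mul_le_mul h5 (hM1 _) (hf0 _) ?_) h4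
            exact (abs_nonneg _).trans h5
        _ = D * ‖w‖ ^ 2 := by rw [hD]; ring
        _ ≤ max C D * ‖w‖ ^ 2 := by gcongr; exact le_max_right _ _

/-- The expansion of the smoothing bias: `∫ K(v) (m(x + h v) - m(x) - h² b) f(x + h v) dv = o(h²)`
for the Nadaraya-Watson bias constant `b`. -/
theorem tendsto_integral_bias (hk : IsUnivariateKernel k) (hc : DensityControl k h f (fJ 2) x)
    (hmm : Measurable m) (hm : ContDiffAt ℝ 2 m x) (hf : ContDiffAt ℝ 2 f x) (hfx : 0 < f x)
    (htail : HasCompactSupport (productKernel k : Regressor dI dC → ℝ) ∨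
      HasModerateGrowth f fJ m s2) :
    Tendsto (fun t => (∫ v, productKernel k v *
      ((m (x + h t • v) - m x - h t ^ 2 * biasNW k f m x) * f (x + h t • v))) / h t ^ 2)
      atTop (𝓝 0) := by
  set g : Regressor dI dC → ℝ := fun y => (m y - m x) * f y with hg
  have hgm : Measurable g := (hmm.sub_const _).mul hc.measurable_f
  have hgc : ContDiffAt ℝ 2 g x := (hm.sub contDiffAt_const).mul hf
  set L := fderiv ℝ g x with hL
  set β := biasNW k f m x with hβ
  obtain ⟨C, hC0, hC⟩ := exists_abs_sub_fderiv_le_of_growth hc.tendsto_zero hc.f_nonneg hm hf htail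
  have hh : Tendsto h atTop (𝓝[>] 0) :=
    tendsto_nhdsWithin_iff.2 ⟨hc.tendsto_zero, Eventually.of_forall hc.pos⟩
  -- The second-order remainder divided by h² converges along each ray to half the Hessian form and
  -- is dominated by C ‖v‖².
  have hA := tendsto_integral_weight_mul (μ := volume) hk.measurable_productKernel
    hk.productKernel_nonneg hk.integrable_weight_productKernel
    (F := fun t v => (g (x + h t • v) - h t * L v) / h t ^ 2)
    (c := fun v => fderiv ℝ (fderiv ℝ g) x v v / 2) (C := C)
    (fun t => ((hgm.comp (by fun_prop)).sub (by fun_prop)).div_const _) (by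
      filter_upwards [hC] with t ht v hv
      have hp := hc.pos t
      have h1 := ht v hv
      rw [map_smul, smul_eq_mul, norm_smul, Real.norm_of_nonneg hp.le] at h1
      rw [abs_div, abs_of_pos (by positivity : 0 < h t ^ 2), div_le_iff₀ (by positivity)]
      refine h1.trans ?_
      have hv0 := norm_nonneg v
      have h2 : ‖v‖ ^ 2 ≤ (1 + ‖v‖) ^ 4 := by
        calc ‖v‖ ^ 2 ≤ (1 + ‖v‖) ^ 2 := by gcongr; linarith
          _ ≤ (1 + ‖v‖) ^ 4 := pow_le_pow_right₀ (by linarith) (by norm_num)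
      calc C * (h t * ‖v‖) ^ 2 = C * h t ^ 2 * ‖v‖ ^ 2 := by ring
        _ ≤ C * h t ^ 2 * (1 + ‖v‖) ^ 4 := by gcongr
        _ = _ := by ring)
    (fun v => (hgc.tendsto_sub_fderiv_div_sq (by simp [hg]) v).comp hh)
  have hB := hc.tendsto_integral_mul hk.measurable_productKernel hk.productKernel_nonneg
    (fun v hv => hv) hk.integrable_weight_productKernel (ρ := fun _ _ => 1) (C := 1) (c := 1)
    (fun _ => measurable_const) (Eventually.of_forall fun t v _ => by
      rw [abs_one, one_mul]; exact one_le_pow₀ (by linarith [norm_nonneg v]))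
    (fun v => tendsto_const_nhds)
  have hlim := hA.2.sub (hB.2.const_mul β)
  rw [hk.integral_mul_bilin, hk.integral_productKernel] at hlim
  -- The bias constant is made for this cancellation.
  have hz : kernelSecondMoment k * ∑ q, fderiv ℝ (fderiv ℝ g) x (coordVec q) (coordVec q) / 2
      - β * (1 * (1 * f x)) = 0 := by
    have := biasNW_eq k hm hf hfx
    rw [one_mul, one_mul, hβ, this, sub_self]
  rw [hz] at hlim
  refine hlim.congr' ?_
  filter_upwards [hA.1, hB.1] with t h1 h2
  have hp := hc.pos t
  have hLi := (hk.integrable_mul_clm L).const_mul (h t / h t ^ 2)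
  -- Second-order remainder, plus a linear term of order 1/h that integrates to 0, minus the
  -- centring by β.
  have e : ∀ v, productKernel k v * ((m (x + h t • v) - m x - h t ^ 2 * β) * f (x + h t • v))
      / h t ^ 2 = productKernel k v * ((g (x + h t • v) - h t * L v) / h t ^ 2)
        + h t / h t ^ 2 * (productKernel k v * L v)
        - β * (productKernel k v * (1 * f (x + h t • v))) := fun v => by
    simp only [hg]
    field_simp
    ring
  rw [← integral_div]
  simp_rw [e]
  have h12 : Integrable fun v => productKernel k v * ((g (x + h t • v) - h t * L v) / h t ^ 2)
      + h t / h t ^ 2 * (productKernel k v * L v) := h1.add hLi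
  rw [integral_sub h12 (h2.const_mul β), integral_add h1 hLi, integral_const_mul,
    integral_const_mul, hk.integral_mul_clm]
  ring

end Tails

/-! ## Kernel-weighted sums over cluster samples -/

section Sequences

variable {dI dC : ℕ} {Ω : ℕ → Type*} [∀ t, MeasurableSpace (Ω t)]
  {P : ∀ t, Measure (Ω t)} {S : ∀ t, ClusterSample dI dC (Ω t)}
  {f : Regressor dI dC → ℝ} {fJ : (k : ℕ) → JointRegressor k dI dC → ℝ}
  {m s2 : Regressor dI dC → ℝ} {sc : JointRegressor 2 dI dC → ℝ}
  {k : ℝ → ℝ} {h : ℕ → ℝ} {lam : ℝ} {x : Regressor dI dC}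

namespace BandwidthCondition

variable (hb : BandwidthCondition S h lam)
include hb

theorem eventually_n_pos : ∀ᶠ t in atTop, 0 < ((S t).n : ℝ) := by
  filter_upwards [hb.tendsto_effective.eventually_gt_atTop 0] with t ht
  by_contra hn
  have : ((S t).n : ℝ) = 0 := le_antisymm (not_lt.1 hn) (Nat.cast_nonneg _)
  simp [this] at ht

theorem tendsto_inv_effective :
    Tendsto (fun t => (((S t).n : ℝ) * h t ^ (dI + dC))⁻¹) atTop (𝓝 0) :=
  tendsto_inv_atTop_zero.comp hb.tendsto_effective

end BandwidthCondition

/-- With s = ∑ n_g² the pair term acquires the factor whose limit is λ. -/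
theorem inv_effective_mul {n h s Q1 Q2 : ℝ} (hn : 0 < n) (hh : 0 < h) :
    (n * h ^ (dI + dC))⁻¹ * (n * h ^ (dI + dC) * Q1 + s * h ^ (2 * dI + dC) * Q2)
      = Q1 + 1 / n * s * h ^ dI * Q2 := by
  have e : h ^ (2 * dI + dC) = h ^ (dI + dC) * h ^ dI := by rw [← pow_add]; congr 1; ring
  rw [e]
  field_simp

theorem inv_sqrt_effective_sq {n h : ℝ} (hn : 0 ≤ n) (hh : 0 < h) (d : ℕ) :
    (√(n * h ^ d))⁻¹ ^ 2 = (n * h ^ d)⁻¹ := by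
  rw [inv_pow, Real.sq_sqrt (by positivity)]

namespace IsClusterDGP

variable (hd : IsClusterDGP P S f fJ m s2 sc)
include hd

theorem iIndepFun_sum (t : ℕ) {φ : ℝ × Regressor dI dC → ℝ} (hφ : Measurable φ) :
    iIndepFun (fun g ω => ∑ j, φ ((S t).Y g j ω, (S t).X g j ω)) (P t) :=
  (hd.indep t).comp (fun g z => ∑ j, φ (z.1 j, (z.2.1 j, z.2.2))) fun g =>
    Finset.measurable_sum _ fun j _ => hφ.comp (by fun_prop)

theorem measurable_err (t : ℕ) (g : Fin (S t).G) (j : Fin ((S t).size g)) :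
    Measurable ((S t).err m g j) :=
  ((S t).measurable_Y g j).sub (hd.measurable_m.comp ((S t).measurable_X g j))

/-- Normalized second moments of kernel-weighted sums over clusters. -/
theorem exists_tendsto_sum_integral_sq_le (hk : IsUnivariateKernel k)
    (hc : DensityControl k h f (fJ 2) x) (hb : BandwidthCondition S h lam)
    {ρ : ℕ → Regressor dI dC → ℝ} (hρ : ∀ t, Measurable (ρ t)) (hρ0 : ∀ t u, 0 ≤ ρ t u) {C c : ℝ}
    (hbd : ∀ᶠ t in atTop, ∀ v, productKernel k v ≠ 0 →
      |ρ t (x + h t • v)| ≤ C * (1 + ‖v‖) ^ 4)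
    (hlim : ∀ v, Tendsto (fun t => ρ t (x + h t • v)) atTop (𝓝 c))
    {ζ : ∀ t g, Fin ((S t).size g) → Ω t → ℝ} (hζ : ∀ t g j, Measurable (ζ t g j))
    (h1 : ∀ t g j,
      Integrable (fun ω => (S t).kern k (h t) x g j ω ^ 2 * ρ t ((S t).X g j ω)) (P t) →
      Integrable (fun ω => (S t).kern k (h t) x g j ω ^ 2 * ζ t g j ω ^ 2) (P t) ∧
      ∫ ω, (S t).kern k (h t) x g j ω ^ 2 * ζ t g j ω ^ 2 ∂(P t)
        ≤ ∫ ω, (S t).kern k (h t) x g j ω ^ 2 * ρ t ((S t).X g j ω) ∂(P t))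
    (h2 : ∀ t g j l,
      Integrable (fun ω => (S t).kern k (h t) x g j ω * (S t).kern k (h t) x g l ω
        * ρ t ((S t).X g j ω)) (P t) →
      Integrable (fun ω => (S t).kern k (h t) x g j ω * (S t).kern k (h t) x g l ω
        * ζ t g j ω ^ 2) (P t) ∧
      ∫ ω, (S t).kern k (h t) x g j ω * (S t).kern k (h t) x g l ω * ζ t g j ω ^ 2 ∂(P t)
        ≤ ∫ ω, (S t).kern k (h t) x g j ω * (S t).kern k (h t) x g l ω
          * ρ t ((S t).X g j ω) ∂(P t)) :
    (∀ᶠ t in atTop, ∀ g,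
      MemLp (fun ω => ∑ j, (S t).kern k (h t) x g j ω * ζ t g j ω) 2 (P t)) ∧
    ∃ R : ℕ → ℝ, Tendsto R atTop (𝓝 (kernelRoughness k ^ (dI + dC) * (c * f x)
        + lam * (kernelRoughness k ^ dC * (c * fJ 2 (diagPoint 2 x))))) ∧
      ∀ᶠ t in atTop, (((S t).n : ℝ) * h t ^ (dI + dC))⁻¹ *
        ∑ g, ∫ ω, (∑ j, (S t).kern k (h t) x g j ω * ζ t g j ω) ^ 2 ∂(P t) ≤ R t := by
  have hwk : ∀ v : Regressor dI dC, productKernel k v ^ 2 ≠ 0 → productKernel k v ≠ 0 :=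
    fun v hv h0 => hv (by rw [h0]; ring)
  have hQ1 := hc.tendsto_integral_mul (hk.measurable_productKernel.pow_const 2)
    (fun v => sq_nonneg _) hwk hk.integrable_weight_productKernel_sq hρ hbd hlim
  have hQ2 := hc.tendsto_integral_pair_mul hk (Ψ := fun t z => ρ t (z.1 0, z.2)) (C := C) (c := c)
    (fun t => (hρ t).comp (by fun_prop))
    (hbd.mono fun t ht z hz => ht (z.1 0, z.2) (pairKernel_ne_zero hz 0))
    (fun z => hlim (z.1 0, z.2))
  rw [IsUnivariateKernel.integral_productKernel_sq] at hQ1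
  -- The bounding sequence is the rescaled single-member integral plus (n⁻¹ ∑ n_g²) h^dI times the
  -- rescaled pair integral.
  refine ⟨?_, _, hQ1.2.add (hb.tendsto_lam.mul hQ2.2), ?_⟩
  · filter_upwards [hQ1.1, hQ2.1] with t i1 i2
    exact (hd.sum_integral_sq_le hk t (hb.pos t) x (hρ t) (hρ0 t) (hζ t) i1 i2 (h1 t) (h2 t)).1
  · filter_upwards [hQ1.1, hQ2.1, hb.eventually_n_pos] with t i1 i2 hn
    have := (hd.sum_integral_sq_le hk t (hb.pos t) x (hρ t) (hρ0 t) (hζ t) i1 i2 (h1 t) (h2 t)).2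
    have hp := hb.pos t
    refine (mul_le_mul_of_nonneg_left this (by positivity)).trans ?_
    rw [inv_effective_mul hn hp]
    exact le_rfl

theorem sum_integral_kern_mul (hk : IsUnivariateKernel k) (t : ℕ) {s : ℝ} (hs : 0 < s)
    {ρ : Regressor dI dC → ℝ} (hρ : Measurable ρ)
    (hi : Integrable fun v => productKernel k v * (ρ (x + s • v) * f (x + s • v))) (a : ℝ) :
    ∑ g, ∫ ω, ∑ j, a * ((S t).kern k s x g j ω * ρ ((S t).X g j ω)) ∂(P t)
      = a * ((S t).n * s ^ (dI + dC))
        * ∫ v, productKernel k v * (ρ (x + s • v) * f (x + s • v)) := by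
  have hX : ∀ g j, (Integrable (fun ω => (S t).kern k s x g j ω * ρ ((S t).X g j ω)) (P t) ↔
      Integrable fun v => productKernel k v * (ρ (x + s • v) * f (x + s • v))) ∧
      ∫ ω, (S t).kern k s x g j ω * ρ ((S t).X g j ω) ∂(P t) = s ^ (dI + dC) *
        ∫ v, productKernel k v * (ρ (x + s • v) * f (x + s • v)) := fun g j =>
    hd.integral_weight_X t g j hk.measurable_productKernel hρ x hs
  calc _ = ∑ g, ∑ j : Fin ((S t).size g), a * (s ^ (dI + dC) *
        ∫ v, productKernel k v * (ρ (x + s • v) * f (x + s • v))) := by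
        refine Finset.sum_congr rfl fun g _ => ?_
        rw [integral_finsetSum _ fun j _ => ((hX g j).1.2 hi).const_mul a]
        refine Finset.sum_congr rfl fun j _ => ?_
        rw [integral_const_mul]
        rw [(hX g j).2]
    _ = _ := by
        simp only [Finset.sum_const, Finset.card_univ, Fintype.card_fin, nsmul_eq_mul,
          ClusterSample.n, ← Finset.sum_mul]
        push_cast
        ring

variable [∀ t, IsProbabilityMeasure (P t)]

/-- Consistency of the kernel density estimator. -/
theorem tendsto_measure_density_sub_ge (hk : IsUnivariateKernel k)
    (hc : DensityControl k h f (fJ 2) x) (hb : BandwidthCondition S h lam) {ε : ℝ} (hε : 0 < ε) :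
    Tendsto (fun t => P t {ω | ε ≤ |∑ g, ∑ j, (((S t).n : ℝ) * h t ^ (dI + dC))⁻¹ *
      ((S t).kern k (h t) x g j ω * 1) - f x|}) atTop (𝓝 0) := by
  have hone : ∀ v : Regressor dI dC, |(1 : ℝ)| ≤ 1 * (1 + ‖v‖) ^ 4 := fun v => by
    rw [abs_one, one_mul]; exact one_le_pow₀ (by linarith [norm_nonneg v])
  obtain ⟨hL, R, hR, hle⟩ := hd.exists_tendsto_sum_integral_sq_le hk hc hb
    (ρ := fun _ _ => 1) (C := 1) (c := 1) (ζ := fun _ _ _ _ => 1) (fun _ => measurable_const)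
    (fun _ _ => zero_le_one) (Eventually.of_forall fun t v _ => hone v)
    (fun v => tendsto_const_nhds) (fun _ _ _ => measurable_const)
    (fun t g j hi => by simpa using hi) (fun t g j l hi => by simpa using hi)
  have hQ := hc.tendsto_integral_mul hk.measurable_productKernel hk.productKernel_nonneg
    (fun v hv => hv) hk.integrable_weight_productKernel (ρ := fun _ _ => 1) (C := 1) (c := 1)
    (fun _ => measurable_const) (Eventually.of_forall fun t v _ => hone v)
    (fun v => tendsto_const_nhds)
  refine tendsto_measure_sum_sub_ge
    (W := fun t g ω => ∑ j, (((S t).n : ℝ) * h t ^ (dI + dC))⁻¹ *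
      ((S t).kern k (h t) x g j ω * 1)) (fun t => ?_) ?_ ?_ ?_ hε
  · exact hd.iIndepFun_sum t (φ := fun z => (((S t).n : ℝ) * h t ^ (dI + dC))⁻¹ *
      (productKernel k ((h t)⁻¹ • (z.2 - x)) * 1))
      (((hk.measurable_productKernel.comp (by fun_prop)).mul_const 1).const_mul _)
  · filter_upwards [hL] with t ht g
    simp_rw [← Finset.mul_sum]
    exact (ht g).const_mul _
  · rw [hk.integral_productKernel, one_mul, one_mul] at hQ
    refine hQ.2.congr' ?_
    filter_upwards [hQ.1, hb.eventually_n_pos] with t i1 hn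
    have hp := hb.pos t
    rw [hd.sum_integral_kern_mul hk t hp measurable_const i1, inv_mul_cancel₀ (by positivity),
      one_mul]
  -- The density estimator is normalized by E⁻¹ instead of E^(-1/2), so its second moments carry one
  -- more factor E⁻¹ → 0.
  · have hz : Tendsto (fun t => (((S t).n : ℝ) * h t ^ (dI + dC))⁻¹ * R t) atTop (𝓝 0) := by
      simpa using hb.tendsto_inv_effective.mul hR
    refine tendsto_of_tendsto_of_tendsto_of_le_of_le' tendsto_const_nhds hz
      (Eventually.of_forall fun t => Finset.sum_nonneg fun g _ => integral_nonneg fun ω =>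
        sq_nonneg _) ?_
    filter_upwards [hle] with t ht
    have hp := hb.pos t
    refine le_trans (le_of_eq ?_) (mul_le_mul_of_nonneg_left ht (by positivity))
    simp_rw [← Finset.mul_sum, mul_pow, integral_const_mul]
    rw [← Finset.mul_sum]
    ring

/-- Scaled kernel-weighted sums vanish in probability when their means do and the second moments
of their summands are dominated by a vanishing function of the regressors. -/
theorem tendsto_measure_scaled_sum_ge (hk : IsUnivariateKernel k)
    (hc : DensityControl k h f (fJ 2) x) (hb : BandwidthCondition S h lam)
    {ρ : ℕ → Regressor dI dC → ℝ} (hρ : ∀ t, Measurable (ρ t)) (hρ0 : ∀ t u, 0 ≤ ρ t u) {C : ℝ}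
    (hbd : ∀ᶠ t in atTop, ∀ v, productKernel k v ≠ 0 →
      |ρ t (x + h t • v)| ≤ C * (1 + ‖v‖) ^ 4)
    (hlim : ∀ v, Tendsto (fun t => ρ t (x + h t • v)) atTop (𝓝 0))
    {φ : ℕ → ℝ × Regressor dI dC → ℝ} (hφ : ∀ t, Measurable (φ t))
    (h1 : ∀ t g j,
      Integrable (fun ω => (S t).kern k (h t) x g j ω ^ 2 * ρ t ((S t).X g j ω)) (P t) →
      Integrable (fun ω => (S t).kern k (h t) x g j ω ^ 2
        * φ t ((S t).Y g j ω, (S t).X g j ω) ^ 2) (P t) ∧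
      ∫ ω, (S t).kern k (h t) x g j ω ^ 2 * φ t ((S t).Y g j ω, (S t).X g j ω) ^ 2 ∂(P t)
        ≤ ∫ ω, (S t).kern k (h t) x g j ω ^ 2 * ρ t ((S t).X g j ω) ∂(P t))
    (h2 : ∀ t g j l,
      Integrable (fun ω => (S t).kern k (h t) x g j ω * (S t).kern k (h t) x g l ω
        * ρ t ((S t).X g j ω)) (P t) →
      Integrable (fun ω => (S t).kern k (h t) x g j ω * (S t).kern k (h t) x g l ω
        * φ t ((S t).Y g j ω, (S t).X g j ω) ^ 2) (P t) ∧
      ∫ ω, (S t).kern k (h t) x g j ω * (S t).kern k (h t) x g l ω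
          * φ t ((S t).Y g j ω, (S t).X g j ω) ^ 2 ∂(P t)
        ≤ ∫ ω, (S t).kern k (h t) x g j ω * (S t).kern k (h t) x g l ω
          * ρ t ((S t).X g j ω) ∂(P t))
    (hmean : Tendsto (fun t => ∑ g, ∫ ω, ∑ j, (√(((S t).n : ℝ) * h t ^ (dI + dC)))⁻¹ *
      ((S t).kern k (h t) x g j ω * φ t ((S t).Y g j ω, (S t).X g j ω)) ∂(P t)) atTop (𝓝 0))
    {ε : ℝ} (hε : 0 < ε) :
    Tendsto (fun t => P t {ω | ε ≤ |∑ g, ∑ j, (√(((S t).n : ℝ) * h t ^ (dI + dC)))⁻¹ *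
      ((S t).kern k (h t) x g j ω * φ t ((S t).Y g j ω, (S t).X g j ω)) - 0|}) atTop (𝓝 0) := by
  obtain ⟨hL, R, hR, hle⟩ := hd.exists_tendsto_sum_integral_sq_le hk hc hb hρ hρ0 hbd hlim
    (ζ := fun t g j ω => φ t ((S t).Y g j ω, (S t).X g j ω))
    (fun t g j => (hφ t).comp (((S t).measurable_Y g j).prodMk ((S t).measurable_X g j))) h1 h2
  refine tendsto_measure_sum_sub_ge
    (W := fun t g ω => ∑ j, (√(((S t).n : ℝ) * h t ^ (dI + dC)))⁻¹ *
      ((S t).kern k (h t) x g j ω * φ t ((S t).Y g j ω, (S t).X g j ω)))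
    (fun t => ?_) ?_ hmean ?_ hε
  · exact hd.iIndepFun_sum t (φ := fun z => (√(((S t).n : ℝ) * h t ^ (dI + dC)))⁻¹ *
      (productKernel k ((h t)⁻¹ • (z.2 - x)) * φ t z))
      (((hk.measurable_productKernel.comp (by fun_prop)).mul (hφ t)).const_mul _)
  · filter_upwards [hL] with t ht g
    simp_rw [← Finset.mul_sum]
    exact (ht g).const_mul _
  -- The dominating function tends to c = 0, hence both parts of the limit of R vanish.
  · simp only [zero_mul, mul_zero, add_zero] at hR
    refine tendsto_of_tendsto_of_tendsto_of_le_of_le' tendsto_const_nhds hR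
      (Eventually.of_forall fun t => Finset.sum_nonneg fun g _ => integral_nonneg fun ω =>
        sq_nonneg _) ?_
    filter_upwards [hle] with t ht
    refine le_trans (le_of_eq ?_) ht
    simp_rw [← Finset.mul_sum, mul_pow, integral_const_mul,
      inv_sqrt_effective_sq (Nat.cast_nonneg (S t).n) (hb.pos t)]
    rw [← Finset.mul_sum]

/-- The smoothing bias of the Nadaraya-Watson estimator is asymptotically `h²` times the bias
constant. -/
theorem tendsto_measure_bias_ge (hk : IsUnivariateKernel k)
    (hc : DensityControl k h f (fJ 2) x) (hb : BandwidthCondition S h lam)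
    (hm : ContDiffAt ℝ 2 m x) (hf : ContDiffAt ℝ 2 f x) (hfx : 0 < f x)
    (htail : HasCompactSupport (productKernel k : Regressor dI dC → ℝ) ∨
      HasModerateGrowth f fJ m s2) {ε : ℝ} (hε : 0 < ε) :
    Tendsto (fun t => P t {ω | ε ≤ |∑ g, ∑ j, (√(((S t).n : ℝ) * h t ^ (dI + dC)))⁻¹ *
      ((S t).kern k (h t) x g j ω *
        (m ((S t).X g j ω) - m x - h t ^ 2 * biasNW k f m x)) - 0|}) atTop (𝓝 0) := by
  set β := biasNW k f m x with hβ
  have hmm := hd.measurable_m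
  obtain ⟨C, hC0, hC⟩ := exists_abs_le_of_growth (k := k) hb.pos hb.tendsto_zero hm.continuousAt
    htail
  have hμbd : ∀ᶠ t in atTop, ∀ v, productKernel k v ≠ 0 →
      |m (x + h t • v) - m x - h t ^ 2 * β| ≤ (C + |m x| + |β|) * (1 + ‖v‖) ^ 2 := by
    filter_upwards [hC, hb.tendsto_zero.eventually (Iic_mem_nhds one_pos)] with t ht ht1 v hv
    have hp := hb.pos t
    have h1 := ht v hv
    have h2 : (1 : ℝ) ≤ (1 + ‖v‖) ^ 2 := one_le_pow₀ (by linarith [norm_nonneg v])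
    have h3 : |h t ^ 2 * β| ≤ |β| := by
      rw [abs_mul, abs_of_pos (by positivity : 0 < h t ^ 2)]
      exact mul_le_of_le_one_left (abs_nonneg _) (pow_le_one₀ hp.le ht1)
    calc _ ≤ |m (x + h t • v)| + |m x| + |h t ^ 2 * β| :=
          (abs_sub _ _).trans (add_le_add_left (abs_sub _ _) _)
      _ ≤ C * (1 + ‖v‖) ^ 2 + |m x| * 1 + |β| * 1 := by linarith
      _ ≤ C * (1 + ‖v‖) ^ 2 + |m x| * (1 + ‖v‖) ^ 2 + |β| * (1 + ‖v‖) ^ 2 := by gcongr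
      _ = _ := by ring
  have hμlim : ∀ v, Tendsto (fun t => m (x + h t • v) - m x - h t ^ 2 * β) atTop (𝓝 0) := by
    intro v
    have h1 := hm.continuousAt.tendsto.comp (tendsto_add_smul hb.tendsto_zero x v)
    have h2 := (h1.sub_const (m x)).sub ((hb.tendsto_zero.pow 2).mul_const β)
    simpa using h2
  have hbd' : ∀ᶠ t in atTop, ∀ v, productKernel k v ≠ 0 →
      |m (x + h t • v) - m x - h t ^ 2 * β| ≤ (C + |m x| + |β|) * (1 + ‖v‖) ^ 4 := by
    filter_upwards [hμbd] with t ht v hv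
    refine (ht v hv).trans ?_
    gcongr
    · linarith [norm_nonneg v]
    · norm_num
  have hQ := hc.tendsto_integral_mul hk.measurable_productKernel hk.productKernel_nonneg
    (fun v hv => hv) hk.integrable_weight_productKernel
    (ρ := fun t u => m u - m x - h t ^ 2 * β) (fun t => (hmm.sub_const _).sub_const _) hbd' hμlim
  refine hd.tendsto_measure_scaled_sum_ge hk hc hb
    (ρ := fun t u => (m u - m x - h t ^ 2 * β) ^ 2)
    (φ := fun t z => m z.2 - m x - h t ^ 2 * β) (C := (C + |m x| + |β|) ^ 2)
    (fun t => ((hmm.sub_const _).sub_const _).pow_const 2) (fun t u => sq_nonneg _) ?_ ?_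
    (fun t => ((hmm.comp measurable_snd).sub_const _).sub_const _) (fun t g j hi => ⟨hi, le_rfl⟩)
    (fun t g j l hi => ⟨hi, le_rfl⟩) ?_ hε
  · filter_upwards [hμbd] with t ht v hv
    rw [abs_pow]
    calc _ ≤ ((C + |m x| + |β|) * (1 + ‖v‖) ^ 2) ^ 2 := by gcongr; exact ht v hv
      _ = _ := by ring
  · intro v
    simpa using (hμlim v).pow 2
  -- The mean equals √(n h^d) h² times the bias integral divided by h²: the first factor is bounded
  -- because n h^(d+4) is, the second tends to 0.
  · have hbias := tendsto_integral_bias hk hc hmm hm hf hfx htail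
    obtain ⟨M, hM⟩ := hb.bias_isBigO.bound
    have hbdd : ∀ᶠ t in atTop,
        ‖√(((S t).n : ℝ) * h t ^ (dI + dC)) * h t ^ 2‖ ≤ √|M| := by
      filter_upwards [hM] with t ht
      have hp := hb.pos t
      rw [Real.norm_of_nonneg (by positivity)]
      refine Real.le_sqrt_of_sq_le ?_
      rw [mul_pow, Real.sq_sqrt (by positivity)]
      rw [norm_one, mul_one, Real.norm_of_nonneg (by positivity)] at ht
      calc _ = ((S t).n : ℝ) * h t ^ (dI + dC + 4) := by ring
        _ ≤ |M| := ht.trans (le_abs_self M)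
    have hlim := bdd_le_mul_tendsto_zero' (√|M|) hbdd hbias
    refine hlim.congr' ?_
    filter_upwards [hQ.1, hb.eventually_n_pos] with t i1 hn
    have hp := hb.pos t
    rw [hd.sum_integral_kern_mul hk t hp ((hmm.sub_const _).sub_const _) i1]
    have hpos : 0 < ((S t).n : ℝ) * h t ^ (dI + dC) := by positivity
    have e : (√(((S t).n : ℝ) * h t ^ (dI + dC)))⁻¹ * (((S t).n : ℝ) * h t ^ (dI + dC))
        = √(((S t).n : ℝ) * h t ^ (dI + dC)) := by
      rw [inv_mul_eq_div, Real.div_sqrt]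
    rw [e]
    field_simp
    rfl

end IsClusterDGP

end Sequences

/-! ## Sums of kernel-weighted errors -/

section Errors

variable {dI dC : ℕ} {Ω : ℕ → Type*} [∀ t, MeasurableSpace (Ω t)]
  {P : ∀ t, Measure (Ω t)} {S : ∀ t, ClusterSample dI dC (Ω t)}
  {f : Regressor dI dC → ℝ} {fJ : (k : ℕ) → JointRegressor k dI dC → ℝ}
  {m s2 : Regressor dI dC → ℝ} {sc : JointRegressor 2 dI dC → ℝ}
  {k : ℝ → ℝ} {h : ℕ → ℝ} {lam : ℝ} {x : Regressor dI dC}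

/-- The indicator function of a set, with values in `ℝ`. -/
noncomputable def oneOn {α : Type*} (U : Set α) : α → ℝ := U.indicator fun _ => 1

section oneOn

variable {α : Type*} {U : Set α} {u : α}

theorem oneOn_of_mem (hu : u ∈ U) : oneOn U u = 1 := Set.indicator_of_mem hu _

theorem oneOn_of_notMem (hu : u ∉ U) : oneOn U u = 0 := Set.indicator_of_notMem hu _

theorem oneOn_nonneg : 0 ≤ oneOn U u := Set.indicator_nonneg (fun _ _ => zero_le_one) _

theorem oneOn_le_one : oneOn U u ≤ 1 := Set.indicator_le_self' (fun _ _ => zero_le_one) _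

theorem oneOn_sq : oneOn U u ^ 2 = oneOn U u := by
  by_cases hu : u ∈ U
  · simp [oneOn_of_mem hu]
  · simp [oneOn_of_notMem hu]

theorem abs_oneOn_le_one : |oneOn U u| ≤ 1 := by
  rw [abs_of_nonneg oneOn_nonneg]; exact oneOn_le_one

theorem measurable_oneOn [MeasurableSpace α] (hU : MeasurableSet U) : Measurable (oneOn U) :=
  measurable_const.indicator hU

end oneOn

namespace IsClusterDGP

variable (hd : IsClusterDGP P S f fJ m s2 sc) [∀ t, IsProbabilityMeasure (P t)]
include hd

theorem integral_mul_err (t : ℕ) (g : Fin (S t).G) (j : Fin ((S t).size g)) {w : Ω t → ℝ}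
    (hw : Measurable[(S t).sigmaX g] w) {c : ℝ} (hc : ∀ ω, |w ω| ≤ c) :
    Integrable (fun ω => w ω * (S t).err m g j ω) (P t) ∧
      ∫ ω, w ω * (S t).err m g j ω ∂(P t) = 0 := by
  obtain ⟨h1, -, h3⟩ := integral_mul_eq_of_condExp ((S t).sigmaX_le g)
    ((hd.memLp_err t g j).integrable (by norm_num)) hw hc (hd.cond_mean t g j)
  exact ⟨h1, by rw [h3]; simp⟩

theorem integral_mul_err_sq (t : ℕ) (g : Fin (S t).G) (j : Fin ((S t).size g)) {w : Ω t → ℝ}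
    (hw : Measurable[(S t).sigmaX g] w) {c : ℝ} (hc : ∀ ω, |w ω| ≤ c) :
    Integrable (fun ω => w ω * (S t).err m g j ω ^ 2) (P t) ∧
      Integrable (fun ω => w ω * s2 ((S t).X g j ω)) (P t) ∧
      ∫ ω, w ω * (S t).err m g j ω ^ 2 ∂(P t) = ∫ ω, w ω * s2 ((S t).X g j ω) ∂(P t) :=
  integral_mul_eq_of_condExp ((S t).sigmaX_le g) (hd.memLp_err t g j).integrable_sq hw hc
    (hd.cond_var t g j)

theorem integral_mul_err_mul_err (t : ℕ) (g : Fin (S t).G) {j l : Fin ((S t).size g)}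
    (hjl : j ≠ l) {w : Ω t → ℝ} (hw : Measurable[(S t).sigmaX g] w) {c : ℝ}
    (hc : ∀ ω, |w ω| ≤ c) :
    ∫ ω, w ω * ((S t).err m g j ω * (S t).err m g l ω) ∂(P t)
      = ∫ ω, w ω * sc ((S t).jointX g ![j, l] ω) ∂(P t) :=
  (integral_mul_eq_of_condExp ((S t).sigmaX_le g)
    ((hd.memLp_err t g j).integrable_mul (hd.memLp_err t g l)) hw hc (hd.cond_cov t g j l hjl)).2.2

omit hd [∀ t, IsProbabilityMeasure (P t)] in
theorem measurable_sigmaX_oneOn {U : Set (Regressor dI dC)} (hU : MeasurableSet U) (t : ℕ)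
    (g : Fin (S t).G) (j : Fin ((S t).size g)) :
    Measurable[(S t).sigmaX g] fun ω => oneOn U ((S t).X g j ω) :=
  (measurable_oneOn hU).comp ((S t).measurable_sigmaX_X g j)

/-- Kernel-weighted errors at regressors away from `x` are negligible. -/
theorem tendsto_measure_err_off_ge (hk : IsUnivariateKernel k)
    (hc : DensityControl k h f (fJ 2) x) (hb : BandwidthCondition S h lam)
    (htail : HasCompactSupport (productKernel k : Regressor dI dC → ℝ) ∨
      HasModerateGrowth f fJ m s2) {U : Set (Regressor dI dC)} (hU : MeasurableSet U)
    (hUx : U ∈ 𝓝 x) {ε : ℝ} (hε : 0 < ε) :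
    Tendsto (fun t => P t {ω | ε ≤ |∑ g, ∑ j, (√(((S t).n : ℝ) * h t ^ (dI + dC)))⁻¹ *
      ((S t).kern k (h t) x g j ω *
        (oneOn Uᶜ ((S t).X g j ω) * (S t).err m g j ω)) - 0|}) atTop (𝓝 0) := by
  obtain ⟨b, hb1, hkb⟩ := hk.exists_productKernel_bound (dI := dI) (dC := dC)
  obtain ⟨C, hC0, hC⟩ := exists_le_of_growth_off (k := k) hb.pos hb.tendsto_zero hUx htail
  have hmm := hd.measurable_m
  have hs2 := hd.measurable_s2
  have hoff := measurable_oneOn hU.compl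
  have hw : ∀ t g (j l i : Fin ((S t).size g)), Measurable[(S t).sigmaX g] fun ω =>
      (S t).kern k (h t) x g j ω * (S t).kern k (h t) x g l ω * oneOn Uᶜ ((S t).X g i ω) :=
    fun t g j l i => (((S t).measurable_sigmaX_kern hk (h t) x g j).mul
      ((S t).measurable_sigmaX_kern hk (h t) x g l)).mul (measurable_sigmaX_oneOn hU.compl t g i)
  have hwb : ∀ t g (j l i : Fin ((S t).size g)) ω,
      |(S t).kern k (h t) x g j ω * (S t).kern k (h t) x g l ω * oneOn Uᶜ ((S t).X g i ω)|
        ≤ b * b * 1 := by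
    intro t g j l i ω
    rw [abs_mul, abs_mul, abs_of_nonneg ((S t).kern_nonneg hk _ _ _ _ _),
      abs_of_nonneg ((S t).kern_nonneg hk _ _ _ _ _)]
    have := (S t).kern_nonneg hk (h t) x g l ω
    exact mul_le_mul (mul_le_mul (hkb _) (hkb _) this (by linarith)) abs_oneOn_le_one
      (abs_nonneg _) (by positivity)
  -- The dominating function must be nonnegative everywhere, whereas σ² is known to be so only
  -- almost surely at the regressors; hence the positive part.
  have key : ∀ t g (j l : Fin ((S t).size g)),
      Integrable (fun ω => (S t).kern k (h t) x g j ω * (S t).kern k (h t) x g l ω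
        * (oneOn Uᶜ ((S t).X g j ω) * max (s2 ((S t).X g j ω)) 0)) (P t) →
      Integrable (fun ω => (S t).kern k (h t) x g j ω * (S t).kern k (h t) x g l ω
        * (oneOn Uᶜ ((S t).X g j ω) * (S t).err m g j ω) ^ 2) (P t) ∧
      ∫ ω, (S t).kern k (h t) x g j ω * (S t).kern k (h t) x g l ω
          * (oneOn Uᶜ ((S t).X g j ω) * (S t).err m g j ω) ^ 2 ∂(P t)
        ≤ ∫ ω, (S t).kern k (h t) x g j ω * (S t).kern k (h t) x g l ω
          * (oneOn Uᶜ ((S t).X g j ω) * max (s2 ((S t).X g j ω)) 0) ∂(P t) := by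
    intro t g j l hi
    obtain ⟨i1, i2, i3⟩ := hd.integral_mul_err_sq t g j (hw t g j l j) (hwb t g j l j)
    simp_rw [mul_pow, oneOn_sq, ← mul_assoc]
    refine ⟨i1, i3.le.trans (integral_mono i2 (by simpa only [← mul_assoc] using hi) fun ω => ?_)⟩
    have h1 := (S t).kern_nonneg hk (h t) x g j ω
    have h2 := (S t).kern_nonneg hk (h t) x g l ω
    have h3 : 0 ≤ oneOn Uᶜ ((S t).X g j ω) := oneOn_nonneg
    simp only
    gcongr
    exact le_max_left _ _
  refine hd.tendsto_measure_scaled_sum_ge hk hc hb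
    (ρ := fun t u => oneOn Uᶜ u * max (s2 u) 0) (C := C)
    (φ := fun t z => oneOn Uᶜ z.2 * (z.1 - m z.2))
    (fun t => hoff.mul (hs2.max measurable_const))
    (fun t u => mul_nonneg oneOn_nonneg (le_max_right _ _)) ?_ ?_
    (fun t => (hoff.comp measurable_snd).mul (measurable_fst.sub (hmm.comp measurable_snd)))
    (fun t g j hi => by
      have := key t g j j (by simpa only [← sq] using hi)
      simp only [← sq] at this
      exact this)
    (fun t g j l hi => key t g j l hi) ?_ hε
  · filter_upwards [hC] with t ht v hv
    rw [abs_of_nonneg (mul_nonneg oneOn_nonneg (le_max_right _ _))]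
    by_cases hu : x + h t • v ∈ U
    · rw [oneOn_of_notMem (by simpa using hu), zero_mul]; positivity
    · rw [oneOn_of_mem (by simpa using hu), one_mul]
      exact max_le (ht v hv hu) (by positivity)
  -- For fixed v the point x + h v eventually lies in U, so the truncated variance there is
  -- eventually 0.
  · intro v
    refine tendsto_const_nhds.congr' ?_
    filter_upwards [(tendsto_add_smul hb.tendsto_zero x v).eventually hUx] with t ht
    rw [oneOn_of_notMem (Set.notMem_compl_iff.2 ht), zero_mul]
  · refine tendsto_const_nhds.congr fun t => (Finset.sum_eq_zero fun g _ => ?_).symm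
    have hj : ∀ j, Integrable (fun ω => (√(((S t).n : ℝ) * h t ^ (dI + dC)))⁻¹ *
        ((S t).kern k (h t) x g j ω * (oneOn Uᶜ ((S t).X g j ω) * (S t).err m g j ω))) (P t) ∧
        ∫ ω, (√(((S t).n : ℝ) * h t ^ (dI + dC)))⁻¹ * ((S t).kern k (h t) x g j ω *
          (oneOn Uᶜ ((S t).X g j ω) * (S t).err m g j ω)) ∂(P t) = 0 := by
      intro j
      have := hd.integral_mul_err t g j
        (w := fun ω => (S t).kern k (h t) x g j ω * oneOn Uᶜ ((S t).X g j ω))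
        (((S t).measurable_sigmaX_kern hk (h t) x g j).mul
          (measurable_sigmaX_oneOn hU.compl t g j)) (c := b * 1) (fun ω => by
          rw [abs_mul, abs_of_nonneg ((S t).kern_nonneg hk _ _ _ _ _)]
          exact mul_le_mul (hkb _) abs_oneOn_le_one (abs_nonneg _) (by linarith))
      simp_rw [mul_assoc] at this
      exact ⟨this.1.const_mul _, by rw [integral_const_mul, this.2, mul_zero]⟩
    rw [show (fun ω => ∑ j, (√(((S t).n : ℝ) * h t ^ (dI + dC)))⁻¹ * ((S t).kern k (h t) x g j ω *
        (oneOn Uᶜ ((S t).X g j ω) * ((S t).Y g j ω - m ((S t).X g j ω)))))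
      = fun ω => ∑ j, (√(((S t).n : ℝ) * h t ^ (dI + dC)))⁻¹ * ((S t).kern k (h t) x g j ω *
        (oneOn Uᶜ ((S t).X g j ω) * (S t).err m g j ω)) from rfl,
      integral_finsetSum _ fun j _ => (hj j).1]
    exact Finset.sum_eq_zero fun j _ => (hj j).2

end IsClusterDGP

/-- On a small neighbourhood of `x` the variance and covariance functions are bounded. -/
theorem exists_nhds_bounds {N : Set (Regressor dI dC)} (hN : N ∈ 𝓝 x) (hs2 : ContinuousAt s2 x)
    (hsc : ContinuousAt sc (diagPoint 2 x)) :
    ∃ U : Set (Regressor dI dC), IsOpen U ∧ x ∈ U ∧ U ⊆ N ∧ ∃ C, 0 ≤ C ∧ (∀ u ∈ U, |s2 u| ≤ C) ∧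
      ∀ z ∈ jointNhd U 2, |sc z| ≤ C := by
  set C := max (|s2 x| + 1) (|sc (diagPoint 2 x)| + 1) with hC
  have h1 : ∀ᶠ u in 𝓝 x, |s2 u| ≤ C :=
    hs2.abs.eventually (Iic_mem_nhds ((lt_add_one _).trans_le (le_max_left _ _)))
  have h2 : ∀ᶠ z in 𝓝 (diagPoint 2 x), |sc z| ≤ C :=
    hsc.abs.eventually (Iic_mem_nhds ((lt_add_one _).trans_le (le_max_right _ _)))
  obtain ⟨δ, hδ, hδ1⟩ := Metric.mem_nhds_iff.1 (inter_mem hN h1)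
  obtain ⟨η, hη, hη1⟩ := Metric.mem_nhds_iff.1 h2
  have hmin : 0 < min δ η := lt_min hδ hη
  refine ⟨Metric.ball x (min δ η), Metric.isOpen_ball, Metric.mem_ball_self hmin,
    fun u hu => (hδ1 (Metric.ball_subset_ball (min_le_left _ _) hu)).1, C,
    (by positivity : (0 : ℝ) ≤ |s2 x| + 1).trans (le_max_left _ _),
    fun u hu => (hδ1 (Metric.ball_subset_ball (min_le_left _ _) hu)).2, fun z hz => hη1 ?_⟩
  refine Metric.ball_subset_ball (min_le_right δ η) ?_
  -- In the sup norm, all (z_i, z_cls) being in a ball around x forces z into the ball of the same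
  -- radius around the diagonal point.
  have hz' : ∀ i, dist (z.1 i) x.1 < min δ η ∧ dist z.2 x.2 < min δ η := fun i => by
    have := hz i
    rwa [Metric.mem_ball, Prod.dist_eq, max_lt_iff] at this
  rw [Metric.mem_ball, Prod.dist_eq, max_lt_iff]
  exact ⟨(dist_pi_lt_iff hmin).2 fun i => (hz' i).1, (hz' 0).2⟩

/-- The contribution of cluster `g` to the numerator of the estimator made by the errors at
regressors in `U`. -/
noncomputable def ClusterSample.score {Ω : Type*} [MeasurableSpace Ω] (S : ClusterSample dI dC Ω)
    (k : ℝ → ℝ) (h : ℝ) (m : Regressor dI dC → ℝ) (x : Regressor dI dC)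
    (U : Set (Regressor dI dC)) (g : Fin S.G) (ω : Ω) : ℝ :=
  ∑ j, (√((S.n : ℝ) * h ^ (dI + dC)))⁻¹ *
    (S.kern k h x g j ω * (oneOn U (S.X g j ω) * S.err m g j ω))

/-! ### First and second moments of the cluster scores -/

namespace IsClusterDGP

variable (hd : IsClusterDGP P S f fJ m s2 sc) [∀ t, IsProbabilityMeasure (P t)]
  {U : Set (Regressor dI dC)}
include hd

omit [∀ t, IsProbabilityMeasure (P t)] in
theorem measurable_score (hk : IsUnivariateKernel k) (hU : MeasurableSet U) (t : ℕ) (s : ℝ)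
    (g : Fin (S t).G) : Measurable ((S t).score k s m x U g) :=
  Finset.measurable_sum _ fun j _ => (((S t).measurable_kern hk s x g j).mul
    (((measurable_oneOn hU).comp ((S t).measurable_X g j)).mul (hd.measurable_err t g j))).const_mul _

omit [∀ t, IsProbabilityMeasure (P t)] in
theorem iIndepFun_score (hk : IsUnivariateKernel k) (hU : MeasurableSet U) (t : ℕ) (s : ℝ) :
    iIndepFun ((S t).score k s m x U) (P t) :=
  hd.iIndepFun_sum t (φ := fun z => (√(((S t).n : ℝ) * s ^ (dI + dC)))⁻¹ *
      (productKernel k (s⁻¹ • (z.2 - x)) * (oneOn U z.2 * (z.1 - m z.2))))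
    (((hk.measurable_productKernel.comp (by fun_prop)).mul
      (((measurable_oneOn hU).comp measurable_snd).mul
        (measurable_fst.sub (hd.measurable_m.comp measurable_snd)))).const_mul _)

omit [∀ t, IsProbabilityMeasure (P t)] in
theorem memLp_kern_mul_err (hk : IsUnivariateKernel k) (hU : MeasurableSet U) (t : ℕ) (s : ℝ)
    (g : Fin (S t).G) (j : Fin ((S t).size g)) :
    MemLp (fun ω => (S t).kern k s x g j ω * (oneOn U ((S t).X g j ω) * (S t).err m g j ω)) 2
      (P t) := by
  obtain ⟨b, hb1, hkb⟩ := hk.exists_productKernel_bound (dI := dI) (dC := dC)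
  refine MemLp.of_le_mul (c := b) (hd.memLp_err t g j) (((S t).measurable_kern hk s x g j).mul
    (((measurable_oneOn hU).comp ((S t).measurable_X g j)).mul
      (hd.measurable_err t g j))).aestronglyMeasurable (ae_of_all _ fun ω => ?_)
  rw [norm_mul, norm_mul, Real.norm_of_nonneg ((S t).kern_nonneg hk s x g j ω)]
  gcongr
  · exact hkb _
  · exact mul_le_of_le_one_left (norm_nonneg _) abs_oneOn_le_one

omit [∀ t, IsProbabilityMeasure (P t)] in
theorem memLp_score (hk : IsUnivariateKernel k) (hU : MeasurableSet U) (t : ℕ) (s : ℝ)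
    (g : Fin (S t).G) : MemLp ((S t).score k s m x U g) 2 (P t) :=
  memLp_finsetSum _ fun j _ => (hd.memLp_kern_mul_err hk hU t s g j).const_mul _

theorem integral_score (hk : IsUnivariateKernel k) (hU : MeasurableSet U) (t : ℕ) (s : ℝ)
    (g : Fin (S t).G) : ∫ ω, (S t).score k s m x U g ω ∂(P t) = 0 := by
  obtain ⟨b, hb1, hkb⟩ := hk.exists_productKernel_bound (dI := dI) (dC := dC)
  unfold ClusterSample.score
  rw [integral_finsetSum _ fun j _ =>
    ((hd.memLp_kern_mul_err hk hU t s g j).integrable (by norm_num)).const_mul _]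
  refine Finset.sum_eq_zero fun j _ => ?_
  have := hd.integral_mul_err t g j
    (w := fun ω => (S t).kern k s x g j ω * oneOn U ((S t).X g j ω))
    (((S t).measurable_sigmaX_kern hk s x g j).mul (measurable_sigmaX_oneOn hU t g j))
    (c := b * 1) (fun ω => by
      rw [abs_mul, abs_of_nonneg ((S t).kern_nonneg hk _ _ _ _ _)]
      exact mul_le_mul (hkb _) abs_oneOn_le_one (abs_nonneg _) (by linarith))
  simp_rw [mul_assoc] at this
  rw [integral_const_mul, this.2, mul_zero]

/-- The second moment of the score of a cluster. -/
theorem integral_score_sq (hk : IsUnivariateKernel k) (hU : MeasurableSet U) (t : ℕ) {s : ℝ}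
    (hs : 0 < s) (g : Fin (S t).G) :
    ∫ ω, (S t).score k s m x U g ω ^ 2 ∂(P t) = (((S t).n : ℝ) * s ^ (dI + dC))⁻¹ *
      ((S t).size g * (s ^ (dI + dC) * ∫ v, productKernel k v ^ 2 *
          (oneOn U (x + s • v) * s2 (x + s • v) * f (x + s • v)))
        + (((S t).size g : ℝ) ^ 2 - (S t).size g) * (s ^ (2 * dI + dC) *
          ∫ z, pairKernel k z * (oneOn (jointNhd U 2) (diagPoint 2 x + s • z)
            * sc (diagPoint 2 x + s • z) * fJ 2 (diagPoint 2 x + s • z)))) := by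
  obtain ⟨b, hb1, hkb⟩ := hk.exists_productKernel_bound (dI := dI) (dC := dC)
  have hU2 : MeasurableSet (jointNhd U 2) := by
    have : jointNhd U 2 = ⋂ i, (fun z : JointRegressor 2 dI dC => (z.1 i, z.2)) ⁻¹' U := by
      ext z; simp [jointNhd]
    rw [this]
    exact MeasurableSet.iInter fun i => hU.preimage (by fun_prop)
  set A1 := s ^ (dI + dC) * ∫ v, productKernel k v ^ 2 *
          (oneOn U (x + s • v) * s2 (x + s • v) * f (x + s • v)) with hA1
  set A2 := s ^ (2 * dI + dC) *
          ∫ z, pairKernel k z * (oneOn (jointNhd U 2) (diagPoint 2 x + s • z)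
            * sc (diagPoint 2 x + s • z) * fJ 2 (diagPoint 2 x + s • z)) with hA2
  set V : Fin ((S t).size g) → Ω t → ℝ := fun j ω =>
    (S t).kern k s x g j ω * (oneOn U ((S t).X g j ω) * (S t).err m g j ω) with hV
  have hL : ∀ j, MemLp (V j) 2 (P t) := hd.memLp_kern_mul_err hk hU t s g
  have hVV : ∀ j l, Integrable (fun ω => V j ω * V l ω) (P t) := fun j l =>
    (hL j).integrable_mul (hL l)
  have hwb : ∀ (j l : Fin ((S t).size g)) ω,
      |(S t).kern k s x g j ω * (S t).kern k s x g l ω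
        * (oneOn U ((S t).X g j ω) * oneOn U ((S t).X g l ω))| ≤ b * b * (1 * 1) := by
    intro j l ω
    rw [abs_mul, abs_mul, abs_of_nonneg ((S t).kern_nonneg hk _ _ _ _ _),
      abs_of_nonneg ((S t).kern_nonneg hk _ _ _ _ _), abs_mul]
    have := (S t).kern_nonneg hk s x g l ω
    exact mul_le_mul (mul_le_mul (hkb _) (hkb _) this (by linarith))
      (mul_le_mul abs_oneOn_le_one abs_oneOn_le_one (abs_nonneg _) zero_le_one)
      (by positivity) (by positivity)
  have hw : ∀ j l : Fin ((S t).size g), Measurable[(S t).sigmaX g] fun ω =>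
      (S t).kern k s x g j ω * (S t).kern k s x g l ω
        * (oneOn U ((S t).X g j ω) * oneOn U ((S t).X g l ω)) := fun j l =>
    (((S t).measurable_sigmaX_kern hk s x g j).mul
      ((S t).measurable_sigmaX_kern hk s x g l)).mul
      ((measurable_sigmaX_oneOn hU t g j).mul (measurable_sigmaX_oneOn hU t g l))
  -- Equalities are needed for the limiting variance: the conditional variance enters on the
  -- diagonal, the conditional covariance off it. Every pair has the same value since f and f₂ do
  -- not depend on the members.
  have hjl : ∀ j l, ∫ ω, V j ω * V l ω ∂(P t) = if j = l then A1 else A2 := by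
    intro j l
    split_ifs with h
    · subst h
      have h1 := (hd.integral_mul_err_sq t g j (hw j j) (hwb j j)).2.2
      have h2 := (hd.integral_weight_X t g j (hk.measurable_productKernel.pow_const 2)
        ((measurable_oneOn hU).mul hd.measurable_s2) x hs).2
      calc ∫ ω, V j ω * V j ω ∂(P t) = _ := by
            refine Eq.trans ?_ h1
            congr 1; ext ω; simp only [hV]; ring
        _ = _ := by
            refine Eq.trans ?_ h2
            congr 1; ext ω
            simp only [Pi.mul_apply, ← sq, oneOn_sq, ClusterSample.kern]
            ring
        _ = A1 := rfl
    · have h1 := hd.integral_mul_err_mul_err t g h (hw j l) (hwb j l)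
      have h2 := (hd.integral_weight_pair t g h hk.measurable_pairKernel
        ((measurable_oneOn hU2).mul hd.measurable_sc) x hs).2
      calc ∫ ω, V j ω * V l ω ∂(P t) = _ := by
            refine Eq.trans ?_ h1
            congr 1; ext ω; simp only [hV]; ring
        _ = _ := by
            refine Eq.trans ?_ h2
            congr 1; ext ω
            rw [ClusterSample.kern_mul_kern]
            have : oneOn (jointNhd U 2) ((S t).jointX g ![j, l] ω)
                = oneOn U ((S t).X g j ω) * oneOn U ((S t).X g l ω) := by
              have hiff : (S t).jointX g ![j, l] ω ∈ jointNhd U 2 ↔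
                  (S t).X g j ω ∈ U ∧ (S t).X g l ω ∈ U := by
                simp [jointNhd, ClusterSample.jointX, ClusterSample.X, Fin.forall_fin_two]
              by_cases hj : (S t).X g j ω ∈ U <;> by_cases hl : (S t).X g l ω ∈ U
              · rw [oneOn_of_mem (hiff.2 ⟨hj, hl⟩), oneOn_of_mem hj, oneOn_of_mem hl, one_mul]
              · rw [oneOn_of_notMem (fun h => hl (hiff.1 h).2), oneOn_of_notMem hl, mul_zero]
              · rw [oneOn_of_notMem (fun h => hj (hiff.1 h).1), oneOn_of_notMem hj, zero_mul]
              · rw [oneOn_of_notMem (fun h => hj (hiff.1 h).1), oneOn_of_notMem hj, zero_mul]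
            simp only [Pi.mul_apply, this, mul_assoc]
        _ = A2 := rfl
  have hsum : ∫ ω, (∑ j, V j ω) ^ 2 ∂(P t)
      = (S t).size g * A1 + (((S t).size g : ℝ) ^ 2 - (S t).size g) * A2 := by
    simp_rw [sq (∑ j, V j _), Finset.sum_mul_sum]
    rw [integral_finsetSum _ fun j _ => integrable_finsetSum _ fun l _ => hVV j l]
    calc _ = ∑ j : Fin ((S t).size g), ∑ l, (if j = l then A1 else A2) := by
          refine Finset.sum_congr rfl fun j _ => ?_
          rw [integral_finsetSum _ fun l _ => hVV j l]
          exact Finset.sum_congr rfl fun l _ => hjl j l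
      _ = ∑ j : Fin ((S t).size g), ∑ l, ((if j = l then A1 - A2 else 0) + A2) := by
          refine Finset.sum_congr rfl fun j _ => Finset.sum_congr rfl fun l _ => ?_
          split_ifs <;> ring
      _ = _ := by
          simp [Finset.sum_add_distrib, Finset.sum_const]
          ring
  rw [← hsum, ← inv_sqrt_effective_sq (Nat.cast_nonneg _) hs, ← integral_const_mul]
  congr 1; ext ω
  rw [ClusterSample.score, ← Finset.mul_sum, mul_pow]

/-- The variance of the sum of the scores converges. -/
theorem tendsto_sum_integral_score_sq (hdI : 1 ≤ dI) (hk : IsUnivariateKernel k)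
    (hc : DensityControl k h f (fJ 2) x) (hb : BandwidthCondition S h lam)
    (hs2 : ContinuousAt s2 x) (hsc : ContinuousAt sc (diagPoint 2 x)) (hU : IsOpen U)
    (hxU : x ∈ U) {C : ℝ} (hC0 : 0 ≤ C) (hC : ∀ u ∈ U, |s2 u| ≤ C)
    (hC2 : ∀ z ∈ jointNhd U 2, |sc z| ≤ C) :
    Tendsto (fun t => ∑ g, ∫ ω, (S t).score k (h t) m x U g ω ^ 2 ∂(P t)) atTop
      (𝓝 (kernelRoughness k ^ (dI + dC) * (s2 x * f x)
        + lam * (kernelRoughness k ^ dC * (sc (diagPoint 2 x) * fJ 2 (diagPoint 2 x))))) := by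
  have hwk : ∀ v : Regressor dI dC, productKernel k v ^ 2 ≠ 0 → productKernel k v ≠ 0 :=
    fun v hv h0 => hv (by rw [h0]; ring)
  -- Truncation to U makes σ² and σ(·,·;·) bounded, so dominated convergence needs no growth
  -- condition on them here.
  have hbound : ∀ {α : Type} {W : Set α} {ψ : α → ℝ}, (∀ u ∈ W, |ψ u| ≤ C) → ∀ u (y : ℝ), 0 ≤ y →
      |oneOn W u * ψ u| ≤ C * (1 + y) ^ 4 := by
    intro α W ψ hψ u y hy
    have : C ≤ C * (1 + y) ^ 4 := le_mul_of_one_le_right hC0 (one_le_pow₀ (by linarith))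
    refine le_trans ?_ this
    by_cases hu : u ∈ W
    · rw [oneOn_of_mem hu, one_mul]; exact hψ u hu
    · rw [oneOn_of_notMem hu, zero_mul, abs_zero]; exact hC0
  have hU2 : IsOpen (jointNhd U 2) := isOpen_jointNhd hU 2
  have hQ1 := hc.tendsto_integral_mul (hk.measurable_productKernel.pow_const 2)
    (fun v => sq_nonneg _) hwk hk.integrable_weight_productKernel_sq
    (ρ := fun _ u => oneOn U u * s2 u) (C := C) (c := s2 x)
    (fun _ => (measurable_oneOn hU.measurableSet).mul hd.measurable_s2)
    (Eventually.of_forall fun t v _ => hbound hC _ _ (norm_nonneg _)) (fun v => by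
      have hx := tendsto_add_smul hb.tendsto_zero x v
      refine (hs2.tendsto.comp hx).congr' ?_
      filter_upwards [hx.eventually (hU.mem_nhds hxU)] with t ht
      rw [oneOn_of_mem ht, one_mul, Function.comp_apply])
  have hQ2 := hc.tendsto_integral_pair_mul hk
    (Ψ := fun _ z => oneOn (jointNhd U 2) z * sc z) (C := C) (c := sc (diagPoint 2 x))
    (fun _ => (measurable_oneOn hU2.measurableSet).mul hd.measurable_sc)
    (Eventually.of_forall fun t z _ => hbound hC2 _ _ (norm_nonneg _)) (fun z => by
      have hx := tendsto_add_smul hb.tendsto_zero (diagPoint 2 x) z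
      refine (hsc.tendsto.comp hx).congr' ?_
      filter_upwards [hx.eventually (hU2.mem_nhds fun _ => hxU)] with t ht
      rw [oneOn_of_mem (show diagPoint 2 x + h t • z ∈ jointNhd U 2 from ht), one_mul, Function.comp_apply])
  rw [IsUnivariateKernel.integral_productKernel_sq] at hQ1
  -- There are n_g² - n_g ordered pairs; as ∑ n_g / n = 1, the subtracted term contributes h^dI,
  -- which vanishes because dI ≥ 1.
  have hhd : Tendsto (fun t => h t ^ dI) atTop (𝓝 0) := by
    simpa [show dI ≠ 0 by omega] using hb.tendsto_zero.pow dI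
  have hlim := hQ1.2.add ((hb.tendsto_lam.sub hhd).mul hQ2.2)
  rw [sub_zero] at hlim
  refine hlim.congr' ?_
  filter_upwards [hb.eventually_n_pos] with t hn
  have hp := hb.pos t
  simp_rw [hd.integral_score_sq hk hU.measurableSet t hp]
  set I1 := ∫ v, productKernel k v ^ 2 *
    (oneOn U (x + h t • v) * s2 (x + h t • v) * f (x + h t • v))
  set I2 := ∫ z, pairKernel k z * (oneOn (jointNhd U 2) (diagPoint 2 x + h t • z)
    * sc (diagPoint 2 x + h t • z) * fJ 2 (diagPoint 2 x + h t • z))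
  have hnsum : ((S t).n : ℝ) = ∑ g, ((S t).size g : ℝ) := by
    rw [ClusterSample.n]; push_cast; rfl
  rw [← Finset.mul_sum, Finset.sum_add_distrib, ← Finset.sum_mul, ← Finset.sum_mul,
    Finset.sum_sub_distrib, ← hnsum]
  have e : h t ^ (2 * dI + dC) = h t ^ (dI + dC) * h t ^ dI := by rw [← pow_add]; congr 1; ring
  rw [e]
  field_simp

end IsClusterDGP

end Errors

/-! ## Lyapunov's condition for the scores -/

section Lyapunov

variable {dI dC : ℕ} {Ω : ℕ → Type*} [∀ t, MeasurableSpace (Ω t)]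
  {P : ∀ t, Measure (Ω t)} [∀ t, IsProbabilityMeasure (P t)] {S : ∀ t, ClusterSample dI dC (Ω t)}
  {f : Regressor dI dC → ℝ} {fJ : (k : ℕ) → JointRegressor k dI dC → ℝ}
  {m s2 : Regressor dI dC → ℝ} {sc : JointRegressor 2 dI dC → ℝ}
  {k : ℝ → ℝ} {h : ℕ → ℝ} {lam : ℝ} {x : Regressor dI dC} {U : Set (Regressor dI dC)}

namespace IsClusterDGP

variable (hd : IsClusterDGP P S f fJ m s2 sc)
include hd

/-- Conditioning on X_gj replaces |e|^(2r) by v² on U. Then K^(2r) ≤ b^(2r-2) K² leaves the integral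
of K², which supplies a factor h^d. The estimate is made in [0, ∞], so it yields integrability as
well. -/
theorem integral_abs_rpow_kern_mul_err_le (hk : IsUnivariateKernel k) (hU : MeasurableSet U)
    {b : ℝ} (hb1 : 1 ≤ b) (hkb : ∀ u : Regressor dI dC, productKernel k u ≤ b) {r v : ℝ}
    (hr : 1 ≤ r) (t : ℕ) {s : ℝ} (hs : 0 < s) (g : Fin (S t).G) (j : Fin ((S t).size g))
    (hv : ∀ᵐ ω ∂(P t), (S t).X g j ω ∈ U →
      condLExp (MeasurableSpace.comap ((S t).X g j) inferInstance) (P t)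
        (fun ω => ENNReal.ofReal (|(S t).err m g j ω| ^ (2 * r))) ω ≤ ENNReal.ofReal (v ^ 2))
    (hQ : Integrable fun v => productKernel k v ^ 2 * (1 * f (x + s • v))) :
    Integrable (fun ω => |(S t).kern k s x g j ω *
      (oneOn U ((S t).X g j ω) * (S t).err m g j ω)| ^ (2 * r)) (P t) ∧
    ∫ ω, |(S t).kern k s x g j ω * (oneOn U ((S t).X g j ω) * (S t).err m g j ω)| ^ (2 * r) ∂(P t)
      ≤ v ^ 2 * (b ^ (2 * r - 2) *
        (s ^ (dI + dC) * ∫ v, productKernel k v ^ 2 * (1 * f (x + s • v)))) := by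
  have hX := (S t).measurable_X g j
  have hXi := hd.integral_weight_X t g j (hk.measurable_productKernel.pow_const 2)
    (ρ := fun _ => 1) measurable_const x hs
  simp_rw [mul_one] at hXi
  set B := b ^ (2 * r - 2) *
    (s ^ (dI + dC) * ∫ v, productKernel k v ^ 2 * (1 * f (x + s • v))) with hB
  have hB0 : 0 ≤ B := by
    have : 0 ≤ ∫ v, productKernel k v ^ 2 * (1 * f (x + s • v)) :=
      integral_nonneg fun v => mul_nonneg (sq_nonneg _) (by simpa using hd.f_nonneg _)
    positivity
  set Y : Ω t → ENNReal := fun ω => ENNReal.ofReal (|(S t).err m g j ω| ^ (2 * r)) with hY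
  have hYm : Measurable Y := ((hd.measurable_err t g j).abs.pow_const _).ennreal_ofReal
  set w : Ω t → ENNReal := fun ω => ENNReal.ofReal
    (productKernel k (s⁻¹ • ((S t).X g j ω - x)) ^ (2 * r) * oneOn U ((S t).X g j ω)) with hw
  have hwm : Measurable[MeasurableSpace.comap ((S t).X g j) inferInstance] w := by
    have : Measurable fun u : Regressor dI dC => ENNReal.ofReal
        (productKernel k (s⁻¹ • (u - x)) ^ (2 * r) * oneOn U u) :=
      (((hk.measurable_productKernel.comp (by fun_prop)).pow_const _).mul
        (measurable_oneOn hU)).ennreal_ofReal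
    exact this.comp (comap_measurable _)
  have hlint : ∫⁻ ω, ENNReal.ofReal (|(S t).kern k s x g j ω *
      (oneOn U ((S t).X g j ω) * (S t).err m g j ω)| ^ (2 * r)) ∂(P t)
      ≤ ENNReal.ofReal (v ^ 2 * B) := by
    calc _ = ∫⁻ ω, w ω * Y ω ∂(P t) := by
          refine lintegral_congr fun ω => ?_
          have h0 := (S t).kern_nonneg hk s x g j ω
          show _ = ENNReal.ofReal ((S t).kern k s x g j ω ^ (2 * r) * oneOn U ((S t).X g j ω)) *
            ENNReal.ofReal (|(S t).err m g j ω| ^ (2 * r))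
          rw [← ENNReal.ofReal_mul (mul_nonneg (Real.rpow_nonneg h0 _) oneOn_nonneg)]
          congr 1
          rw [abs_mul, abs_mul, Real.mul_rpow (abs_nonneg _) (by positivity),
            Real.mul_rpow (abs_nonneg _) (abs_nonneg _), abs_of_nonneg h0,
            abs_of_nonneg oneOn_nonneg, ← mul_assoc]
          congr 2
          by_cases hu : (S t).X g j ω ∈ U
          · rw [oneOn_of_mem hu, Real.one_rpow]
          · rw [oneOn_of_notMem hu, Real.zero_rpow (by linarith)]
      _ = ∫⁻ ω, w ω * condLExp (MeasurableSpace.comap ((S t).X g j) inferInstance) (P t) Y ω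
            ∂(P t) := (lintegral_mul_condLExp hX.comap_le hYm hwm).symm
      _ ≤ ∫⁻ ω, ENNReal.ofReal (v ^ 2) * ENNReal.ofReal (b ^ (2 * r - 2) *
            (productKernel k (s⁻¹ • ((S t).X g j ω - x)) ^ 2)) ∂(P t) := by
          refine lintegral_mono_ae ?_
          filter_upwards [hv] with ω hω
          by_cases hu : (S t).X g j ω ∈ U
          · rw [mul_comm (w ω)]
            refine mul_le_mul' (hω hu) (ENNReal.ofReal_le_ofReal ?_)
            have h0 := hk.productKernel_nonneg (s⁻¹ • ((S t).X g j ω - x))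
            have e : productKernel k (s⁻¹ • ((S t).X g j ω - x)) ^ (2 * r)
                = productKernel k (s⁻¹ • ((S t).X g j ω - x)) ^ (2 * r - 2)
                  * productKernel k (s⁻¹ • ((S t).X g j ω - x)) ^ 2 := by
              rw [← Real.rpow_natCast _ 2, ← Real.rpow_add_of_nonneg h0 (by linarith) (by norm_num)]
              norm_num
            rw [oneOn_of_mem hu, mul_one, e]
            gcongr
            · linarith
            · exact hkb _
          · simp [hw, oneOn_of_notMem hu]
      _ = _ := by
          have hi := (hXi.1.2 (by simpa using hQ)).const_mul (b ^ (2 * r - 2))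
          rw [lintegral_const_mul _ (by
            have := hk.measurable_productKernel.comp ((hX.sub_const x).const_smul s⁻¹)
            exact ((this.pow_const 2).const_mul _).ennreal_ofReal),
            ← ofReal_integral_eq_lintegral_ofReal hi (ae_of_all _ fun ω => by positivity),
            integral_const_mul, hXi.2, ← ENNReal.ofReal_mul (sq_nonneg v)]
  have hm : Measurable fun ω => |(S t).kern k s x g j ω *
      (oneOn U ((S t).X g j ω) * (S t).err m g j ω)| ^ (2 * r) :=
    (((S t).measurable_kern hk s x g j).mul (((measurable_oneOn hU).comp hX).mul
      (hd.measurable_err t g j))).abs.pow_const _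
  have h0 : ∀ ω, 0 ≤ |(S t).kern k s x g j ω *
      (oneOn U ((S t).X g j ω) * (S t).err m g j ω)| ^ (2 * r) := fun ω => by positivity
  refine ⟨⟨hm.aestronglyMeasurable, ?_⟩, ?_⟩
  · rw [hasFiniteIntegral_iff_ofReal (ae_of_all _ h0)]
    exact hlint.trans_lt ENNReal.ofReal_lt_top
  · rw [integral_eq_lintegral_of_nonneg_ae (ae_of_all _ h0) hm.aestronglyMeasurable]
    exact ENNReal.toReal_le_of_le_ofReal (by positivity) hlint

/-- The power-mean inequality |∑ T_j|^(2r) ≤ n_g^(2r-1) ∑ |T_j|^(2r) allows arbitrary dependence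
within the cluster, at the price of n_g^(2r). -/
theorem integral_abs_rpow_score_le (hk : IsUnivariateKernel k) (hU : MeasurableSet U)
    {b : ℝ} (hb1 : 1 ≤ b) (hkb : ∀ u : Regressor dI dC, productKernel k u ≤ b) {r v : ℝ}
    (hr : 1 ≤ r) (t : ℕ) {s : ℝ} (hs : 0 < s) (g : Fin (S t).G)
    (hv : ∀ j, ∀ᵐ ω ∂(P t), (S t).X g j ω ∈ U →
      condLExp (MeasurableSpace.comap ((S t).X g j) inferInstance) (P t)
        (fun ω => ENNReal.ofReal (|(S t).err m g j ω| ^ (2 * r))) ω ≤ ENNReal.ofReal (v ^ 2))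
    (hQ : Integrable fun v => productKernel k v ^ 2 * (1 * f (x + s • v))) :
    Integrable (fun ω => |(S t).score k s m x U g ω| ^ (2 * r)) (P t) ∧
    ∫ ω, |(S t).score k s m x U g ω| ^ (2 * r) ∂(P t)
      ≤ (((S t).n : ℝ) * s ^ (dI + dC)) ^ (-r) * ((S t).size g : ℝ) ^ (2 * r) *
        (v ^ 2 * (b ^ (2 * r - 2) *
          (s ^ (dI + dC) * ∫ v, productKernel k v ^ 2 * (1 * f (x + s • v))))) := by
  set B := v ^ 2 * (b ^ (2 * r - 2) *
          (s ^ (dI + dC) * ∫ v, productKernel k v ^ 2 * (1 * f (x + s • v))))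
  set T : Fin ((S t).size g) → Ω t → ℝ := fun j ω =>
    (S t).kern k s x g j ω * (oneOn U ((S t).X g j ω) * (S t).err m g j ω) with hT
  have hj := fun j => hd.integral_abs_rpow_kern_mul_err_le hk hU hb1 hkb hr t hs g j (hv j) hQ
  set E := ((S t).n : ℝ) * s ^ (dI + dC) with hE
  have hE0 : 0 ≤ E := by positivity
  have ha : ((√E)⁻¹) ^ (2 * r) = E ^ (-r) := by
    rw [Real.rpow_mul (by positivity), Real.rpow_two, inv_pow, Real.sq_sqrt hE0,
      Real.inv_rpow hE0, Real.rpow_neg hE0]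
  have hpt : ∀ ω, |(S t).score k s m x U g ω| ^ (2 * r) ≤
      E ^ (-r) * (((S t).size g : ℝ) ^ (2 * r - 1) * ∑ j, |T j ω| ^ (2 * r)) := by
    intro ω
    rw [ClusterSample.score, ← Finset.mul_sum, abs_mul, abs_of_nonneg (by positivity),
      Real.mul_rpow (by positivity) (abs_nonneg _), ha]
    gcongr
    have := Real.rpow_sum_le_const_mul_sum_rpow Finset.univ (fun j => T j ω)
      (by linarith : 1 ≤ 2 * r)
    rw [Finset.card_univ, Fintype.card_fin] at this
    refine le_trans ?_ this
    gcongr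
    exact Finset.abs_sum_le_sum_abs _ _
  have hint : Integrable (fun ω =>
      E ^ (-r) * (((S t).size g : ℝ) ^ (2 * r - 1) * ∑ j, |T j ω| ^ (2 * r))) (P t) :=
    ((integrable_finsetSum _ fun j _ => (hj j).1).const_mul _).const_mul _
  have hi : Integrable (fun ω => |(S t).score k s m x U g ω| ^ (2 * r)) (P t) :=
    hint.mono' ((hd.measurable_score hk hU t s g).abs.pow_const _).aestronglyMeasurable
      (ae_of_all _ fun ω => by
        rw [Real.norm_of_nonneg (by positivity)]; exact hpt ω)
  refine ⟨hi, (integral_mono hi hint hpt).trans ?_⟩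
  rw [integral_const_mul, integral_const_mul, integral_finsetSum _ fun j _ => (hj j).1]
  have hsize : (0 : ℝ) < (S t).size g := by exact_mod_cast (S t).size_pos g
  calc _ ≤ E ^ (-r) * (((S t).size g : ℝ) ^ (2 * r - 1) * ∑ _j : Fin ((S t).size g), B) := by
        gcongr with j _
        exact (hj j).2
    _ = E ^ (-r) * ((S t).size g : ℝ) ^ (2 * r) * B := by
        have e : ((S t).size g : ℝ) ^ (2 * r) = ((S t).size g : ℝ) ^ (2 * r - 1) * (S t).size g := by
          rw [← Real.rpow_add_one hsize.ne', sub_add_cancel]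
        rw [e, Finset.sum_const, Finset.card_univ, Fintype.card_fin, nsmul_eq_mul]
        ring

end IsClusterDGP

/-- Cluster sizes are negligible: `∑_g n_g^(2r) / n^(r/2) → 0`. -/
theorem tendsto_sum_size_rpow_div (hb : BandwidthCondition S h lam) {r : ℝ} (hr : 0 < r)
    (hsize : ∃ C : ℝ, ∀ᶠ t in atTop,
      (∑ g, ((S t).size g : ℝ) ^ r) ^ (1 / r) / ((S t).n : ℝ) ^ (1 / 4 : ℝ) ≤ C) :
    Tendsto (fun t => (∑ g, ((S t).size g : ℝ) ^ (2 * r)) / ((S t).n : ℝ) ^ (r / 2))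
      atTop (𝓝 0) := by
  obtain ⟨C, hC⟩ := hsize
  -- With M = max n_g, one has ∑ n_g^(2r) ≤ M^r ∑ n_g^r ≤ M^r |C|^r n^(r/4), and M^r = (M⁴/n)^(r/4)
  -- n^(r/4).
  have h1 : Tendsto (fun t => |C| ^ r * (((S t).maxSize : ℝ) ^ 4 / ((S t).n : ℝ)) ^ (r / 4)) atTop
      (𝓝 0) := by
    have := hb.maxSize_pow_four.rpow_const (p := r / 4) (Or.inr (by positivity))
    rw [Real.zero_rpow (by positivity)] at this
    simpa using this.const_mul (|C| ^ r)
  refine tendsto_of_tendsto_of_tendsto_of_le_of_le' tendsto_const_nhds h1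
    (Eventually.of_forall fun t => by positivity) ?_
  filter_upwards [hC, hb.eventually_n_pos] with t ht hn
  set n := ((S t).n : ℝ)
  set M := ((S t).maxSize : ℝ)
  have hM0 : 0 ≤ M := Nat.cast_nonneg _
  have hs : ∑ g, ((S t).size g : ℝ) ^ r ≤ |C| ^ r * n ^ (r / 4) := by
    rw [div_le_iff₀ (by positivity)] at ht
    have h2 : (∑ g, ((S t).size g : ℝ) ^ r) ^ (1 / r) ≤ |C| * n ^ (1 / 4 : ℝ) :=
      ht.trans (by gcongr; exact le_abs_self C)
    have h3 := Real.rpow_le_rpow (by positivity) h2 hr.le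
    rw [← Real.rpow_mul (by positivity), one_div_mul_cancel hr.ne', Real.rpow_one,
      Real.mul_rpow (by positivity) (by positivity), ← Real.rpow_mul hn.le] at h3
    rwa [one_div_mul_eq_div] at h3
  have hg : ∀ g, ((S t).size g : ℝ) ^ (2 * r) ≤ M ^ r * ((S t).size g : ℝ) ^ r := fun g => by
    have hle : ((S t).size g : ℝ) ≤ M :=
      Nat.cast_le.2 (Finset.le_sup (f := (S t).size) (Finset.mem_univ g))
    rw [two_mul, Real.rpow_add_of_nonneg (Nat.cast_nonneg _) hr.le hr.le]
    gcongr
  rw [div_le_iff₀ (by positivity), Real.div_rpow (by positivity) hn.le,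
    ← Real.rpow_natCast M 4, ← Real.rpow_mul hM0]
  have e : ((4 : ℕ) : ℝ) * (r / 4) = r := by push_cast; ring
  have e2 : n ^ (r / 2) = n ^ (r / 4) * n ^ (r / 4) := by
    rw [← Real.rpow_add hn]; congr 1; ring
  rw [e, e2]
  calc ∑ g, ((S t).size g : ℝ) ^ (2 * r) ≤ M ^ r * ∑ g, ((S t).size g : ℝ) ^ r := by
        rw [Finset.mul_sum]; exact Finset.sum_le_sum fun g _ => hg g
    _ ≤ M ^ r * (|C| ^ r * n ^ (r / 4)) := by gcongr
    _ = _ := by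
        have : 0 < n ^ (r / 4) := by positivity
        field_simp

/-- Lyapunov's condition of order `2r` for the scores. -/
theorem IsClusterDGP.tendsto_sum_integral_abs_rpow_score (hd : IsClusterDGP P S f fJ m s2 sc)
    (hk : IsUnivariateKernel k) (hc : DensityControl k h f (fJ 2) x)
    (hb : BandwidthCondition S h lam) {N : Set (Regressor dI dC)} {r : ℝ} (hr : 2 ≤ r)
    (hmom : MomentCondition P S h m N r) (hU : MeasurableSet U) (hUN : U ⊆ N) :
    (∀ᶠ t in atTop, ∀ g, Integrable (fun ω => |(S t).score k (h t) m x U g ω| ^ (2 * r)) (P t)) ∧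
    Tendsto (fun t => ∑ g, ∫ ω, |(S t).score k (h t) m x U g ω| ^ (2 * r) ∂(P t)) atTop (𝓝 0) := by
  obtain ⟨b, hb1, hkb⟩ := hk.exists_productKernel_bound (dI := dI) (dC := dC)
  obtain ⟨v, hv⟩ := hmom.cond_moment
  have hwk : ∀ v : Regressor dI dC, productKernel k v ^ 2 ≠ 0 → productKernel k v ≠ 0 :=
    fun v hv h0 => hv (by rw [h0]; ring)
  have hQ := hc.tendsto_integral_mul (hk.measurable_productKernel.pow_const 2)
    (fun v => sq_nonneg _) hwk hk.integrable_weight_productKernel_sq (ρ := fun _ _ => 1) (C := 1)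
    (c := 1) (fun _ => measurable_const) (Eventually.of_forall fun t v _ => by
      rw [abs_one, one_mul]; exact one_le_pow₀ (by linarith [norm_nonneg v]))
    (fun v => tendsto_const_nhds)
  have hv' : ∀ t g j, ∀ᵐ ω ∂(P t), (S t).X g j ω ∈ U →
      condLExp (MeasurableSpace.comap ((S t).X g j) inferInstance) (P t)
        (fun ω => ENNReal.ofReal (|(S t).err m g j ω| ^ (2 * r))) ω
          ≤ ENNReal.ofReal (v ^ 2) := fun t g j => (hv t g j).mono fun ω hω hu => hω (hUN hu)
  have hbd : ∀ t g, (Integrable fun v => productKernel k v ^ 2 * (1 * f (x + h t • v))) →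
      Integrable (fun ω => |(S t).score k (h t) m x U g ω| ^ (2 * r)) (P t) ∧
      ∫ ω, |(S t).score k (h t) m x U g ω| ^ (2 * r) ∂(P t)
        ≤ (((S t).n : ℝ) * h t ^ (dI + dC)) ^ (-r) * ((S t).size g : ℝ) ^ (2 * r) *
          (v ^ 2 * (b ^ (2 * r - 2) *
            (h t ^ (dI + dC) * ∫ v, productKernel k v ^ 2 * (1 * f (x + h t • v))))) :=
    fun t g hQt => hd.integral_abs_rpow_score_le hk hU hb1 hkb (by linarith) t (hb.pos t) g
      (hv' t g) hQt
  refine ⟨hQ.1.mono fun t ht g => (hbd t g ht).1, ?_⟩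
  obtain ⟨M, hM⟩ := hmom.bandwidth.bound
  have hsz := tendsto_sum_size_rpow_div hb (by linarith) hmom.sizes
  have hlim : Tendsto (fun t => |M| * ((∑ g, ((S t).size g : ℝ) ^ (2 * r)) /
      ((S t).n : ℝ) ^ (r / 2)) * (v ^ 2 * (b ^ (2 * r - 2) *
        ∫ v, productKernel k v ^ 2 * (1 * f (x + h t • v))))) atTop (𝓝 0) := by
    have := (hsz.const_mul |M|).mul ((hQ.2.const_mul (b ^ (2 * r - 2))).const_mul (v ^ 2))
    simpa using this
  refine tendsto_of_tendsto_of_tendsto_of_le_of_le' tendsto_const_nhds hlim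
    (Eventually.of_forall fun t => Finset.sum_nonneg fun g _ => integral_nonneg fun ω => by
      positivity) ?_
  filter_upwards [hM, hQ.1, hb.eventually_n_pos] with t hMt hQt hn
  have hp := hb.pos t
  refine (Finset.sum_le_sum fun g _ => (hbd t g hQt).2).trans ?_
  set n := ((S t).n : ℝ)
  set I := ∫ v, productKernel k v ^ 2 * (1 * f (x + h t • v))
  have hI0 : 0 ≤ I := integral_nonneg fun v => mul_nonneg (sq_nonneg _) (by simpa using hd.f_nonneg _)
  rw [← Finset.sum_mul, ← Finset.mul_sum]
  have hMt' : 1 / (n ^ (r / 2) * h t ^ (((dI + dC : ℕ) : ℝ) * r - ((dI + dC : ℕ) : ℝ))) ≤ |M| := by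
    rw [norm_one, mul_one] at hMt
    exact ((le_abs_self _).trans hMt).trans (le_abs_self M)
  -- The scale splits into the quantity bounded by the bandwidth condition and n^(-r/2), which the
  -- cluster-size bound compensates.
  have e : (n * h t ^ (dI + dC)) ^ (-r) * h t ^ (dI + dC)
      = 1 / (n ^ (r / 2) * h t ^ (((dI + dC : ℕ) : ℝ) * r - ((dI + dC : ℕ) : ℝ)))
        * (n ^ (r / 2))⁻¹ := by
    have e1 : n ^ r = n ^ (r / 2) * n ^ (r / 2) := by rw [← Real.rpow_add hn]; congr 1; ring
    have e2 : h t ^ (((dI + dC : ℕ) : ℝ) * r - ((dI + dC : ℕ) : ℝ))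
        = (h t ^ (dI + dC)) ^ r / h t ^ (dI + dC) := by
      rw [Real.rpow_sub hp, Real.rpow_mul hp.le, Real.rpow_natCast]
    rw [Real.rpow_neg (by positivity), Real.mul_rpow hn.le (by positivity), e1, e2]
    have : 0 < (h t ^ (dI + dC)) ^ r := by positivity
    field_simp
  calc _ = ((n * h t ^ (dI + dC)) ^ (-r) * h t ^ (dI + dC)) *
        (∑ g, ((S t).size g : ℝ) ^ (2 * r)) * (v ^ 2 * (b ^ (2 * r - 2) * I)) := by ring
    _ ≤ (|M| * (n ^ (r / 2))⁻¹) * (∑ g, ((S t).size g : ℝ) ^ (2 * r)) *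
        (v ^ 2 * (b ^ (2 * r - 2) * I)) := by
        rw [e]
        gcongr
    _ = _ := by ring

/-- Asymptotic normality of the sum of the scores. -/
theorem IsClusterDGP.tendstoInDistribution_score (hd : IsClusterDGP P S f fJ m s2 sc)
    (hdI : 1 ≤ dI) (hk : IsUnivariateKernel k)
    (hc : DensityControl k h f (fJ 2) x) (hb : BandwidthCondition S h lam)
    (hs2 : ContinuousAt s2 x) (hsc : ContinuousAt sc (diagPoint 2 x)) {N : Set (Regressor dI dC)}
    {r : ℝ} (hr : 2 ≤ r) (hmom : MomentCondition P S h m N r) (hU : IsOpen U)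
    (hxU : x ∈ U) (hUN : U ⊆ N) {C : ℝ} (hC0 : 0 ≤ C) (hC : ∀ u ∈ U, |s2 u| ≤ C)
    (hC2 : ∀ z ∈ jointNhd U 2, |sc z| ≤ C) :
    TendstoInDistribution (fun t ω => ∑ g, (S t).score k (h t) m x U g ω) atTop (id : ℝ → ℝ) P
      (gaussianReal 0 (kernelRoughness k ^ (dI + dC) * (s2 x * f x) + lam *
        (kernelRoughness k ^ dC * (sc (diagPoint 2 x) * fJ 2 (diagPoint 2 x)))).toNNReal) := by
  have hUm := hU.measurableSet
  have hly := hd.tendsto_sum_integral_abs_rpow_score hk hc hb hr hmom hUm hUN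
  exact tendstoInDistribution_sum_of_lyapunov (p := 2 * r)
    (fun t g => hd.measurable_score hk hUm t (h t) g)
    (fun t => hd.iIndepFun_score hk hUm t (h t)) (by linarith)
    (Eventually.of_forall fun t g => hd.memLp_score hk hUm t (h t) g)
    (Eventually.of_forall fun t g => hd.integral_score hk hUm t (h t) g) hly.1
    (hd.tendsto_sum_integral_score_sq hdI hk hc hb hs2 hsc hU hxU hC0 hC hC2) hly.2

end Lyapunov

/-! ## Asymptotic normality of the Nadaraya-Watson estimator -/

namespace ClusterSample

variable {dI dC : ℕ} {Ω : Type*} [MeasurableSpace Ω] (S : ClusterSample dI dC Ω)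
  {k : ℝ → ℝ} {h : ℝ} {m : Regressor dI dC → ℝ} {x : Regressor dI dC}

/-- The scaled estimation error as a ratio: the numerator consists of the scores, the errors at
regressors outside of `U` and the bias, the denominator is the kernel density estimator. -/
theorem sqrt_mul_nadarayaWatson_sub (U : Set (Regressor dI dC)) (c : ℝ) {ω : Ω}
    (hE : 0 < (S.n : ℝ) * h ^ (dI + dC))
    (hF : ∑ g, ∑ j, ((S.n : ℝ) * h ^ (dI + dC))⁻¹ * (S.kern k h x g j ω * 1) ≠ 0) :
    √((S.n : ℝ) * h ^ (dI + dC)) * (S.nadarayaWatson k h x ω - m x - c)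
      = (∑ g, S.score k h m x U g ω
        + (∑ g, ∑ j, (√((S.n : ℝ) * h ^ (dI + dC)))⁻¹ *
            (S.kern k h x g j ω * (oneOn Uᶜ (S.X g j ω) * S.err m g j ω))
          + ∑ g, ∑ j, (√((S.n : ℝ) * h ^ (dI + dC)))⁻¹ *
            (S.kern k h x g j ω * (m (S.X g j ω) - m x - c))))
        / ∑ g, ∑ j, ((S.n : ℝ) * h ^ (dI + dC))⁻¹ * (S.kern k h x g j ω * 1) := by
  set E := (S.n : ℝ) * h ^ (dI + dC)
  have hnum : ∑ g, S.score k h m x U g ω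
        + (∑ g, ∑ j, (√E)⁻¹ * (S.kern k h x g j ω * (oneOn Uᶜ (S.X g j ω) * S.err m g j ω))
          + ∑ g, ∑ j, (√E)⁻¹ * (S.kern k h x g j ω * (m (S.X g j ω) - m x - c)))
      = (√E)⁻¹ * (∑ g, ∑ j, S.kern k h x g j ω * S.Y g j ω
          - (m x + c) * ∑ g, ∑ j, S.kern k h x g j ω) := by
    simp_rw [score, Finset.mul_sum, ← Finset.sum_add_distrib, ← Finset.sum_sub_distrib,
      Finset.mul_sum]
    refine Finset.sum_congr rfl fun g _ => Finset.sum_congr rfl fun j _ => ?_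
    by_cases hu : S.X g j ω ∈ U
    · rw [oneOn_of_mem hu, oneOn_of_notMem (Set.notMem_compl_iff.2 hu), err]; ring
    · rw [oneOn_of_notMem hu, oneOn_of_mem (Set.mem_compl hu), err]; ring
  simp_rw [mul_one, ← Finset.mul_sum] at hF ⊢
  simp_rw [← Finset.mul_sum] at hnum
  rw [hnum, nadarayaWatson]
  change √E * ((∑ g, ∑ j, S.kern k h x g j ω * S.Y g j ω) / (∑ g, ∑ j, S.kern k h x g j ω)
    - m x - c) = _
  set s := ∑ g, ∑ j, S.kern k h x g j ω
  have hs : s ≠ 0 := right_ne_zero_of_mul hF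
  have hE' : 0 < √E := Real.sqrt_pos.2 hE
  have hEE : E⁻¹ = (√E)⁻¹ * (√E)⁻¹ := by rw [← mul_inv, Real.mul_self_sqrt hE.le]
  rw [hEE]
  field_simp
  ring

theorem measurable_nadarayaWatson (hk : IsUnivariateKernel k) (h : ℝ) (x : Regressor dI dC) :
    Measurable (S.nadarayaWatson k h x) :=
  (Finset.measurable_sum _ fun g _ => Finset.measurable_sum _ fun j _ =>
    (S.measurable_kern hk h x g j).mul (S.measurable_Y g j)).div
  (Finset.measurable_sum _ fun g _ => Finset.measurable_sum _ fun j _ =>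
    S.measurable_kern hk h x g j)

end ClusterSample

/-- Slutsky's lemma for ratios: if `A` converges in law to a centred normal variable, `O` and `B`
converge to `0` and `F` to `c > 0` in probability, then any variables which equal
`(A + (O + B)) / F` where `F` is not zero are asymptotically normal. -/
theorem tendstoInDistribution_gaussianReal_ratio {Ω : ℕ → Type*} [∀ t, MeasurableSpace (Ω t)]
    {P : ∀ t, Measure (Ω t)} [∀ t, IsProbabilityMeasure (P t)] {T A O B F : ∀ t, Ω t → ℝ}
    {V c : ℝ} (hc : 0 < c)
    (hT : ∀ᶠ t in atTop, ∀ ω, F t ω ≠ 0 → T t ω = (A t ω + (O t ω + B t ω)) / F t ω)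
    (hTm : ∀ t, Measurable (T t)) (hAm : ∀ t, Measurable (A t)) (hOm : ∀ t, Measurable (O t))
    (hBm : ∀ t, Measurable (B t)) (hFm : ∀ t, Measurable (F t))
    (hA : TendstoInDistribution A atTop (id : ℝ → ℝ) P (gaussianReal 0 V.toNNReal))
    (hO : ∀ ε > 0, Tendsto (fun t => P t {ω | ε ≤ |O t ω - 0|}) atTop (𝓝 0))
    (hB : ∀ ε > 0, Tendsto (fun t => P t {ω | ε ≤ |B t ω - 0|}) atTop (𝓝 0))
    (hF : ∀ ε > 0, Tendsto (fun t => P t {ω | ε ≤ |F t ω - c|}) atTop (𝓝 0)) :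
    TendstoInDistribution T atTop (id : ℝ → ℝ) P (gaussianReal 0 (V / c ^ 2).toNNReal) := by
  -- Truncating the denominator at c/2 makes the ratio a continuous map. The discrepancy D is 0 once
  -- F > c/2, so it tends to 0 in probability whatever T is where F vanishes.
  set D : ∀ t, Ω t → ℝ := fun t ω => T t ω - (A t ω + (O t ω + B t ω)) / max (F t ω) (c / 2)
    with hD
  have hpos : ∀ y : ℝ, 0 < max y (c / 2) := fun y => lt_max_of_lt_right (by linarith)
  have key := tendstoInDistribution_comp_prodMk (E := ℝ × ℝ × ℝ) (Z := (id : ℝ → ℝ))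
    (P' := gaussianReal 0 V.toNNReal) (X := A)
    (Y := fun t ω => (O t ω + B t ω, F t ω, D t ω)) (c := (0, c, 0))
    (g := fun p => (p.1 + p.2.1) / max p.2.2.1 (c / 2) + p.2.2.2)
    (Continuous.add (Continuous.div (by fun_prop) (by fun_prop) fun p => (hpos _).ne')
      (by fun_prop)) hA hAm
    (fun t => ((hOm t).add (hBm t)).prodMk ((hFm t).prodMk ((hTm t).sub
      (((hAm t).add ((hOm t).add (hBm t))).div ((hFm t).max measurable_const))))) (by
    intro ε hε
    have hlim := ((hO (ε / 2) (by linarith)).add (hB (ε / 2) (by linarith))).add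
      ((hF ε hε).add (hF (c / 2) (by linarith)))
    simp only [add_zero] at hlim
    refine tendsto_of_tendsto_of_tendsto_of_le_of_le' tendsto_const_nhds hlim
      (Eventually.of_forall fun t => zero_le) ?_
    filter_upwards [hT] with t ht
    refine (measure_mono (t := ({ω | ε / 2 ≤ |O t ω - 0|} ∪ {ω | ε / 2 ≤ |B t ω - 0|}) ∪
      ({ω | ε ≤ |F t ω - c|} ∪ {ω | c / 2 ≤ |F t ω - c|})) fun ω hω => ?_).trans
      ((measure_union_le _ _).trans (add_le_add (measure_union_le _ _) (measure_union_le _ _)))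
    by_contra hcon
    simp only [Set.mem_union, Set.mem_ofPred_eq, not_or, not_le, sub_zero] at hcon
    obtain ⟨⟨h1, h2⟩, h3, h4⟩ := hcon
    have hFc : c / 2 < F t ω := by linarith [(abs_lt.1 h4).1]
    have hD0 : D t ω = 0 := by
      rw [hD]
      simp only
      rw [max_eq_left hFc.le, ht ω (by linarith : 0 < F t ω).ne', sub_self]
    have : ‖((O t ω + B t ω, F t ω, D t ω) : ℝ × ℝ × ℝ) - (0, c, 0)‖ < ε := by
      rw [hD0]
      simp only [Prod.mk_sub_mk, sub_zero, Prod.norm_mk, norm_zero, Real.norm_eq_abs]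
      refine max_lt ?_ (max_lt h3 hε)
      linarith [abs_add_le (O t ω) (B t ω)]
    exact absurd hω (not_le.2 this))
  have hlaw : (gaussianReal 0 V.toNNReal).map
      (fun y : ℝ => (id y + (0 : ℝ)) / max c (c / 2) + 0)
      = (gaussianReal 0 (V / c ^ 2).toNNReal).map id := by
    have e : (fun y : ℝ => (id y + (0 : ℝ)) / max c (c / 2) + 0) = (· / c) := by
      ext y; simp [max_eq_left (by linarith : c / 2 ≤ c)]
    rw [e, gaussianReal_map_div_const, Measure.map_id, zero_div]
    congr 1
    ext
    have h2 := sq_nonneg c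
    simp only [NNReal.coe_div, Real.coe_toNNReal', NNReal.coe_mk]
    -- Taking positive parts commutes with division by c² ≥ 0, so the sign of V plays no role.
    rw [← max_div_div_right h2, zero_div]
  refine ⟨fun t => (hTm t).aemeasurable, aemeasurable_id, ?_⟩
  have hkt := key.tendsto
  have hfun : ∀ t, (fun ω => (A t ω + (O t ω + B t ω)) / max (F t ω) (c / 2) + D t ω) = T t :=
    fun t => funext fun ω => by simp only [hD]; ring
  simp only [hfun] at hkt
  rw [show (⟨_, _⟩ : ProbabilityMeasure ℝ) = ⟨_, _⟩ from Subtype.ext hlaw] at hkt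
  exact hkt

theorem mainTheorem1 {dI dC : ℕ} (hdI : 1 ≤ dI)
    {Ω : ℕ → Type*} [∀ t, MeasurableSpace (Ω t)]
    (P : ∀ t, Measure (Ω t)) [∀ t, IsProbabilityMeasure (P t)]
    (S : ∀ t, ClusterSample dI dC (Ω t))
    (k : ℝ → ℝ) (h : ℕ → ℝ) (lam : ℝ)
    (f : Regressor dI dC → ℝ) (fJ : (k : ℕ) → JointRegressor k dI dC → ℝ)
    (m s2 : Regressor dI dC → ℝ) (sc : JointRegressor 2 dI dC → ℝ)
    (x : Regressor dI dC) (N : Set (Regressor dI dC)) (r : ℝ)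
    (hk : IsUnivariateKernel k)
    (hdgp : IsClusterDGP P S f fJ m s2 sc)
    (hN : IsOpen N) (hxN : x ∈ N)
    (hfx : 0 < f x)
    (hsmooth : IsSmoothModelOn N f fJ m s2 sc)
    (hband : BandwidthCondition S h lam)
    (hr : 2 ≤ r) (hmom : MomentCondition P S h m N r)
    (hvar : 0 < kernelRoughness k ^ (dI + dC) * f x * s2 x
      + lam * kernelRoughness k ^ dC * fJ 2 (diagPoint 2 x) * sc (diagPoint 2 x))
    (htail : HasCompactSupport (productKernel k : Regressor dI dC → ℝ) ∨
      HasModerateGrowth f fJ m s2) :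
    TendstoInDistribution
      (fun t ω => √(((S t).n : ℝ) * h t ^ (dI + dC)) *
        ((S t).nadarayaWatson k (h t) x ω - m x - h t ^ 2 * biasNW k f m x))
      atTop (id : ℝ → ℝ) P
      (gaussianReal 0 (asymptoticVarianceNW k lam f fJ s2 sc x).toNNReal) := by
  have hc := densityControl (k := k) hband.pos hband.tendsto_zero hdgp.measurable_f hdgp.f_nonneg
    (hdgp.measurable_fJ 2) (hdgp.fJ_nonneg 2) hN hxN hsmooth htail
  have hNx := hN.mem_nhds hxN
  have hs2 : ContinuousAt s2 x := hsmooth.continuousOn_s2.continuousAt hNx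
  have hsc : ContinuousAt sc (diagPoint 2 x) :=
    hsmooth.continuousOn_sc.continuousAt ((isOpen_jointNhd hN 2).mem_nhds fun _ => hxN)
  -- U lies in N, so the moment bound holds on it, and it is small enough for σ² and σ(·,·;·) to be
  -- bounded there.
  obtain ⟨U, hU, hxU, hUN, C, hC0, hC, hC2⟩ := exists_nhds_bounds hNx hs2 hsc
  have hUm := hU.measurableSet
  have hmX := fun t g j => hdgp.measurable_m.comp ((S t).measurable_X g j)
  have hasymp : asymptoticVarianceNW k lam f fJ s2 sc x
      = (kernelRoughness k ^ (dI + dC) * (s2 x * f x) + lam *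
        (kernelRoughness k ^ dC * (sc (diagPoint 2 x) * fJ 2 (diagPoint 2 x)))) / f x ^ 2 := by
    rw [asymptoticVarianceNW]
    field_simp
  rw [hasymp]
  refine tendstoInDistribution_gaussianReal_ratio hfx
    (hband.tendsto_effective.eventually_gt_atTop 0 |>.mono fun t hE ω hF =>
      (S t).sqrt_mul_nadarayaWatson_sub U _ hE hF)
    (fun t => (((S t).measurable_nadarayaWatson hk (h t) x).sub_const _ |>.sub_const _).const_mul _)
    (fun t => Finset.measurable_sum _ fun g _ => hdgp.measurable_score hk hUm t (h t) g)
    (fun t => Finset.measurable_sum _ fun g _ => Finset.measurable_sum _ fun j _ =>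
      (((S t).measurable_kern hk (h t) x g j).mul
        (((measurable_oneOn hUm.compl).comp ((S t).measurable_X g j)).mul
          (hdgp.measurable_err t g j))).const_mul _)
    (fun t => Finset.measurable_sum _ fun g _ => Finset.measurable_sum _ fun j _ =>
      (((S t).measurable_kern hk (h t) x g j).mul
        (((hmX t g j).sub_const _).sub_const _)).const_mul _)
    (fun t => Finset.measurable_sum _ fun g _ => Finset.measurable_sum _ fun j _ =>
      (((S t).measurable_kern hk (h t) x g j).mul_const 1).const_mul _)
    (hdgp.tendstoInDistribution_score hdI hk hc hband hs2 hsc hr hmom hU hxU hUN hC0 hC hC2)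
    (fun ε hε => hdgp.tendsto_measure_err_off_ge hk hc hband htail hUm (hU.mem_nhds hxU) hε)
    (fun ε hε => hdgp.tendsto_measure_bias_ge hk hc hband
      (hsmooth.contDiffOn_m.contDiffAt hNx) (hsmooth.contDiffOn_f.contDiffAt hNx) hfx htail hε)
    (fun ε hε => hdgp.tendsto_measure_density_sub_ge hk hc hband hε)
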